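/- **Theorem.** Let $N\ge 2$ be an integer. For $T>0$ let $B^{-1(\ln)}_{\infty\infty}(\mathbb R^N)$ be the space of $N$-vectors $\varphi$ of tempered distributions on $\mathbb R^N$ with $e^{t\Delta}\varphi\in L^\infty(\mathbb R^N)$ for all $t>0$ and $$\|\varphi\|_{B^{-1(\ln)}_{\infty\infty},T}:=\sup_{0<t<T}\sqrt t\,\Big|\ln\Big(\frac{t}{e^2T}\Big)\Big|\,\|e^{t\Delta}\varphi\|_{\infty}<\infty$$ (the space does not depend on $T$, and these norms are equivalent). Let $C_w([0,T],B^{-1(\ln)}_{\infty\infty}(\mathbb R^N))$ be the space of maps from $[0,T]$ to $B^{-1(\ln)}_{\infty\infty}(\mathbb R^N)$ that are continuous for the $*$-weak topology; here the predual of $B^{-1(\ln)}_{\infty\infty}(\mathbb R^N)$ is the completion of $\mathcal S(\mathbb R^N)^N$ for the dual norm, i.e. the closure of $\{\varphi\mapsto\langle\varphi,\Phi\rangle:\Phi\in\mathcal S(\mathbb R^N)^N\}$ in the dual space of $B^{-1(\ln)}_{\infty\infty}(\mathbb R^N)$. Let $\mathscr Y_T$ be the space of real vector fields $\mathbf u$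 with $$\mathbf u\in C_w([0,T],B^{-1(\ln)}_{\infty\infty}(\mathbb R^N))\cap L^\infty_{\rm loc}((0,T),L^\infty(\mathbb R^N)),\qquad \nabla\cdot\mathbf u=0,\qquad \sup_{0<t<T}\sqrt t\,\Big|\ln\Big(\frac t{e^2T}\Big)\Big|\,\|\mathbf u(t)\|_\infty<\infty,$$ with the norm $$\|\mathbf u\|_{\mathscr Y_T}=\sup_{0\le t\le T}\|\mathbf u(t)\|_{B^{-1(\ln)}_{\infty\infty},T}+\sup_{0<t<T}\sqrt t\,\Big|\ln\Big(\frac t{e^2T}\Big)\Big|\,\|\mathbf u(t)\|_\infty .$$ A mild solution in $\mathscr Y_T$ of the Navier–Stokes initial value problem with initial value $\mathbf u_0$ is a $\mathbf u\in\mathscr Y_T$ such that, for all $t\in[0,T]$, $$\mathbf u(t)=e^{t\Delta}\mathbf u_0-\int_0^t e^{(t-\tau)\Delta}\,\mathbb P\nabla\cdot[\mathbf u(\tau)\otimes\mathbf u(\tau)]\,d\tau ,$$ where $\mathbb P$ is the Fourier multiplier with symbol $\big(\delta_{ij}-\xi_i\xi_j/|\xi|^2\big)_{i,j}$ and $e^{s\Delta}\mathbb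 P\nabla\cdot$ ($s>0$) acts on bounded matrix fields by convolution with its $L^1$ kernel. Then for every $T>0$ there is $\varepsilon>0$ such that for every real $\mathbf u_0\in B^{-1(\ln)}_{\infty\infty}(\mathbb R^N)$ with $\nabla\cdot\mathbf u_0=0$ and $\|\mathbf u_0\|_{B^{-1(\ln)}_{\infty\infty},T}\le\varepsilon$ there is a unique mild solution $\mathbf u\in\mathscr Y_T$ with initial value $\mathbf u_0$, and the solution map $\mathbf u_0\mapsto\mathbf u$ from the closed ball $\{\mathbf u_0 \text{ real}:\nabla\cdot\mathbf u_0=0,\ \|\mathbf u_0\|_{B^{-1(\ln)}_{\infty\infty},T}\le\varepsilon\}$ to $\mathscr Y_T$ is Lipschitz continuous: there is $K\ge 0$ (depending on $N$, $T$, $\varepsilon$ only) with $\|\mathbf u-\mathbf v\|_{\mathscr Y_T}\le K\|\mathbf u_0-\mathbf v_0\|_{B^{-1(\ln)}_{\infty\infty},T}$ for the solutions $\mathbf u,\mathbf v$ with initial values $\mathbf u_0,\mathbf v_0$ in this ball. -/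

import Mathlib

open MeasureTheory Set
open scoped ENNReal NNReal SchwartzMap FourierTransform LineDeriv

noncomputable section

namespace LogBesovNS

/-- Physical space `ℝᴺ`. -/
abbrev Space (N : ℕ) := EuclideanSpace ℝ (Fin N)

/-- The values of `N`-vector fields. Distributions act on complex test functions, so values are
taken in `ℂᴺ`; real fields are singled out by `IsReal` below. -/
abbrev Vec (N : ℕ) := EuclideanSpace ℂ (Fin N)

/-- `N`-vectors of tempered distributions on `ℝᴺ`. -/
abbrev VDist (N : ℕ) := 𝓢'(Space N, Vec N)

variable {N : ℕ}

/-- A vector distribution is real if it takes real values on real test functions. -/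
def IsReal (f : VDist N) : Prop :=
  ∀ φ : 𝓢(Space N, ℂ), (∀ x, (φ x).im = 0) → ∀ i, (f φ i).im = 0

/-- `∇ · f = 0` in the sense of distributions. -/
def IsDivFree (f : VDist N) : Prop :=
  ∀ φ : 𝓢(Space N, ℂ), ∑ j, ((∂_{(EuclideanSpace.single j 1 : Space N)} f : VDist N) φ) j = 0

/-! ### The norm of `L^∞(ℝᴺ)`, extended to distributions -/

/-- `‖f‖_∞` if `f` is given by a function of `L^∞(ℝᴺ)`, and `∞` otherwise. -/
def linfNorm (f : VDist N) : ℝ≥0∞ :=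
  ⨅ (g : Lp (Vec N) ∞ (volume : Measure (Space N)))
    (_ : Lp.toTemperedDistribution g = f), ‖g‖ₑ

open Classical in
/-- A bounded function representing the distribution `f`, if `f` belongs to `L^∞(ℝᴺ)`
(it is unique almost everywhere), and `0` otherwise. -/
def linfRep (f : VDist N) : Space N → Vec N :=
  if h : ∃ g : Lp (Vec N) ∞ (volume : Measure (Space N)), Lp.toTemperedDistribution g = f
  then h.choose else 0

theorem linfNorm_zero : linfNorm (0 : VDist N) = 0 := by
  refine le_antisymm ?_ bot_le
  refine (iInf₂_le (0 : Lp (Vec N) ∞ (volume : Measure (Space N))) ?_).trans (by simp)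
  exact map_zero (Lp.toTemperedDistributionCLM (Vec N) volume ∞)

theorem linfNorm_add_le (f g : VDist N) : linfNorm (f + g) ≤ linfNorm f + linfNorm g := by
  simp only [linfNorm, ENNReal.iInf_add, ENNReal.add_iInf]
  refine le_iInf fun a => le_iInf fun ha => le_iInf fun b => le_iInf fun hb => ?_
  refine (iInf₂_le (b + a) ?_).trans (enorm_add_le _ _) |>.trans ?_
  · have := map_add (Lp.toTemperedDistributionCLM (Vec N) (volume : Measure (Space N)) ∞) b a
    simp only [Lp.toTemperedDistributionCLM_apply] at this
    rw [this, ha, hb]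
  · exact le_rfl

theorem linfNorm_smul_le (c : ℂ) (f : VDist N) : linfNorm (c • f) ≤ ‖c‖ₑ * linfNorm f := by
  rcases eq_or_ne c 0 with rfl | hc
  · have h : (0 : ℂ) • f = 0 := zero_smul ℂ f
    rw [h, linfNorm_zero]
    exact bot_le
  have h0 : ‖c‖ₑ ≠ 0 := by simpa using hc
  simp only [linfNorm]
  rw [ENNReal.mul_iInf_of_ne h0 enorm_ne_top]
  refine le_iInf fun a => ?_
  rw [ENNReal.mul_iInf_of_ne h0 enorm_ne_top]
  refine le_iInf fun ha => (iInf₂_le (c • a) ?_).trans (enorm_smul c a).le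
  have := map_smul (Lp.toTemperedDistributionCLM (Vec N) (volume : Measure (Space N)) ∞) c a
  simp only [Lp.toTemperedDistributionCLM_apply] at this
  rw [this, ha]

/-! ### Heat semigroup -/

/-- The symbol of `e^{tΔ}` for the Fourier transform with kernel `e^{-2πi⟨x,ξ⟩}`. -/
def heatSymbol (t : ℝ) (ξ : Space N) : ℂ :=
  ((Real.exp (-(4 * Real.pi ^ 2 * t * ‖ξ‖ ^ 2)) : ℝ) : ℂ)

/-- For `t ≥ 0` the heat symbol is an admissible Fourier multiplier. -/
theorem hasTemperateGrowth_heatSymbol {t : ℝ} (ht : 0 ≤ t) :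
    (heatSymbol t : Space N → ℂ).HasTemperateGrowth := by
  set a : ℝ := -(4 * Real.pi ^ 2 * t) with ha
  have ha0 : a ≤ 0 := by
    rw [ha, neg_nonpos]
    positivity
  have hreal : ((fun s : ℝ => Real.exp (a * s)) ∘
      fun ξ : Space N => ‖ξ‖ ^ 2).HasTemperateGrowth := by
    have hopen : IsOpen (Ioi (-1 : ℝ)) := isOpen_Ioi
    have hsm : ContDiff ℝ (⊤ : ℕ∞) fun s : ℝ => Real.exp (a * s) := by fun_prop
    refine Function.HasTemperateGrowth.comp' (t := Ioi (-1 : ℝ)) ?_ hopen.uniqueDiffOn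
      hsm.contDiffOn ?_ (Function.hasTemperateGrowth_norm_sq (Space N))
    · rintro _ ⟨y, rfl⟩
      exact lt_of_lt_of_le (by norm_num) (sq_nonneg ‖y‖)
    · intro M
      refine ⟨0, ∑ n ∈ Finset.range (M + 1), |a| ^ n * Real.exp |a|, by positivity, ?_⟩
      intro n hn x hx
      rw [norm_iteratedFDerivWithin_eq_norm_iteratedDerivWithin,
        iteratedDerivWithin_of_isOpen hopen hx, iteratedDeriv_exp_const_mul, pow_zero, mul_one,
        norm_mul, norm_pow, Real.norm_eq_abs, Real.norm_eq_abs, Real.abs_exp]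
      refine le_trans ?_ (Finset.single_le_sum (f := fun n => |a| ^ n * Real.exp |a|)
        (fun _ _ => by positivity) (Finset.mem_range.2 (Nat.lt_succ_of_le hn)))
      have hx' : -1 < x := hx
      have : a * x ≤ |a| := by rw [abs_of_nonpos ha0]; nlinarith
      gcongr
  have h := Function.Complex.hasTemperateGrowth_ofReal.comp hreal
  have heq : (heatSymbol t : Space N → ℂ) =
      Complex.ofReal ∘ (fun s : ℝ => Real.exp (a * s)) ∘ fun ξ : Space N => ‖ξ‖ ^ 2 := by
    funext ξ
    simp [heatSymbol, ha]
  rw [heq]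
  exact h

/-- The heat semigroup `e^{tΔ}` (`t ≥ 0`) on tempered distributions. -/
def heat (t : ℝ) : VDist N →L[ℂ] VDist N :=
  TemperedDistribution.fourierMultiplierCLM (Vec N) (heatSymbol t)

/-! ### The space `B^{-1(ln)}_{∞∞}(ℝᴺ)` -/

/-- The weight `√t |ln (t / (e² T))|`. -/
def weight (T t : ℝ) : ℝ := √t * |Real.log (t / (Real.exp 2 * T))|

/-- `sup_{0<t<T} √t |ln (t / (e² T))| ‖e^{tΔ} f‖_∞`. -/
def logBesovNorm (T : ℝ) (f : VDist N) : ℝ≥0∞ :=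
  ⨆ t ∈ Ioo (0 : ℝ) T, ENNReal.ofReal (weight T t) * linfNorm (heat t f)

theorem logBesovNorm_add_le (T : ℝ) (f g : VDist N) :
    logBesovNorm T (f + g) ≤ logBesovNorm T f + logBesovNorm T g := by
  refine iSup₂_le fun (t : ℝ) (ht : t ∈ Ioo (0 : ℝ) T) => ?_
  rw [map_add]
  refine (mul_le_mul_right (linfNorm_add_le _ _) _).trans ?_
  rw [mul_add]
  exact add_le_add (le_iSup₂_of_le t ht le_rfl) (le_iSup₂_of_le t ht le_rfl)

theorem logBesovNorm_smul_le (T : ℝ) (c : ℂ) (f : VDist N) :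
    logBesovNorm T (c • f) ≤ ‖c‖ₑ * logBesovNorm T f := by
  refine iSup₂_le fun (t : ℝ) (ht : t ∈ Ioo (0 : ℝ) T) => ?_
  rw [map_smul]
  refine (mul_le_mul_right (linfNorm_smul_le _ _) _).trans ?_
  rw [mul_left_comm]
  exact mul_le_mul' le_rfl (le_iSup₂_of_le (f := fun (s : ℝ) (_ : s ∈ Ioo (0 : ℝ) T) =>
    ENNReal.ofReal (weight T s) * linfNorm (heat s f)) t ht le_rfl)

/-- The space `B^{-1(ln)}_{∞∞}(ℝᴺ)`, with the norm attached to the time `T > 0`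
(as a vector space it does not depend on `T`, and the norms are equivalent). -/
def LogBesov (N : ℕ) (T : ℝ) : Submodule ℂ (VDist N) where
  carrier := {f | (∀ t, 0 < t → linfNorm (heat t f) < ∞) ∧ logBesovNorm T f < ∞}
  zero_mem' := by
    refine ⟨fun t _ => ?_, ?_⟩
    · rw [map_zero, linfNorm_zero]
      exact ENNReal.zero_lt_top
    · simp [logBesovNorm, map_zero, linfNorm_zero]
  add_mem' := by
    rintro f g ⟨hf, hf'⟩ ⟨hg, hg'⟩
    refine ⟨fun t ht => ?_, (logBesovNorm_add_le T f g).trans_lt (ENNReal.add_lt_top.2 ⟨hf', hg'⟩)⟩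
    rw [map_add]
    exact (linfNorm_add_le _ _).trans_lt (ENNReal.add_lt_top.2 ⟨hf t ht, hg t ht⟩)
  smul_mem' := by
    rintro c f ⟨hf, hf'⟩
    refine ⟨fun t ht => ?_,
      (logBesovNorm_smul_le T c f).trans_lt (ENNReal.mul_lt_top enorm_lt_top hf')⟩
    rw [map_smul]
    exact (linfNorm_smul_le _ _).trans_lt (ENNReal.mul_lt_top enorm_lt_top (hf t ht))

/-- The elements of the predual of `B^{-1(ln)}_{∞∞}(ℝᴺ)`: the predual is the completion of
`𝓢(ℝᴺ)ᴺ` for the norm dual to that of `B^{-1(ln)}_{∞∞}`, that is, it consists of the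
linear functionals on `B^{-1(ln)}_{∞∞}` which are limits, in the norm of the dual space,
of the functionals `f ↦ ⟨f, Φ⟩` with `Φ ∈ 𝓢(ℝᴺ)ᴺ`. -/
def IsPredual (T : ℝ) (ℓ : LogBesov N T →ₗ[ℂ] ℂ) : Prop :=
  ∀ ε : ℝ, 0 < ε → ∃ Φ : Fin N → 𝓢(Space N, ℂ), ∀ f : LogBesov N T,
    ‖ℓ f - ∑ i, (f : VDist N) (Φ i) i‖ₑ ≤ ENNReal.ofReal ε * logBesovNorm T (f : VDist N)

/-- `u ∈ C_w([0,T], B^{-1(ln)}_{∞∞}(ℝᴺ))`: continuity on `[0,T]` for the `∗`-weak topology.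
Only the values of `u` on `[0,T]` matter. -/
def WeakStarContinuous (T : ℝ) (u : ℝ → LogBesov N T) : Prop :=
  ∀ ℓ : LogBesov N T →ₗ[ℂ] ℂ, IsPredual T ℓ → ContinuousOn (fun t => ℓ (u t)) (Icc 0 T)

/-! ### The solution class -/

/-- `sup_{0<t<T} √t |ln (t / (e² T))| ‖u(t)‖_∞`. -/
def pathNorm (T : ℝ) (u : ℝ → LogBesov N T) : ℝ≥0∞ :=
  ⨆ t ∈ Ioo (0 : ℝ) T, ENNReal.ofReal (weight T t) * linfNorm (u t : VDist N)

/-- The norm of the solution class. -/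
def classNorm (T : ℝ) (u : ℝ → LogBesov N T) : ℝ≥0∞ :=
  (⨆ t ∈ Icc (0 : ℝ) T, logBesovNorm T (u t : VDist N)) + pathNorm T u

/-- The class of real fields `u ∈ C_w([0,T], B^{-1(ln)}_{∞∞}) ∩ L^∞_loc((0,T), L^∞)` with
`∇ · u = 0` and `sup_{0<t<T} √t |ln (t / (e² T))| ‖u(t)‖_∞ < ∞`. (The membership in
`L^∞_loc((0,T), L^∞)` is part of `finite`: the weight is bounded below by a positive constant on
compact subintervals of `(0,T)`, and measurability follows from the `∗`-weak continuity.) -/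
structure InClass (T : ℝ) (u : ℝ → LogBesov N T) : Prop where
  real : ∀ t ∈ Icc 0 T, IsReal (u t : VDist N)
  weakStar : WeakStarContinuous T u
  divFree : ∀ t ∈ Icc 0 T, IsDivFree (u t : VDist N)
  finite : pathNorm T u < ∞

/-! ### Mild solutions -/

/-- The symbol of the component `(i, j, k)` of `e^{tΔ} ℙ ∇`, namely
`e^{-4π²t|ξ|²} (δᵢⱼ - ξᵢξⱼ/|ξ|²) 2πi ξₖ`. -/
def oseenSymbol (i j k : Fin N) (t : ℝ) (ξ : Space N) : ℂ :=
  heatSymbol t ξ * (((if i = j then 1 else 0) - ξ i * ξ j / ‖ξ‖ ^ 2 : ℝ) : ℂ) *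
    (2 * Real.pi * Complex.I * (ξ k : ℂ))

/-- The convolution kernel of the component `(i, j, k)` of `e^{tΔ} ℙ ∇`, for `t > 0`; it is a
function of `L¹(ℝᴺ)`. -/
def oseenKernel (i j k : Fin N) (t : ℝ) : Space N → ℂ :=
  𝓕⁻ (oseenSymbol i j k t)

/-- The `i`-th component of `B(u,v)(t) = ∫₀ᵗ e^{(t-τ)Δ} ℙ ∇·[u(τ) ⊗ v(τ)] dτ` at the point `x`,
for `u(τ), v(τ) ∈ L^∞`, where `(∇·[u ⊗ v])ⱼ = ∑ₖ ∂ₖ (uₖ vⱼ)`. -/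
def bilin (u v : ℝ → VDist N) (t : ℝ) (x : Space N) (i : Fin N) : ℂ :=
  ∫ τ in Ioo 0 t, ∑ j, ∑ k, ∫ y, oseenKernel i j k (t - τ) (x - y) *
    (linfRep (u τ) y k * linfRep (v τ) y j)

/-- `u` is a mild solution on `[0,T]` with initial value `u₀`:
`u(t) = e^{tΔ} u₀ - B(u,u)(t)` for all `t ∈ [0,T]`, as distributions
(at `t = 0` this reads `u(0) = u₀`). -/
def IsMildSolution (T : ℝ) (u₀ : LogBesov N T) (u : ℝ → LogBesov N T) : Prop :=
  ∀ t ∈ Icc 0 T, ∀ (φ : 𝓢(Space N, ℂ)) (i : Fin N),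
    (u t : VDist N) φ i = heat t (u₀ : VDist N) φ i -
      ∫ x, φ x * bilin (fun τ => (u τ : VDist N)) (fun τ => (u τ : VDist N)) t x i

end LogBesovNS

end

open LogBesovNS

/-! Put L(t) = 2 + log(T/t), so that the weight is w(t) = √t L(t) on (0,T]. Everything rests on w⁻²
= 1/(t L²) being the derivative of 1/L: a field with |u| ≤ M/w has |u|² just integrable in time at t
= 0, which the scale-invariant bound |u| ≤ M/√t would not give.

Existence. The kernel of e^{tΔ}ℙ∇ is bounded by C(√t+|x|)^{-N-1} (`norm_oseenKernel_le`), so its L¹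
norm is O(t^{-1/2}). With ∫₀ᵗ (s+t-τ)^{-1/2} w(τ)⁻² dτ ≤ 3/w(max(s,t))
(`lintegral_inv_sqrt_mul_inv_weight_sq`) this yields |e^{sΔ}B(u,v)(t)| ≤ C‖u‖‖v‖/w(max(s,t)). The
case s = 0 bounds the path norm of B(u,v); the cases 0 < s < T bound the Besov norm of B(u,v)(t)
uniformly in t, because w is increasing. Picard iteration then converges for small data
(`exists_picard_limit`, `exists_mildSolution`). Weak-* continuity follows from the uniform Besov
bound and continuity against test functions. The latter is dominated convergence, since the
correlation of a test function with the kernel is O((1+|y|)^{-N-1}) uniformly in time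
(`exists_norm_oseenCorr_le`).

Uniqueness must hold in the whole class, without smallness, so the contraction estimate is not
enough. For two solutions U, V put δ = U - V, so that δ = -(B(U,δ) + B(δ,V)), and consider the
energy ∬ e^{-λ/L(t)} (1+|x|)^{-N-1} |δ|² dx dt. Plancherel gives the square function bound ∫₀ᵀ ‖K_t
* h‖₂² dt ≤ 2‖h‖₂², which localises to the weight (1+|x|)^{-N-1} (`exists_weighted_square_bound`).
Cauchy-Schwarz in τ against w⁻²e^{λ/L} costs only λ⁻¹e^{λ/L(t)}, and the factor w² left over cancels
the squares of |U|, |V| ≤ M/w. Hence the energy is at most C M² λ⁻¹ times itself; it is finite, and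
a large λ forces δ = 0 (`exists_energy_duhamel_le`, `ae_eq_of_nlin_eq`).

Lipschitz dependence. By uniqueness every solution with small data is the Picard solution, hence
small, and the difference estimate can be absorbed (`classNorm_sub_le`).

An element of the class only provides one distribution per time. To use Fubini one first needs a
bounded, jointly measurable representative, built by mollification from weak continuity
(`exists_measurable_rep`). -/

noncomputable section

namespace LogBesovNS

open Filter Topology

/-! ### The weight -/

/-- The logarithmic factor `2 + log (T / t)` of the weight. -/
def logFactor (T t : ℝ) : ℝ := 2 + (Real.log T - Real.log t)

theorem two_le_logFactor {T t : ℝ} (ht : 0 < t) (htT : t ≤ T) : 2 ≤ logFactor T t := by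
  have := Real.log_le_log ht htT
  unfold logFactor; linarith

theorem logFactor_pos {T t : ℝ} (ht : 0 < t) (htT : t ≤ T) : 0 < logFactor T t := by
  linarith [two_le_logFactor ht htT]

theorem logFactor_anti {T s t : ℝ} (hs : 0 < s) (hst : s ≤ t) : logFactor T t ≤ logFactor T s := by
  have := Real.log_le_log hs hst
  unfold logFactor; linarith

theorem weight_eq {T t : ℝ} (ht : 0 < t) (htT : t ≤ T) : weight T t = √t * logFactor T t := by
  have hT : 0 < T := ht.trans_le htT
  have h : Real.log (t / (Real.exp 2 * T)) = -logFactor T t := by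
    rw [Real.log_div ht.ne' (by positivity), Real.log_mul (by positivity) hT.ne', Real.log_exp]
    unfold logFactor; ring
  rw [weight, h, abs_neg, abs_of_pos (logFactor_pos ht htT)]

theorem weight_pos {T t : ℝ} (ht : 0 < t) (htT : t ≤ T) : 0 < weight T t := by
  rw [weight_eq ht htT]
  exact mul_pos (Real.sqrt_pos.2 ht) (logFactor_pos ht htT)

theorem measurable_weight (T : ℝ) : Measurable (weight T) := by
  unfold weight; fun_prop

/-- The derivative of √x L(x) is (L(x) - 2)/(2√x), and L ≥ 2 on (0,T]. This is the role of the
factor e² in the weight. -/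
theorem weight_mono {T s t : ℝ} (hs : 0 < s) (hst : s ≤ t) (htT : t ≤ T) :
    weight T s ≤ weight T t := by
  have hder : ∀ x ∈ Ioi (0 : ℝ), HasDerivAt (fun x => √x * logFactor T x)
      (1 / (2 * √x) * logFactor T x + √x * (0 + (0 - x⁻¹))) x := fun x hx =>
    (Real.hasDerivAt_sqrt (ne_of_gt hx)).mul
      ((hasDerivAt_const x (2 : ℝ)).add ((hasDerivAt_const x _).sub
        (Real.hasDerivAt_log (ne_of_gt hx))))
  have hmono : MonotoneOn (fun x => √x * logFactor T x) (Icc s T) := by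
    apply monotoneOn_of_deriv_nonneg (convex_Icc s T)
    · exact fun x hx => (hder x (hs.trans_le hx.1)).continuousAt.continuousWithinAt
    · exact fun x hx => (hder x (hs.trans_le (interior_subset hx).1)).differentiableAt.differentiableWithinAt
    · intro x hx
      have hx' := interior_subset hx
      have hx0 : 0 < x := hs.trans_le hx'.1
      rw [(hder x hx0).deriv]
      have h2 := two_le_logFactor hx0 hx'.2
      have hsq : 0 < √x := Real.sqrt_pos.2 hx0
      have : √x * (0 + (0 - x⁻¹)) = -(1 / √x) := by
        have : x⁻¹ = (√x)⁻¹ * (√x)⁻¹ := by rw [← mul_inv, Real.mul_self_sqrt hx0.le]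
        rw [this]; field_simp; ring
      rw [this]
      have : 1 / (2 * √x) * 2 ≤ 1 / (2 * √x) * logFactor T x := by gcongr
      have h3 : 1 / (2 * √x) * 2 = 1 / √x := by field_simp
      linarith
  rw [weight_eq hs (hst.trans htT), weight_eq (hs.trans_le hst) htT]
  exact hmono ⟨le_rfl, hst.trans htT⟩ ⟨hst, htT⟩ hst

theorem inv_weight_anti {T s t : ℝ} (hs : 0 < s) (hst : s ≤ t) (htT : t ≤ T) :
    (weight T t)⁻¹ ≤ (weight T s)⁻¹ :=
  inv_anti₀ (weight_pos hs (hst.trans htT)) (weight_mono hs hst htT)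

/-! ### Time integrals against the weight -/

/-- Integral of a nonnegative derivative. -/
theorem lintegral_deriv_of_nonneg {g g' : ℝ → ℝ} {a b : ℝ} (hab : a ≤ b)
    (hcont : ContinuousOn g (Icc a b)) (hderiv : ∀ x ∈ Ioo a b, HasDerivAt g (g' x) x)
    (hpos : ∀ x ∈ Ioo a b, 0 ≤ g' x) :
    ∫⁻ x in Ioo a b, ENNReal.ofReal (g' x) = ENNReal.ofReal (g b - g a) := by
  have hint := intervalIntegral.integrableOn_deriv_of_nonneg hcont hderiv hpos
  have hint' : IntervalIntegrable g' volume a b := (intervalIntegrable_iff_integrableOn_Ioc_of_le hab).2 hint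
  rw [← intervalIntegral.integral_eq_sub_of_hasDerivAt_of_le hab hcont hderiv hint',
    intervalIntegral.integral_of_le hab, integral_Ioc_eq_integral_Ioo,
    ofReal_integral_eq_lintegral_ofReal (hint.mono_set Ioo_subset_Ioc_self)]
  exact (ae_restrict_iff' measurableSet_Ioo).2 (ae_of_all _ hpos)

theorem tendsto_inv_logFactor (T : ℝ) :
    Tendsto (fun t => (logFactor T t)⁻¹) (𝓝[>] 0) (𝓝 0) := by
  refine Tendsto.inv_tendsto_atTop ?_
  unfold logFactor
  refine tendsto_atTop_add_const_left _ _ ?_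
  simp only [sub_eq_add_neg]
  refine tendsto_atTop_add_const_left _ _ ?_
  exact tendsto_neg_atBot_atTop.comp Real.tendsto_log_nhdsGT_zero

/-- (1/L)' = 1/(tL²) = w⁻²: the logarithm is exactly what makes the square of a field integrable at
t = 0. -/
theorem hasDerivAt_inv_logFactor {T t : ℝ} (ht : 0 < t) (htT : t ≤ T) :
    HasDerivAt (fun x => (logFactor T x)⁻¹) ((weight T t ^ 2)⁻¹) t := by
  have h1 : HasDerivAt (logFactor T) (-t⁻¹) t := by
    have := (hasDerivAt_const t (2 : ℝ)).add ((hasDerivAt_const t (Real.log T)).sub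
        (Real.hasDerivAt_log ht.ne'))
    simpa using! this
  have h2 := h1.fun_inv (logFactor_pos ht htT).ne'
  convert! h2 using 1
  rw [weight_eq ht htT, mul_pow, Real.sq_sqrt ht.le]
  have := (logFactor_pos ht htT).ne'
  field_simp

/-- `∫₀ᵇ w(τ)⁻² dτ = 1 / (2 + log (T / b))`. -/
theorem lintegral_inv_weight_sq {T b : ℝ} (hb : 0 < b) (hbT : b ≤ T) :
    ∫⁻ x in Ioo 0 b, ENNReal.ofReal ((weight T x ^ 2)⁻¹) = ENNReal.ofReal ((logFactor T b)⁻¹) := by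
  -- The convention `Real.log 0 = 0` gives 1/L an irrelevant value at 0; overwriting it by 0 makes
  -- the primitive continuous on [0,b].
  set g : ℝ → ℝ := Function.update (fun x => (logFactor T x)⁻¹) 0 0 with hg
  have hne : ∀ x : ℝ, 0 < x → g =ᶠ[𝓝 x] fun x => (logFactor T x)⁻¹ := by
    intro x hx
    filter_upwards [lt_mem_nhds hx] with y hy
    simp [hg, Function.update_of_ne hy.ne']
  have := lintegral_deriv_of_nonneg (g := g) (g' := fun x => (weight T x ^ 2)⁻¹) hb.le ?_ ?_ ?_
  · rw [this]
    simp [hg, Function.update_of_ne hb.ne']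
  · intro x hx
    rcases hx.1.eq_or_lt with rfl | hx0
    · rw [hg, continuousWithinAt_update_same]
      refine (tendsto_inv_logFactor T).mono_left (nhdsWithin_mono _ ?_)
      exact fun y hy => lt_of_le_of_ne hy.1.1 (Ne.symm hy.2)
    · exact (((hasDerivAt_inv_logFactor hx0 (hx.2.trans hbT)).continuousAt).congr
        (hne x hx0).symm).continuousWithinAt
  · intro x hx
    exact (hasDerivAt_inv_logFactor hx.1 (hx.2.le.trans hbT)).congr_of_eventuallyEq (hne x hx.1)
  · intro x _; positivity

theorem lintegral_inv_sqrt {a b : ℝ} (hab : a ≤ b) :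
    ∫⁻ x in Ioo a b, ENNReal.ofReal ((√(b - x))⁻¹) = ENNReal.ofReal (2 * √(b - a)) := by
  have := lintegral_deriv_of_nonneg (g := fun x => -(2 * √(b - x))) (g' := fun x => (√(b - x))⁻¹)
    hab (by fun_prop) ?_ ?_
  · rw [this]; simp
  · intro x hx
    have h := (((hasDerivAt_id x).const_sub b).sqrt (by simpa using (sub_pos.2 hx.2).ne')).const_mul 2 |>.neg
    convert! h using 1
    simp; field_simp
  · intro x _; positivity

/-- The time integral behind the bilinear estimate. -/
theorem lintegral_inv_sqrt_mul_inv_weight_sq {T s t : ℝ} (hs : 0 ≤ s) (hsT : s ≤ T) (ht : 0 < t)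
    (htT : t ≤ T) :
    ∫⁻ τ in Ioo 0 t, ENNReal.ofReal ((√(s + (t - τ)))⁻¹ * (weight T τ ^ 2)⁻¹) ≤
      ENNReal.ofReal (3 * (weight T (max s t))⁻¹) := by
  have hpull : ∀ (c : ℝ) (b : ℝ), 0 ≤ c → 0 < b → b ≤ T →
      ∫⁻ τ in Ioo 0 b, ENNReal.ofReal (c * (weight T τ ^ 2)⁻¹) =
        ENNReal.ofReal (c * (logFactor T b)⁻¹) := by
    intro c b hc hb hbT
    simp_rw [ENNReal.ofReal_mul hc]
    rw [lintegral_const_mul _ (by have := measurable_weight T; fun_prop), lintegral_inv_weight_sq hb hbT]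
  -- If t ≤ s, the square root is at least √s throughout and ∫w⁻² = 1/L(t) ≤ 1/L(s). If s ≤ t, split
  -- at t/2. On the first half the kernel factor is at most (t/2)^{-1/2}; on the second w(τ) ≥
  -- w(t)/√2 and the kernel factor is integrated. Each half contributes √2/w(t), and 2√2 ≤ 3.
  rcases le_total t s with hts | hst
  · have hs0 : 0 < s := ht.trans_le hts
    rw [max_eq_left hts]
    calc _ ≤ ∫⁻ τ in Ioo 0 t, ENNReal.ofReal ((√s)⁻¹ * (weight T τ ^ 2)⁻¹) := by
          refine setLIntegral_mono' measurableSet_Ioo fun τ hτ => ?_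
          have : s ≤ s + (t - τ) := by linarith [hτ.2]
          gcongr
      _ = ENNReal.ofReal ((√s)⁻¹ * (logFactor T t)⁻¹) := hpull _ _ (by positivity) ht htT
      _ ≤ ENNReal.ofReal ((√s)⁻¹ * (logFactor T s)⁻¹) := by
          gcongr
          exacts [logFactor_pos hs0 hsT, logFactor_anti ht hts]
      _ ≤ _ := by
          rw [weight_eq hs0 hsT, mul_inv]
          have := logFactor_pos hs0 hsT
          refine ENNReal.ofReal_le_ofReal ?_
          have : 0 ≤ (√s)⁻¹ * (logFactor T s)⁻¹ := by positivity
          linarith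
  · rw [max_eq_right hst]
    have hw := weight_pos ht htT
    have hl := two_le_logFactor ht htT
    have ht2 : 0 < t / 2 := by positivity
    have ht2T : t / 2 ≤ T := by linarith
    have hsqrt2 : √(t / 2) = √t / √2 := Real.sqrt_div ht.le 2
    have h2 : √2 * √2 = 2 := Real.mul_self_sqrt (by norm_num)
    have h2' : √2 ≤ 3 / 2 := by
      rw [Real.sqrt_le_left (by norm_num)]; norm_num
    have hst0 : 0 < √t := Real.sqrt_pos.2 ht
    have hhalf : weight T t / √2 ≤ weight T (t / 2) := by
      rw [weight_eq ht htT, weight_eq ht2 ht2T, hsqrt2, div_mul_eq_mul_div]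
      have := logFactor_anti (T := T) ht2 (by linarith : t / 2 ≤ t)
      gcongr
    have hsub : Ioo 0 t ⊆ Ioo 0 (t / 2) ∪ Ico (t / 2) t := by
      intro τ hτ
      rcases lt_or_ge τ (t / 2) with h | h
      · exact Or.inl ⟨hτ.1, h⟩
      · exact Or.inr ⟨h, hτ.2⟩
    have hA : ∫⁻ τ in Ioo 0 (t / 2), ENNReal.ofReal ((√(s + (t - τ)))⁻¹ * (weight T τ ^ 2)⁻¹) ≤
        ENNReal.ofReal (√2 * (weight T t)⁻¹) := by
      calc _ ≤ ∫⁻ τ in Ioo 0 (t / 2), ENNReal.ofReal ((√(t / 2))⁻¹ * (weight T τ ^ 2)⁻¹) := by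
            refine setLIntegral_mono' measurableSet_Ioo fun τ hτ => ?_
            have : t / 2 ≤ s + (t - τ) := by linarith [hτ.2]
            gcongr
        _ = ENNReal.ofReal ((√(t / 2))⁻¹ * (logFactor T (t / 2))⁻¹) :=
            hpull _ _ (by positivity) ht2 ht2T
        _ ≤ _ := by
            rw [← mul_inv, ← weight_eq ht2 ht2T]
            refine ENNReal.ofReal_le_ofReal ?_
            calc _ ≤ (weight T t / √2)⁻¹ := inv_anti₀ (by positivity) hhalf
              _ = _ := by rw [inv_div, div_eq_mul_inv]
    have hB : ∫⁻ τ in Ico (t / 2) t, ENNReal.ofReal ((√(s + (t - τ)))⁻¹ * (weight T τ ^ 2)⁻¹) ≤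
        ENNReal.ofReal (√2 * (weight T t)⁻¹) := by
      calc _ ≤ ∫⁻ τ in Ico (t / 2) t,
              ENNReal.ofReal (2 * (weight T t ^ 2)⁻¹) * ENNReal.ofReal ((√(t - τ))⁻¹) := by
            refine setLIntegral_mono' measurableSet_Ico fun τ hτ => ?_
            rw [← ENNReal.ofReal_mul (by positivity)]
            refine ENNReal.ofReal_le_ofReal ?_
            rw [mul_comm]
            have h1 : t - τ ≤ s + (t - τ) := by linarith
            have h3 : (weight T τ ^ 2)⁻¹ ≤ 2 * (weight T t ^ 2)⁻¹ := by
              have h4 : weight T t / √2 ≤ weight T τ :=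
                hhalf.trans (weight_mono ht2 hτ.1 (hτ.2.le.trans htT))
              have h5 : (weight T τ ^ 2)⁻¹ ≤ ((weight T t / √2) ^ 2)⁻¹ := by
                gcongr
              refine h5.trans_eq ?_
              rw [div_pow, inv_div, pow_two √2, h2, div_eq_mul_inv]
            have : 0 < t - τ := by linarith [hτ.2]
            gcongr
        _ = ENNReal.ofReal (2 * (weight T t ^ 2)⁻¹) * ENNReal.ofReal (2 * √(t / 2)) := by
            rw [lintegral_const_mul _ (by fun_prop), setLIntegral_congr Ioo_ae_eq_Ico.symm,
              lintegral_inv_sqrt (by linarith)]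
            congr 4; ring
        _ ≤ _ := by
            rw [← ENNReal.ofReal_mul (by positivity)]
            refine ENNReal.ofReal_le_ofReal ?_
            have h6 : (weight T t ^ 2)⁻¹ = (weight T t)⁻¹ * ((√t)⁻¹ * (logFactor T t)⁻¹) := by
              rw [← mul_inv √t, ← weight_eq ht htT, pow_two, mul_inv]
            have h7 : 2 * √(t / 2) = √2 * √t := by
              rw [hsqrt2, mul_div_assoc', div_eq_iff (by positivity)]; linear_combination (-√t) * h2
            rw [h6, h7]
            -- The second half produces 2√2/(w(t)L(t)); the bound L ≥ 2 brings it down to √2/w(t).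
            have h8 : (logFactor T t)⁻¹ ≤ 2⁻¹ := inv_anti₀ (by norm_num) hl
            calc _ = √2 * (weight T t)⁻¹ * (2 * (logFactor T t)⁻¹) := by field_simp
              _ ≤ √2 * (weight T t)⁻¹ * (2 * 2⁻¹) := by gcongr
              _ = _ := by ring
    calc _ ≤ _ := lintegral_mono_set hsub
      _ ≤ _ := lintegral_union_le _ _ _
      _ ≤ ENNReal.ofReal (√2 * (weight T t)⁻¹) + ENNReal.ofReal (√2 * (weight T t)⁻¹) :=
          add_le_add hA hB
      _ = ENNReal.ofReal (√2 * (weight T t)⁻¹ + √2 * (weight T t)⁻¹) :=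
          (ENNReal.ofReal_add (by positivity) (by positivity)).symm
      _ ≤ _ := by
          refine ENNReal.ofReal_le_ofReal ?_
          have : 0 < (weight T t)⁻¹ := by positivity
          nlinarith

end LogBesovNS

end

noncomputable section

namespace LogBesovNS

open Filter Topology
open scoped ContDiff Nat

variable {N : ℕ}

/-! ### Gaussian multipliers on the Schwartz space -/

/-- Faà di Bruno for g(|ξ|²) with constants independent of g and linear in the size A of its
derivatives. It is applied to a single exponential for Schwartz decay, and to a difference of two
exponentials for continuity in time, where A is proportional to |t - t₀|. -/
theorem exists_norm_iteratedFDeriv_comp_norm_sq_le (N n : ℕ) :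
    ∃ (k : ℕ) (C : ℝ), 0 ≤ C ∧ ∀ (g : ℝ → ℝ), ContDiff ℝ ∞ g → ∀ (ξ : Space N) (A : ℝ),
      (∀ i ≤ n, |iteratedDeriv i g (‖ξ‖ ^ 2)| ≤ A) → ∀ m ≤ n,
      ‖iteratedFDeriv ℝ m (fun ξ : Space N => ((g (‖ξ‖ ^ 2) : ℝ) : ℂ)) ξ‖ ≤
        C * A * (1 + ‖ξ‖) ^ k := by
  obtain ⟨k, C, hC, h⟩ :=
    (Function.hasTemperateGrowth_norm_sq (Space N)).norm_iteratedFDeriv_le_uniform n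
  refine ⟨k * n, (n ! : ℝ) * (1 + C) ^ n, by positivity, fun g hg ξ A hA m hm => ?_⟩
  have hA0 : 0 ≤ A := (abs_nonneg _).trans (hA 0 (Nat.zero_le _))
  have hcd : ContDiff ℝ ∞ (fun ξ : Space N => ‖ξ‖ ^ 2) := contDiff_norm_sq ℝ
  have h1 : ‖iteratedFDeriv ℝ m (fun ξ : Space N => ((g (‖ξ‖ ^ 2) : ℝ) : ℂ)) ξ‖ =
      ‖iteratedFDeriv ℝ m (g ∘ fun ξ : Space N => ‖ξ‖ ^ 2) ξ‖ :=
    Complex.ofRealLI.norm_iteratedFDeriv_comp_left (f := g ∘ fun ξ : Space N => ‖ξ‖ ^ 2)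
      ((hg.comp hcd).contDiffAt) (by exact_mod_cast le_top)
  rw [h1]
  -- The base must be at least 1: the bound on the i-th derivative of |ξ|² is asked in the form Dⁱ,
  -- and the exponent m is later raised to n.
  have hD1 : 1 ≤ (1 + C) * (1 + ‖ξ‖) ^ k := by
    have h0 : (1 : ℝ) ≤ (1 + ‖ξ‖) ^ k := one_le_pow₀ (by linarith [norm_nonneg ξ])
    nlinarith
  have h2 := norm_iteratedFDeriv_comp_le (n := m) hg hcd (by exact_mod_cast le_top) ξ (C := A)
    (D := (1 + C) * (1 + ‖ξ‖) ^ k)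
    (fun i hi => by
      rw [norm_iteratedFDeriv_eq_norm_iteratedDeriv]; exact hA i (hi.trans hm))
    (fun i hi1 hi => by
      refine (h i (hi.trans hm) ξ).trans ?_
      refine le_trans ?_ (le_self_pow₀ hD1 (by omega))
      gcongr; linarith)
  refine h2.trans ?_
  have h3 : ((1 + C) * (1 + ‖ξ‖) ^ k) ^ m ≤ ((1 + C) * (1 + ‖ξ‖) ^ k) ^ n :=
    pow_le_pow_right₀ hD1 hm
  have h4 : (m ! : ℝ) ≤ n ! := by exact_mod_cast Nat.factorial_le hm
  calc (m ! : ℝ) * A * ((1 + C) * (1 + ‖ξ‖) ^ k) ^ m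
      ≤ (n ! : ℝ) * A * ((1 + C) * (1 + ‖ξ‖) ^ k) ^ n := by gcongr
    _ = _ := by rw [mul_pow, ← pow_mul]; ring

theorem heatSymbol_eq (t : ℝ) : (heatSymbol t : Space N → ℂ) = fun ξ =>
    (((fun s : ℝ => Real.exp (-(4 * Real.pi ^ 2 * t) * s)) (‖ξ‖ ^ 2) : ℝ) : ℂ) := by
  funext ξ; simp [heatSymbol]

theorem contDiff_heatSymbol (t : ℝ) : ContDiff ℝ ∞ (heatSymbol t : Space N → ℂ) := by
  rw [heatSymbol_eq]
  have h1 : ContDiff ℝ ∞ (fun ξ : Space N => ‖ξ‖ ^ 2) := contDiff_norm_sq ℝ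
  have h2 : ContDiff ℝ ∞ fun s : ℝ => Real.exp (-(4 * Real.pi ^ 2 * t) * s) := by fun_prop
  exact Complex.ofRealCLM.contDiff.comp (h2.comp h1)

theorem one_add_pow_mul_exp_le {b : ℝ} (hb : 0 < b) (m : ℕ) :
    ∃ C : ℝ, 0 ≤ C ∧ ∀ r : ℝ, 0 ≤ r → (1 + r) ^ m * Real.exp (-b * r ^ 2) ≤ C := by
  refine ⟨Real.exp b * m ! * (2 / b) ^ m, by positivity, fun r hr => ?_⟩
  have h1 := Real.pow_div_factorial_le_exp (b * (1 + r ^ 2)) (by positivity) m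
  rw [div_le_iff₀ (by positivity)] at h1
  have h2 : (1 + r) ^ m ≤ (2 / b) ^ m * (b * (1 + r ^ 2)) ^ m := by
    rw [← mul_pow]
    refine pow_le_pow_left₀ (by positivity) ?_ _
    have : 2 / b * (b * (1 + r ^ 2)) = 2 * (1 + r ^ 2) := by field_simp
    rw [this]; nlinarith [sq_nonneg (r - 1), sq_nonneg r]
  calc _ ≤ (2 / b) ^ m * (Real.exp (b * (1 + r ^ 2)) * m !) * Real.exp (-b * r ^ 2) := by
        gcongr; exact h2.trans (by gcongr)
    _ = (2 / b) ^ m * m ! * (Real.exp (b * (1 + r ^ 2)) * Real.exp (-b * r ^ 2)) := by ring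
    _ = _ := by rw [← Real.exp_add]; ring_nf

/-- The heat symbol as a Schwartz function, for `t > 0`. -/
def heatSchwartz (t : ℝ) (ht : 0 < t) : 𝓢(Space N, ℂ) where
  toFun := heatSymbol t
  smooth' := contDiff_heatSymbol t
  decay' := by
    intro k n
    obtain ⟨l, C, hC, h⟩ := exists_norm_iteratedFDeriv_comp_norm_sq_le N n
    set b : ℝ := 4 * Real.pi ^ 2 * t with hb
    have hb0 : 0 < b := by positivity
    obtain ⟨A, hA, hA'⟩ := one_add_pow_mul_exp_le hb0 (k + l)
    refine ⟨C * (1 + b) ^ n * A, fun ξ => ?_⟩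
    have h1 := h (fun s : ℝ => Real.exp (-b * s)) (by fun_prop) ξ
      ((1 + b) ^ n * Real.exp (-b * ‖ξ‖ ^ 2)) (fun i hi => by
        rw [iteratedDeriv_exp_const_mul, abs_mul, Real.abs_exp, abs_pow, abs_neg, abs_of_pos hb0]
        gcongr
        calc b ^ i ≤ (1 + b) ^ i := by gcongr; linarith
          _ ≤ _ := pow_le_pow_right₀ (by linarith) hi) n le_rfl
    rw [heatSymbol_eq]
    refine (mul_le_mul_of_nonneg_left h1 (by positivity)).trans ?_
    have h2 : ‖ξ‖ ^ k ≤ (1 + ‖ξ‖) ^ k := by gcongr; linarith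
    calc _ ≤ (1 + ‖ξ‖) ^ k * (C * ((1 + b) ^ n * Real.exp (-b * ‖ξ‖ ^ 2)) * (1 + ‖ξ‖) ^ l) := by
          gcongr
      _ = C * (1 + b) ^ n * ((1 + ‖ξ‖) ^ (k + l) * Real.exp (-b * ‖ξ‖ ^ 2)) := by
          rw [pow_add]; ring
      _ ≤ _ := by gcongr; exact hA' _ (norm_nonneg _)

/-- The quantity (-z)^i e^{-zs} is the i-th derivative of e^{-zs} in s. The mean value inequality in
the parameter z costs one factor 1 + s, a polynomial growth that Schwartz functions absorb. -/
theorem abs_pow_mul_exp_sub_le {X s x y : ℝ} (hs : 0 ≤ s) (hx : x ∈ Icc 0 X) (hy : y ∈ Icc 0 X)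
    (i : ℕ) :
    |(-x) ^ i * Real.exp (-x * s) - (-y) ^ i * Real.exp (-y * s)| ≤
      ((i + 1) * (1 + X) ^ i * (1 + s)) * |x - y| := by
  have hX : 0 ≤ X := hx.1.trans hx.2
  have hder : ∀ z ∈ Icc 0 X, HasDerivWithinAt (fun z => (-z) ^ i * Real.exp (-z * s))
      ((i * (-z) ^ (i - 1) * (-1)) * Real.exp (-z * s) +
        (-z) ^ i * (Real.exp (-z * s) * (-1 * s))) (Icc 0 X) z := fun z _ =>
    ((((hasDerivAt_id z).neg.fun_pow i)).mul
      (((hasDerivAt_id z).neg.mul_const s).exp)).hasDerivWithinAt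
  have := (convex_Icc 0 X).norm_image_sub_le_of_norm_hasDerivWithin_le (C := (i + 1) * (1 + X) ^ i * (1 + s)) hder
    (fun z hz => ?_) hy hx
  · simpa [Real.norm_eq_abs] using this
  · have he : Real.exp (-z * s) ≤ 1 := by
      rw [Real.exp_le_one_iff]; nlinarith [hz.1]
    have he0 := (Real.exp_pos (-z * s)).le
    have hp : ∀ j ≤ i, |(-z) ^ j| ≤ (1 + X) ^ i := fun j hj => by
      rw [abs_pow, abs_neg, abs_of_nonneg hz.1]
      calc z ^ j ≤ (1 + X) ^ j := pow_le_pow_left₀ hz.1 (by linarith [hz.2]) _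
        _ ≤ _ := pow_le_pow_right₀ (by linarith) hj
    have h1 := hp (i - 1) (Nat.sub_le _ _)
    have h2 := hp i le_rfl
    have hP : 0 ≤ (1 + X) ^ i := by positivity
    refine (norm_add_le _ _).trans ?_
    simp only [Real.norm_eq_abs, abs_mul, abs_neg, abs_one, Nat.abs_cast, mul_one, one_mul, Real.abs_exp, abs_of_nonneg hs]
    calc _ ≤ (i : ℝ) * (1 + X) ^ i * 1 + (1 + X) ^ i * (1 * s) := by gcongr
      _ ≤ _ := by
        have : (0:ℝ) ≤ i := Nat.cast_nonneg i
        nlinarith [mul_nonneg (mul_nonneg this hP) hs]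

/-- Heat symbols act on Schwartz functions continuously in time. -/
theorem continuousOn_smulLeftCLM_heatSymbol (ψ : 𝓢(Space N, ℂ)) :
    ContinuousOn (fun t => SchwartzMap.smulLeftCLM ℂ (heatSymbol t) ψ) (Ici 0) := by
  intro t₀ ht₀
  rw [ContinuousWithinAt, (schwartz_withSeminorms ℂ (Space N) ℂ).tendsto_nhds]
  rintro ⟨k, n⟩ ε hε
  obtain ⟨l, C, hC, h⟩ := exists_norm_iteratedFDeriv_comp_norm_sq_le N n
  set a : ℝ := 4 * Real.pi ^ 2 with ha
  have ha0 : 0 < a := by positivity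
  set X : ℝ := a * (t₀ + 1) with hX
  have ht₀' : 0 ≤ t₀ := ht₀
  have hX0 : 0 ≤ X := by positivity
  -- The exponent collects k from the seminorm, 2 from the factor 1 + |ξ|² of the mean value
  -- inequality and l from the chain rule.
  set S : ℝ := 2 ^ (k + 2 + l) * ((Finset.Iic (k + 2 + l, n)).sup
    fun m => SchwartzMap.seminorm ℂ m.1 m.2) ψ with hS
  have hS0 : 0 ≤ S := by
    rw [hS]; positivity
  set B : ℝ := 2 ^ n * (C * ((n + 1) * (1 + X) ^ n) * a * S) with hB
  have hB0 : 0 ≤ B := by positivity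
  have key : ∀ t ∈ Icc 0 (t₀ + 1), SchwartzMap.seminorm ℂ k n
      (SchwartzMap.smulLeftCLM ℂ (heatSymbol t) ψ - SchwartzMap.smulLeftCLM ℂ (heatSymbol t₀) ψ) ≤
      B * |t - t₀| := by
    intro t ht
    refine SchwartzMap.seminorm_le_bound ℂ k n _ (by positivity) fun ξ => ?_
    set g : ℝ → ℝ := fun s => Real.exp (-(a * t) * s) - Real.exp (-(a * t₀) * s) with hg
    have hgs : ContDiff ℝ ∞ g := by rw [hg]; fun_prop
    have hmem : ∀ s ∈ Icc 0 (t₀ + 1), a * s ∈ Icc 0 X := fun s hs =>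
      ⟨mul_nonneg ha0.le hs.1, by rw [hX]; gcongr; exact hs.2⟩
    have hgd : ∀ i ≤ n, |iteratedDeriv i g (‖ξ‖ ^ 2)| ≤
        (n + 1) * (1 + X) ^ n * (1 + ‖ξ‖) ^ 2 * (a * |t - t₀|) := by
      intro i hi
      have e1 : iteratedDeriv i g (‖ξ‖ ^ 2) =
          (-(a * t)) ^ i * Real.exp (-(a * t) * ‖ξ‖ ^ 2) -
          (-(a * t₀)) ^ i * Real.exp (-(a * t₀) * ‖ξ‖ ^ 2) := by
        rw [hg, iteratedDeriv_fun_sub (by fun_prop) (by fun_prop), iteratedDeriv_exp_const_mul,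
          iteratedDeriv_exp_const_mul]
      rw [e1]
      refine (abs_pow_mul_exp_sub_le (by positivity) (hmem t ht)
        (hmem t₀ ⟨ht₀, by linarith⟩) i).trans ?_
      rw [← mul_sub, abs_mul, abs_of_pos ha0]
      have h1 : (1 + X) ^ i ≤ (1 + X) ^ n := pow_le_pow_right₀ (by linarith) hi
      have h2 : (1 + ‖ξ‖ ^ 2) ≤ (1 + ‖ξ‖) ^ 2 := by nlinarith [norm_nonneg ξ]
      have h3 : (i : ℝ) ≤ n := by exact_mod_cast hi
      gcongr
    have hfun : (⇑(SchwartzMap.smulLeftCLM ℂ (heatSymbol t) ψ -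
        SchwartzMap.smulLeftCLM ℂ (heatSymbol t₀) ψ) : Space N → ℂ) =
        fun ξ => ((g (‖ξ‖ ^ 2) : ℝ) : ℂ) * ψ ξ := by
      funext x
      rw [sub_apply, SchwartzMap.smulLeftCLM_apply_apply (hasTemperateGrowth_heatSymbol ht.1),
        SchwartzMap.smulLeftCLM_apply_apply (hasTemperateGrowth_heatSymbol ht₀),
        heatSymbol_eq, heatSymbol_eq, smul_eq_mul, smul_eq_mul, ← sub_mul, hg]
      rw [ha]; push_cast; rfl
    rw [hfun]
    have hcd : ContDiff ℝ ∞ fun ξ : Space N => ((g (‖ξ‖ ^ 2) : ℝ) : ℂ) :=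
      Complex.ofRealCLM.contDiff.comp (hgs.comp (contDiff_norm_sq ℝ))
    have h1 := norm_iteratedFDeriv_mul_le hcd (ψ.smooth ⊤) ξ (n := n) (by exact_mod_cast le_top)
    have hterm : ∀ i ∈ Finset.range (n + 1), ‖ξ‖ ^ k * ((n.choose i : ℝ) *
        ‖iteratedFDeriv ℝ i (fun ξ : Space N => ((g (‖ξ‖ ^ 2) : ℝ) : ℂ)) ξ‖ *
        ‖iteratedFDeriv ℝ (n - i) ψ ξ‖) ≤
        (n.choose i : ℝ) * (C * ((n + 1) * (1 + X) ^ n) * a * S * |t - t₀|) := by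
      intro i hi
      have h2 := h g hgs ξ _ hgd i (Nat.lt_succ_iff.1 (Finset.mem_range.1 hi))
      have h3 := SchwartzMap.one_add_le_sup_seminorm_apply (𝕜 := ℂ) (m := (k + 2 + l, n))
        (k := k + 2 + l) (n := n - i) le_rfl (Nat.sub_le _ _) ψ ξ
      have h4 : ‖ξ‖ ^ k ≤ (1 + ‖ξ‖) ^ k := by gcongr; linarith
      calc _ ≤ (1 + ‖ξ‖) ^ k * ((n.choose i : ℝ) *
            (C * ((n + 1) * (1 + X) ^ n * (1 + ‖ξ‖) ^ 2 * (a * |t - t₀|)) * (1 + ‖ξ‖) ^ l) *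
            ‖iteratedFDeriv ℝ (n - i) ψ ξ‖) := by gcongr
        _ = (n.choose i : ℝ) * (C * ((n + 1) * (1 + X) ^ n) * a *
            ((1 + ‖ξ‖) ^ (k + 2 + l) * ‖iteratedFDeriv ℝ (n - i) ψ ξ‖) * |t - t₀|) := by
            rw [pow_add, pow_add]; ring
        _ ≤ _ := by gcongr
    calc _ ≤ ‖ξ‖ ^ k * _ := mul_le_mul_of_nonneg_left h1 (by positivity)
      _ = ∑ i ∈ Finset.range (n + 1), _ := Finset.mul_sum _ _ _
      _ ≤ ∑ i ∈ Finset.range (n + 1), _ := Finset.sum_le_sum hterm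
      _ = B * |t - t₀| := by
        rw [← Finset.sum_mul, hB]
        have : ∑ i ∈ Finset.range (n + 1), (n.choose i : ℝ) = 2 ^ n := by
          exact_mod_cast Nat.sum_range_choose n
        rw [this]; ring
  have hlim : Tendsto (fun t => B * |t - t₀|) (𝓝[Ici 0] t₀) (𝓝 0) := by
    have : Continuous fun t : ℝ => B * |t - t₀| := by fun_prop
    simpa using (this.tendsto t₀).mono_left (nhdsWithin_le_nhds (s := Ici 0))
  filter_upwards [hlim.eventually (gt_mem_nhds hε), self_mem_nhdsWithin,
    nhdsWithin_le_nhds (gt_mem_nhds (lt_add_one t₀))] with t h1 h2 h3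
  exact (key t ⟨h2, h3.le⟩).trans_lt h1

end LogBesovNS

end

noncomputable section

namespace LogBesovNS

open Filter Topology
open scoped RealInnerProductSpace

variable {N : ℕ}

/-! ### Fourier integrals of multipliers -/

theorem norm_heatSymbol (t : ℝ) (ξ : Space N) :
    ‖heatSymbol t ξ‖ = Real.exp (-(4 * Real.pi ^ 2 * t * ‖ξ‖ ^ 2)) := by
  rw [heatSymbol, Complex.norm_real, Real.norm_eq_abs, Real.abs_exp]

theorem norm_heatSymbol_le_one {t : ℝ} (ht : 0 ≤ t) (ξ : Space N) : ‖heatSymbol t ξ‖ ≤ 1 := by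
  rw [norm_heatSymbol, Real.exp_le_one_iff]
  have : 0 ≤ 4 * Real.pi ^ 2 * t * ‖ξ‖ ^ 2 := by positivity
  linarith

theorem heatSymbol_add (s t : ℝ) (ξ : Space N) :
    heatSymbol (s + t) ξ = heatSymbol s ξ * heatSymbol t ξ := by
  simp only [heatSymbol]
  rw [← Complex.ofReal_mul, ← Real.exp_add]
  congr 2; ring

theorem continuous_heatSymbol_uncurry :
    Continuous fun p : ℝ × Space N => heatSymbol p.1 p.2 := by
  unfold heatSymbol; fun_prop

theorem continuous_heatSymbol (t : ℝ) : Continuous (heatSymbol t : Space N → ℂ) :=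
  (contDiff_heatSymbol t).continuous

theorem heatSymbol_sq_smul (r : ℝ) (t : ℝ) (ξ : Space N) :
    heatSymbol t (r • ξ) = heatSymbol (r ^ 2 * t) ξ := by
  simp only [heatSymbol, norm_smul, mul_pow, Real.norm_eq_abs, sq_abs]
  congr 3; ring

/-- Scaling of the inverse Fourier transform. -/
theorem fourierInv_comp_smul (m : Space N → ℂ) {r : ℝ} (hr : 0 < r) (x : Space N) :
    𝓕⁻ (fun ξ => m (r • ξ)) x = ((r ^ N)⁻¹ : ℝ) • 𝓕⁻ m (r⁻¹ • x) := by
  rw [Real.fourierInv_eq, Real.fourierInv_eq]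
  have := Measure.integral_comp_smul (volume : Measure (Space N))
    (fun ξ => Real.fourierChar ⟪ξ, r⁻¹ • x⟫ • m ξ) r
  rw [finrank_euclideanSpace_fin, abs_of_pos (by positivity)] at this
  rw [← this]
  congr 1; funext ξ
  rw [inner_smul_left, inner_smul_right]
  congr 3
  simp [hr.ne']

/-- Correlation of a Schwartz function with a kernel given by its symbol. -/
theorem integral_mul_fourierInv_sub {m : Space N → ℂ} (hm : Integrable m) (φ : 𝓢(Space N, ℂ))
    (y : Space N) :
    ∫ x, φ x * 𝓕⁻ m (x - y) = 𝓕 (fun ξ => m ξ * 𝓕⁻ (φ : Space N → ℂ) ξ) y := by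
  have h1 : ∀ x, 𝓕⁻ m (x - y) = 𝓕⁻ (fun ξ => Real.fourierChar (-⟪ξ, y⟫) • m ξ) x := by
    intro x
    rw [Real.fourierInv_eq, Real.fourierInv_eq]
    congr 1; funext ξ
    rw [smul_smul, ← AddChar.map_add_eq_mul, inner_sub_right, sub_eq_add_neg]
  simp_rw [h1]
  -- Translating the kernel modulates its symbol; what remains is the self-adjointness of the
  -- Fourier integral, taken for the bilinear form with the opposite sign so that it reads as 𝓕⁻.
  have hm' : Integrable (fun ξ => Real.fourierChar (-⟪ξ, y⟫) • m ξ) :=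
    (Real.fourierIntegral_convergent_iff y).2 hm
  have h2 := VectorFourier.integral_fourierIntegral_smul_eq_flip (μ := volume) (ν := volume)
    (L := -innerₗ (Space N)) Real.continuous_fourierChar (by
      have : Continuous fun p : Space N × Space N => -⟪p.1, p.2⟫ := by fun_prop
      exact this) φ.integrable hm'
  have h3 : ∀ f : Space N → ℂ, VectorFourier.fourierIntegral Real.fourierChar volume
      (-innerₗ (Space N)) f = 𝓕⁻ f := fun f => rfl
  have h4 : ∀ f : Space N → ℂ, VectorFourier.fourierIntegral Real.fourierChar volume
      (-innerₗ (Space N)).flip f = 𝓕⁻ f := by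
    intro f
    rw [← h3]
    congr 1
    ext; simp [real_inner_comm]
  rw [h3, h4] at h2
  simp only [smul_eq_mul] at h2
  rw [← h2, Real.fourier_eq]
  congr 1; funext ξ
  simp only [Circle.smul_def, smul_eq_mul]
  ring

/-- The modulus bound `|ξ| ^ k e^{-4π²t|ξ|²}` is integrable. -/
theorem integrable_norm_pow_mul_heatSymbol {t : ℝ} (ht : 0 < t) (k : ℕ) :
    Integrable fun ξ : Space N => ‖ξ‖ ^ k * ‖heatSymbol t ξ‖ := by
  have := (heatSchwartz t ht : 𝓢(Space N, ℂ)).integrable_pow_mul volume k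
  exact this

theorem integrable_heatSymbol {t : ℝ} (ht : 0 < t) : Integrable (heatSymbol t : Space N → ℂ) :=
  (heatSchwartz t ht : 𝓢(Space N, ℂ)).integrable

/-- Superpositions of heat symbols can be inverted under the integral sign. -/
theorem fourierInv_integral_heatSymbol_mul {A : ℝ} (hA : 0 ≤ A) {S : Set ℝ} (hS : MeasurableSet S)
    (hSA : S ⊆ Ioi A) {f : Space N → ℂ} (hf : Continuous f)
    (hint : ∀ᵐ ξ : Space N, IntegrableOn (fun r => 2 * (4 * Real.pi ^ 2) * r * ‖heatSymbol (r ^ 2) ξ‖) S)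
    {g : Space N → ℝ} (hg : Integrable g)
    (hfg : ∀ᵐ ξ, (∫ r in S, 2 * (4 * Real.pi ^ 2) * r * ‖heatSymbol (r ^ 2) ξ‖) * ‖f ξ‖ ≤ g ξ) (x : Space N) :
    𝓕⁻ (fun ξ => (∫ r in S, ((2 * (4 * Real.pi ^ 2) * r : ℝ) : ℂ) * heatSymbol (r ^ 2) ξ) * f ξ) x =
      ∫ r in S, ((2 * (4 * Real.pi ^ 2) * r : ℝ) : ℂ) * 𝓕⁻ (fun ξ => heatSymbol (r ^ 2) ξ * f ξ) x := by
  set c : ℝ := 2 * (4 * Real.pi ^ 2) with hc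
  have hc0 : 0 < c := by positivity
  have hnorm : ∀ r ∈ S, ∀ ξ : Space N, ‖((c * r : ℝ) : ℂ) * heatSymbol (r ^ 2) ξ‖ =
      c * r * ‖heatSymbol (r ^ 2) ξ‖ := by
    intro r hr ξ
    rw [norm_mul, Complex.norm_real, Real.norm_of_nonneg]
    have : 0 < r := hA.trans_lt (hSA hr)
    positivity
  have hcont : Continuous (Function.uncurry fun (ξ : Space N) (r : ℝ) =>
      Real.fourierChar ⟪ξ, x⟫ • ((((c * r : ℝ) : ℂ) * heatSymbol (r ^ 2) ξ) * f ξ)) := by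
    have h1 : Continuous fun p : Space N × ℝ => heatSymbol (p.2 ^ 2) p.1 :=
      continuous_heatSymbol_uncurry.comp (by fun_prop : Continuous fun p : Space N × ℝ => (p.2 ^ 2, p.1))
    have h2 : Continuous fun p : Space N × ℝ => (Real.fourierChar ⟪p.1, x⟫ : ℂ) :=
      continuous_subtype_val.comp (Real.continuous_fourierChar.comp (by fun_prop))
    simp only [Circle.smul_def, smul_eq_mul]
    fun_prop
  -- Fubini needs absolute integrability, supplied by `hint` in r and by `hfg` in ξ. In the
  -- applications f has a cubic zero at ξ = 0, which pays for the 1/|ξ|² produced by the r integral.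
  have hprod : Integrable (Function.uncurry fun (ξ : Space N) (r : ℝ) =>
      Real.fourierChar ⟪ξ, x⟫ • ((((c * r : ℝ) : ℂ) * heatSymbol (r ^ 2) ξ) * f ξ))
      (volume.prod (volume.restrict S)) := by
    rw [integrable_prod_iff hcont.aestronglyMeasurable]
    have hn : ∀ ξ : Space N, ∀ r ∈ S, ‖Real.fourierChar ⟪ξ, x⟫ •
        ((((c * r : ℝ) : ℂ) * heatSymbol (r ^ 2) ξ) * f ξ)‖ =
        c * r * ‖heatSymbol (r ^ 2) ξ‖ * ‖f ξ‖ := fun ξ r hr => by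
      rw [Circle.norm_smul, norm_mul, hnorm r hr]
    constructor
    · filter_upwards [hint] with ξ hξ
      refine (integrable_norm_iff (hcont.comp (by fun_prop : Continuous fun r : ℝ => (ξ, r))).aestronglyMeasurable).1 ?_
      refine (hξ.mul_const ‖f ξ‖).congr ?_
      exact (ae_restrict_iff' hS).2 (ae_of_all _ fun r hr => (hn ξ r hr).symm)
    · refine hg.mono' ?_ ?_
      · exact hcont.norm.stronglyMeasurable.integral_prod_right.aestronglyMeasurable
      · filter_upwards [hfg] with ξ hξ
        rw [Real.norm_of_nonneg (integral_nonneg fun _ => norm_nonneg _)]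
        refine (le_of_eq ?_).trans hξ
        rw [← integral_mul_const]
        exact setIntegral_congr_fun hS fun r hr => hn ξ r hr
  rw [Real.fourierInv_eq]
  calc _ = ∫ ξ, ∫ r in S, Real.fourierChar ⟪ξ, x⟫ • ((((c * r : ℝ) : ℂ) * heatSymbol (r ^ 2) ξ) * f ξ) := by
        congr 1; funext ξ
        rw [← integral_mul_const]
        exact (integral_smul (Real.fourierChar ⟪ξ, x⟫ : ℂ) _).symm
    _ = ∫ r in S, ∫ ξ, Real.fourierChar ⟪ξ, x⟫ • ((((c * r : ℝ) : ℂ) * heatSymbol (r ^ 2) ξ) * f ξ) :=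
        integral_integral_swap hprod
    _ = _ := by
        congr 1; funext r
        rw [Real.fourierInv_eq, ← integral_const_mul]
        congr 1; funext ξ
        simp only [Circle.smul_def, smul_eq_mul]; ring

/-- This primitive gives e^{-4π²A²q}/q = ∫_A^∞ 8π² r e^{-4π²r²q} dr with q = |ξ|². The singular
factor 1/|ξ|² of the projection ℙ thus becomes a superposition of Gaussians. The variable r is the
square root of time, so that each slice scales by a dilation. -/
theorem hasDerivAt_neg_heat_div {q : ℝ} (hq : q ≠ 0) (r : ℝ) :
    HasDerivAt (fun r => -(Real.exp (-(4 * Real.pi ^ 2 * r ^ 2 * q)) / q))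
      (2 * (4 * Real.pi ^ 2) * r * Real.exp (-(4 * Real.pi ^ 2 * r ^ 2 * q))) r := by
  have h := (((((hasDerivAt_id r).pow 2).const_mul (4 * Real.pi ^ 2)).mul_const q).neg.exp.div_const q).neg
  convert! h using 1
  simp; field_simp

theorem integral_Ioi_heatSymbol {A : ℝ} (hA : 0 ≤ A) {ξ : Space N} (hξ : ξ ≠ 0) :
    IntegrableOn (fun r => 2 * (4 * Real.pi ^ 2) * r * ‖heatSymbol (r ^ 2) ξ‖) (Ioi A) ∧
    ∫ r in Ioi A, 2 * (4 * Real.pi ^ 2) * r * ‖heatSymbol (r ^ 2) ξ‖ =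
      ‖heatSymbol (A ^ 2) ξ‖ / ‖ξ‖ ^ 2 := by
  have hq : 0 < ‖ξ‖ ^ 2 := by positivity
  simp_rw [norm_heatSymbol]
  have hlim : Tendsto (fun r : ℝ => -(Real.exp (-(4 * Real.pi ^ 2 * r ^ 2 * ‖ξ‖ ^ 2)) / ‖ξ‖ ^ 2)) atTop
      (𝓝 0) := by
    have h1 : Tendsto (fun r : ℝ => 4 * Real.pi ^ 2 * ‖ξ‖ ^ 2 * r ^ 2) atTop atTop :=
      (tendsto_pow_atTop (by norm_num)).const_mul_atTop (by positivity)
    have h2 := ((Real.tendsto_exp_neg_atTop_nhds_zero.comp h1).div_const (‖ξ‖ ^ 2)).neg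
    simp only [zero_div, neg_zero] at h2
    refine h2.congr fun r => ?_
    simp only [Function.comp]; congr 4; ring
  have hpos : ∀ r ∈ Ioi A, 0 ≤ 2 * (4 * Real.pi ^ 2) * r *
      Real.exp (-(4 * Real.pi ^ 2 * r ^ 2 * ‖ξ‖ ^ 2)) := fun r hr => by
    have : 0 < r := hA.trans_lt hr
    positivity
  refine ⟨integrableOn_Ioi_deriv_of_nonneg' (fun r _ => hasDerivAt_neg_heat_div hq.ne' r) hpos hlim, ?_⟩
  rw [integral_Ioi_of_hasDerivAt_of_nonneg' (fun r _ => hasDerivAt_neg_heat_div hq.ne' r) hpos hlim]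
  ring

theorem integral_Ioo_heatSymbol {A B : ℝ} (hAB : A ≤ B) {ξ : Space N} (hξ : ξ ≠ 0) :
    ∫ r in Ioo A B, ((2 * (4 * Real.pi ^ 2) * r : ℝ) : ℂ) * heatSymbol (r ^ 2) ξ =
      (heatSymbol (A ^ 2) ξ - heatSymbol (B ^ 2) ξ) / ((‖ξ‖ ^ 2 : ℝ) : ℂ) := by
  have hq : 0 < ‖ξ‖ ^ 2 := by positivity
  have h1 : ∀ r : ℝ, ((2 * (4 * Real.pi ^ 2) * r : ℝ) : ℂ) * heatSymbol (r ^ 2) ξ =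
      ((2 * (4 * Real.pi ^ 2) * r * Real.exp (-(4 * Real.pi ^ 2 * r ^ 2 * ‖ξ‖ ^ 2)) : ℝ) : ℂ) := by
    intro r; rw [heatSymbol]; push_cast; ring
  simp_rw [h1]
  rw [integral_complex_ofReal, ← integral_Ioc_eq_integral_Ioo, ← intervalIntegral.integral_of_le hAB,
    intervalIntegral.integral_eq_sub_of_hasDerivAt (fun r _ => hasDerivAt_neg_heat_div hq.ne' r)
      (Continuous.intervalIntegrable (by fun_prop) _ _)]
  simp only [heatSymbol]
  push_cast; ring

theorem integral_Ioi_heatSymbol_complex {A : ℝ} (hA : 0 ≤ A) {ξ : Space N} (hξ : ξ ≠ 0) :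
    ∫ r in Ioi A, ((2 * (4 * Real.pi ^ 2) * r : ℝ) : ℂ) * heatSymbol (r ^ 2) ξ =
      heatSymbol (A ^ 2) ξ / ((‖ξ‖ ^ 2 : ℝ) : ℂ) := by
  have h1 : ∀ r : ℝ, ((2 * (4 * Real.pi ^ 2) * r : ℝ) : ℂ) * heatSymbol (r ^ 2) ξ =
      ((2 * (4 * Real.pi ^ 2) * r * ‖heatSymbol (r ^ 2) ξ‖ : ℝ) : ℂ) := by
    intro r; rw [norm_heatSymbol, heatSymbol]; push_cast; ring
  simp_rw [h1]
  rw [integral_complex_ofReal, (integral_Ioi_heatSymbol hA hξ).2, norm_heatSymbol, heatSymbol]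
  push_cast; ring

end LogBesovNS

end

noncomputable section

namespace LogBesovNS

open Filter Topology
open scoped RealInnerProductSpace

variable {N : ℕ}

/-! ### The decay function `(1 + |x|)^{-N-1}` -/

/-- The function `(1 + |x|)^{-N-1}`. -/
def decay (x : Space N) : ℝ := ((1 + ‖x‖) ^ (N + 1))⁻¹

theorem decay_pos (x : Space N) : 0 < decay x := by
  unfold decay; positivity

theorem continuous_decay : Continuous (decay : Space N → ℝ) := by
  unfold decay
  refine Continuous.inv₀ (by fun_prop) fun x => by positivity

theorem integrable_decay : Integrable (decay : Space N → ℝ) := by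
  have h := integrable_one_add_norm (E := Space N) (μ := volume) (r := (N + 1 : ℕ))
    (by rw [finrank_euclideanSpace_fin]; exact_mod_cast Nat.lt_succ_self N)
  refine h.congr (ae_of_all _ fun x => ?_)
  show (1 + ‖x‖) ^ (-((N + 1 : ℕ) : ℝ)) = _
  rw [Real.rpow_neg (by positivity), Real.rpow_natCast, decay]

@[simp]
theorem decay_neg (x : Space N) : decay (-x) = decay x := by simp [decay]

/-- `ω(x) ≤ 2^{N+1} ω(y)` as soon as `1 + |y| ≤ 2 (1 + |x|)`. -/
theorem decay_le_of_norm_le {x y : Space N} (h : 1 + ‖y‖ ≤ 2 * (1 + ‖x‖)) :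
    decay x ≤ 2 ^ (N + 1) * decay y := by
  unfold decay
  rw [← div_eq_mul_inv, le_div_iff₀ (by positivity), inv_mul_le_iff₀ (by positivity), mul_comm,
    ← mul_pow]
  exact pow_le_pow_left₀ (by positivity) h _

/-- The longer of x and y has at least half the length of x + y, so its factor is dominated by the
decay at x + y and the other factor is kept. -/
theorem decay_mul_decay_le (x y : Space N) :
    decay x * decay y ≤ 2 ^ (N + 1) * decay (x + y) * (decay x + decay y) := by
  have h1 := norm_add_le x y
  have hx := (decay_pos x).le
  have hy := (decay_pos y).le
  have hxy := (decay_pos (x + y)).le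
  rcases le_total ‖x‖ ‖y‖ with h | h
  · have h2 : decay y ≤ 2 ^ (N + 1) * decay (x + y) := decay_le_of_norm_le (by linarith)
    calc _ ≤ decay x * (2 ^ (N + 1) * decay (x + y)) := by gcongr
      _ = 2 ^ (N + 1) * decay (x + y) * decay x := by ring
      _ ≤ _ := by gcongr; linarith
  · have h2 : decay x ≤ 2 ^ (N + 1) * decay (x + y) := decay_le_of_norm_le (by linarith)
    calc _ ≤ 2 ^ (N + 1) * decay (x + y) * decay y := by gcongr
      _ ≤ _ := by gcongr; linarith

/-- The convolution of the decay function with itself is dominated by the decay function. -/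
theorem integral_decay_mul_decay_sub_le (y : Space N) :
    Integrable (fun x => decay x * decay (x - y)) ∧
    ∫ x, decay x * decay (x - y) ≤ 2 ^ (N + 2) * (∫ x : Space N, decay x) * decay y := by
  have hb : ∀ x : Space N, decay x * decay (x - y) ≤
      2 ^ (N + 1) * decay y * (decay x + decay (x - y)) := by
    intro x
    have := decay_mul_decay_le x (y - x)
    rwa [add_sub_cancel, ← neg_sub x y, decay_neg] at this
  have hi : Integrable (fun x : Space N => 2 ^ (N + 1) * decay y * (decay x + decay (x - y))) :=
    (integrable_decay.add (integrable_decay.comp_sub_right y)).const_mul _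
  have hcont : Continuous fun x : Space N => decay x * decay (x - y) :=
    continuous_decay.mul (continuous_decay.comp (by fun_prop))
  have hint : Integrable (fun x : Space N => decay x * decay (x - y)) :=
    hi.mono' hcont.aestronglyMeasurable (ae_of_all _ fun x => by
      rw [Real.norm_of_nonneg (mul_nonneg (decay_pos _).le (decay_pos _).le)]; exact hb x)
  refine ⟨hint, (integral_mono hint hi hb).trans_eq ?_⟩
  rw [integral_const_mul, integral_add integrable_decay (integrable_decay.comp_sub_right y),
    integral_sub_right_eq_self (decay : Space N → ℝ) y]
  ring

theorem exists_schwartz_norm_le_inv_pow (m : ℕ) (f : 𝓢(Space N, ℂ)) :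
    ∃ C : ℝ, 0 < C ∧ ∀ x, ‖f x‖ ≤ C * ((1 + ‖x‖) ^ m)⁻¹ := by
  set S := 2 ^ m * ((Finset.Iic (m, 0)).sup fun m => SchwartzMap.seminorm ℂ m.1 m.2) f with hS'
  have hS : 0 ≤ S := by positivity
  refine ⟨S + 1, by positivity, fun x => ?_⟩
  have := SchwartzMap.one_add_le_sup_seminorm_apply (𝕜 := ℂ) (m := (m, 0))
    (k := m) (n := 0) le_rfl le_rfl f x
  rw [norm_iteratedFDeriv_zero] at this
  rw [← div_eq_mul_inv, le_div_iff₀ (by positivity), mul_comm]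
  refine this.trans ?_
  rw [hS']
  linarith

theorem exists_schwartz_norm_le_decay (f : 𝓢(Space N, ℂ)) :
    ∃ C : ℝ, 0 < C ∧ ∀ x, ‖f x‖ ≤ C * decay x := exists_schwartz_norm_le_inv_pow (N + 1) f

/-! ### The Oseen kernel -/

/-- The symbol `2πi ξᵢ ξⱼ ξₖ`. -/
def cubicSymbol (i j k : Fin N) (ξ : Space N) : ℂ :=
  2 * Real.pi * Complex.I * ((ξ i * ξ j * ξ k : ℝ) : ℂ)

/-- The symbol `2πi ξₖ`. -/
def gradSymbol (k : Fin N) (ξ : Space N) : ℂ := 2 * Real.pi * Complex.I * (ξ k : ℂ)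

theorem hasTemperateGrowth_coord (i : Fin N) :
    (fun ξ : Space N => ξ i).HasTemperateGrowth :=
  (EuclideanSpace.proj i : Space N →L[ℝ] ℝ).hasTemperateGrowth

theorem hasTemperateGrowth_cubicSymbol (i j k : Fin N) :
    (cubicSymbol i j k : Space N → ℂ).HasTemperateGrowth := by
  have hi := hasTemperateGrowth_coord i
  have hj := hasTemperateGrowth_coord j
  have hk := hasTemperateGrowth_coord k
  have h : (fun ξ : Space N => ξ i * ξ j * ξ k).HasTemperateGrowth := (hi.mul hj).mul hk
  exact (Function.HasTemperateGrowth.const _).mul (Function.Complex.hasTemperateGrowth_ofReal.comp h)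

theorem hasTemperateGrowth_gradSymbol (k : Fin N) :
    (gradSymbol k : Space N → ℂ).HasTemperateGrowth :=
  (Function.HasTemperateGrowth.const _).mul
    (Function.Complex.hasTemperateGrowth_ofReal.comp (hasTemperateGrowth_coord k))

theorem continuous_cubicSymbol (i j k : Fin N) : Continuous (cubicSymbol i j k : Space N → ℂ) := by
  unfold cubicSymbol; fun_prop

theorem abs_coord_le (ξ : Space N) (i : Fin N) : |ξ i| ≤ ‖ξ‖ := by
  simpa using PiLp.norm_apply_le ξ i

theorem norm_gradSymbol_le (k : Fin N) (ξ : Space N) : ‖gradSymbol k ξ‖ ≤ 2 * Real.pi * ‖ξ‖ := by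
  have := abs_coord_le ξ k
  have hp := Real.pi_pos
  simp only [gradSymbol, norm_mul, Complex.norm_ofNat, Complex.norm_real, Complex.norm_I,
    Real.norm_eq_abs, abs_of_pos hp, mul_one]
  gcongr

theorem norm_cubicSymbol_le (i j k : Fin N) (ξ : Space N) :
    ‖cubicSymbol i j k ξ‖ ≤ 2 * Real.pi * ‖ξ‖ ^ 3 := by
  have hp := Real.pi_pos
  simp only [cubicSymbol, norm_mul, Complex.norm_ofNat, Complex.norm_real, Complex.norm_I,
    Real.norm_eq_abs, abs_of_pos hp, mul_one]
  have h : ‖ξ‖ ^ 3 = ‖ξ‖ * ‖ξ‖ * ‖ξ‖ := by ring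
  rw [h]
  gcongr <;> exact abs_coord_le ξ _

/-- Separates the smooth part of the symbol from the part with 1/|ξ|², in which a Gaussian divided
by |ξ|² multiplies a cubic polynomial. The latter is the form to which the superposition formula
applies. -/
theorem oseenSymbol_eq (i j k : Fin N) (t : ℝ) (ξ : Space N) :
    oseenSymbol i j k t ξ = (if i = j then 1 else 0) * (gradSymbol k ξ * heatSymbol t ξ) -
      heatSymbol t ξ / ((‖ξ‖ ^ 2 : ℝ) : ℂ) * cubicSymbol i j k ξ := by
  unfold oseenSymbol gradSymbol cubicSymbol
  push_cast
  split_ifs <;> push_cast <;> ring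

theorem norm_oseenSymbol_le (i j k : Fin N) (t : ℝ) (ξ : Space N) :
    ‖oseenSymbol i j k t ξ‖ ≤ 4 * Real.pi * (‖ξ‖ * ‖heatSymbol t ξ‖) := by
  have h1 := norm_gradSymbol_le k ξ
  have h2 := norm_cubicSymbol_le i j k ξ
  have hp := Real.pi_pos
  rw [oseenSymbol_eq]
  refine (norm_sub_le _ _).trans ?_
  have e1 : ‖(if i = j then (1 : ℂ) else 0) * (gradSymbol k ξ * heatSymbol t ξ)‖ ≤
      2 * Real.pi * (‖ξ‖ * ‖heatSymbol t ξ‖) := by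
    rw [norm_mul, norm_mul]
    have : ‖(if i = j then (1 : ℂ) else 0)‖ ≤ 1 := by split_ifs <;> simp
    calc _ ≤ 1 * (2 * Real.pi * ‖ξ‖ * ‖heatSymbol t ξ‖) := by gcongr
      _ = _ := by ring
  have e2 : ‖heatSymbol t ξ / ((‖ξ‖ ^ 2 : ℝ) : ℂ) * cubicSymbol i j k ξ‖ ≤
      2 * Real.pi * (‖ξ‖ * ‖heatSymbol t ξ‖) := by
    rw [norm_mul, norm_div, Complex.norm_real, Real.norm_of_nonneg (by positivity)]
    rcases eq_or_ne ξ 0 with rfl | hξ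
    · simp
    · have : 0 < ‖ξ‖ := norm_pos_iff.2 hξ
      calc _ ≤ ‖heatSymbol t ξ‖ / ‖ξ‖ ^ 2 * (2 * Real.pi * ‖ξ‖ ^ 3) := by gcongr
        _ = _ := by field_simp
  linarith

theorem measurable_oseenSymbol (i j k : Fin N) (t : ℝ) :
    Measurable (oseenSymbol i j k t : Space N → ℂ) := by
  have h1 := (continuous_heatSymbol (N := N) t).measurable
  unfold oseenSymbol
  fun_prop

theorem integrable_oseenSymbol (i j k : Fin N) {t : ℝ} (ht : 0 < t) :
    Integrable (oseenSymbol i j k t : Space N → ℂ) := by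
  have h := ((integrable_norm_pow_mul_heatSymbol (N := N) ht 1).const_mul (4 * Real.pi))
  refine h.mono' (measurable_oseenSymbol i j k t).aestronglyMeasurable (ae_of_all _ fun ξ => ?_)
  simpa using norm_oseenSymbol_le i j k t ξ

theorem oseenSymbol_smul (i j k : Fin N) {r : ℝ} (hr : 0 < r) (t : ℝ) (ξ : Space N) :
    oseenSymbol i j k t (r • ξ) = r * oseenSymbol i j k (r ^ 2 * t) ξ := by
  have hr' : (r : ℂ) ≠ 0 := by exact_mod_cast hr.ne'
  rw [oseenSymbol_eq, oseenSymbol_eq, heatSymbol_sq_smul]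
  have h1 : gradSymbol k (r • ξ) = r * gradSymbol k ξ := by
    simp [gradSymbol]; ring
  have h2 : cubicSymbol i j k (r • ξ) = r ^ 3 * cubicSymbol i j k ξ := by
    simp [cubicSymbol]; ring
  rw [h1, h2, norm_smul, mul_pow, Real.norm_eq_abs, sq_abs]
  push_cast
  rcases eq_or_ne ξ 0 with rfl | hξ
  · simp [gradSymbol, cubicSymbol]
  · have : (‖ξ‖ : ℂ) ≠ 0 := by exact_mod_cast norm_ne_zero_iff.2 hξ
    field_simp

theorem fourierInv_const_smul (c : ℂ) (f : Space N → ℂ) (x : Space N) :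
    𝓕⁻ (fun ξ => c * f ξ) x = c * 𝓕⁻ f x := by
  rw [Real.fourierInv_eq, Real.fourierInv_eq, ← integral_const_mul]
  congr 1; funext ξ
  simp only [Circle.smul_def, smul_eq_mul]; ring

theorem integrable_fourierInv_integrand {f : Space N → ℂ} (hf : Integrable f) (x : Space N) :
    Integrable fun ξ => Real.fourierChar ⟪ξ, x⟫ • f ξ := by
  have h := (Real.fourierIntegral_convergent_iff (-x)).2 hf
  simpa using h

theorem fourierInv_sub {f g : Space N → ℂ} (hf : Integrable f) (hg : Integrable g) (x : Space N) :
    𝓕⁻ (fun ξ => f ξ - g ξ) x = 𝓕⁻ f x - 𝓕⁻ g x := by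
  rw [Real.fourierInv_eq, Real.fourierInv_eq, Real.fourierInv_eq,
    ← integral_sub (integrable_fourierInv_integrand hf x) (integrable_fourierInv_integrand hg x)]
  congr 1; funext ξ
  rw [smul_sub]

theorem fourierInv_add {f g : Space N → ℂ} (hf : Integrable f) (hg : Integrable g) (x : Space N) :
    𝓕⁻ (fun ξ => f ξ + g ξ) x = 𝓕⁻ f x + 𝓕⁻ g x := by
  rw [Real.fourierInv_eq, Real.fourierInv_eq, Real.fourierInv_eq,
    ← integral_add (integrable_fourierInv_integrand hf x) (integrable_fourierInv_integrand hg x)]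
  congr 1; funext ξ
  rw [smul_add]

/-- Parabolic scaling of the Oseen kernel. -/
theorem oseenKernel_sq (i j k : Fin N) {r : ℝ} (hr : 0 < r) (x : Space N) :
    oseenKernel i j k (r ^ 2) x = ((r ^ (N + 1))⁻¹ : ℝ) * oseenKernel i j k 1 (r⁻¹ • x) := by
  have h := fourierInv_comp_smul (oseenSymbol i j k 1) hr x
  have hr' : (r : ℂ) ≠ 0 := by exact_mod_cast hr.ne'
  simp_rw [oseenSymbol_smul i j k hr, mul_one] at h
  rw [fourierInv_const_smul] at h
  unfold oseenKernel
  rw [← mul_right_inj' hr', h, Complex.real_smul]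
  push_cast
  rw [pow_succ, mul_inv]; field_simp

theorem continuous_oseenKernel (i j k : Fin N) {t : ℝ} (ht : 0 < t) :
    Continuous (oseenKernel i j k t : Space N → ℂ) :=
  VectorFourier.fourierIntegral_continuous Real.continuous_fourierChar
    (by
      have : Continuous fun p : Space N × Space N => -⟪p.1, p.2⟫ := by fun_prop
      exact this)
    (integrable_oseenSymbol i j k ht)

/-- With m = N and c = |x| this sums the slice bounds (r+|x|)^{-N-2} to (1+|x|)^{-N-1}. -/
theorem integral_Ioi_inv_add_pow (m : ℕ) {c : ℝ} (hc : 0 ≤ c) :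
    IntegrableOn (fun r : ℝ => ((r + c) ^ (m + 2))⁻¹) (Ioi 1) ∧
    ∫ r in Ioi 1, ((r + c) ^ (m + 2))⁻¹ = (m + 1 : ℝ)⁻¹ * ((1 + c) ^ (m + 1))⁻¹ := by
  have hder : ∀ r ∈ Ici (1 : ℝ), HasDerivAt (fun r : ℝ => -((m + 1 : ℝ)⁻¹ * ((r + c) ^ (m + 1))⁻¹))
      (((r + c) ^ (m + 2))⁻¹) r := by
    intro r hr
    have hr1 : (1 : ℝ) ≤ r := hr
    have hrc : 0 < r + c := by linarith
    have h := ((((hasDerivAt_id r).add_const c).fun_pow (m + 1)).fun_inv (by simp; positivity)).const_mul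
      (m + 1 : ℝ)⁻¹ |>.neg
    convert! h using 1
    simp only [id, Nat.cast_add, Nat.cast_one, add_tsub_cancel_right, mul_one]
    field_simp
    try ring
  have hlim : Tendsto (fun r : ℝ => -((m + 1 : ℝ)⁻¹ * ((r + c) ^ (m + 1))⁻¹)) atTop (𝓝 0) := by
    have h1 : Tendsto (fun r : ℝ => (r + c) ^ (m + 1)) atTop atTop :=
      (tendsto_pow_atTop (by omega)).comp (tendsto_atTop_add_const_right _ c tendsto_id)
    simpa using (h1.inv_tendsto_atTop.const_mul (m + 1 : ℝ)⁻¹).neg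
  have hpos : ∀ r ∈ Ioi (1 : ℝ), 0 ≤ ((r + c) ^ (m + 2))⁻¹ := by
    intro r hr
    have hr1 : (1 : ℝ) < r := hr
    have : 0 < r + c := by linarith
    positivity
  refine ⟨integrableOn_Ioi_deriv_of_nonneg' hder hpos hlim, ?_⟩
  rw [integral_Ioi_of_hasDerivAt_of_nonneg' hder hpos hlim]
  ring

theorem ae_ne_zero (hN : N ≠ 0) : ∀ᵐ ξ : Space N, ξ ≠ 0 := by
  have : NeZero N := ⟨hN⟩
  exact compl_mem_ae_iff.2 (measure_singleton (0 : Space N))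

theorem norm_ite_one_le (p : Prop) [Decidable p] : ‖(if p then (1 : ℂ) else 0)‖ ≤ 1 := by
  split_ifs <;> simp

/-- The symbol is not smooth at 0, so the kernel is not covered by Schwartz decay. It equals δᵢⱼG(x)
- ∫₁^∞ c r · r^{-N-3} H(x/r) dr with G and H Schwartz; the power N + 3 is the dimension plus the
degree of the cubic. Decay of order N + 2 for H bounds the slice by C(r+|x|)^{-N-2}, and the r
integral loses one power. The origin has measure zero because N ≠ 0. -/
theorem exists_norm_oseenKernel_one_le_aux (hN : N ≠ 0) (i j k : Fin N) :
    ∃ C : ℝ, 0 < C ∧ ∀ x : Space N, ‖oseenKernel i j k 1 x‖ ≤ C * decay x := by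
  set c : ℝ := 2 * (4 * Real.pi ^ 2) with hc
  have hc0 : 0 < c := by positivity
  set G : 𝓢(Space N, ℂ) := 𝓕⁻ (SchwartzMap.smulLeftCLM ℂ (gradSymbol k) (heatSchwartz 1 one_pos)) with hG
  set H : 𝓢(Space N, ℂ) := 𝓕⁻ (SchwartzMap.smulLeftCLM ℂ (cubicSymbol i j k) (heatSchwartz 1 one_pos)) with hH
  have hGx : ∀ x, G x = 𝓕⁻ (fun ξ : Space N => gradSymbol k ξ * heatSymbol 1 ξ) x := by
    intro x
    rw [hG, SchwartzMap.fourierInv_coe]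
    refine congrFun (congrArg (fun f : Space N → ℂ => 𝓕⁻ f) (funext fun ξ => ?_)) x
    rw [SchwartzMap.smulLeftCLM_apply_apply (hasTemperateGrowth_gradSymbol k)]; rfl
  have hHx : ∀ x, H x = 𝓕⁻ (fun ξ : Space N => heatSymbol 1 ξ * cubicSymbol i j k ξ) x := by
    intro x
    rw [hH, SchwartzMap.fourierInv_coe]
    refine congrFun (congrArg (fun f : Space N → ℂ => 𝓕⁻ f) (funext fun ξ => ?_)) x
    rw [SchwartzMap.smulLeftCLM_apply_apply (hasTemperateGrowth_cubicSymbol i j k), smul_eq_mul, mul_comm]; rfl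
  obtain ⟨CG, hCG, hG'⟩ := exists_schwartz_norm_le_decay G
  obtain ⟨CH, hCH, hH'⟩ := exists_schwartz_norm_le_inv_pow (N + 2) H
  have hHr : ∀ r : ℝ, 0 < r → ∀ x : Space N,
      𝓕⁻ (fun ξ : Space N => heatSymbol (r ^ 2) ξ * cubicSymbol i j k ξ) x =
        ((r ^ (N + 3))⁻¹ : ℝ) * H (r⁻¹ • x) := by
    intro r hr x
    have hr' : (r : ℂ) ≠ 0 := by exact_mod_cast hr.ne'
    have h := fourierInv_comp_smul (fun ξ : Space N => heatSymbol 1 ξ * cubicSymbol i j k ξ) hr x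
    rw [← hHx] at h
    have h1 : (fun ξ : Space N => heatSymbol 1 (r • ξ) * cubicSymbol i j k (r • ξ)) =
        fun ξ => ((r : ℂ) ^ 3) * (heatSymbol (r ^ 2) ξ * cubicSymbol i j k ξ) := by
      funext ξ
      rw [heatSymbol_sq_smul, mul_one]
      simp [cubicSymbol]; ring
    rw [h1, fourierInv_const_smul] at h
    rw [← mul_right_inj' (pow_ne_zero 3 hr'), h, Complex.real_smul]
    push_cast
    rw [pow_add, mul_inv]; field_simp
  have hi1 : Integrable fun ξ : Space N => gradSymbol k ξ * heatSymbol 1 ξ := by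
    refine ((SchwartzMap.smulLeftCLM ℂ (gradSymbol k) (heatSchwartz 1 one_pos :
      𝓢(Space N, ℂ))).integrable).congr (ae_of_all _ fun ξ => ?_)
    simp only [SchwartzMap.smulLeftCLM_apply_apply (hasTemperateGrowth_gradSymbol k)]; rfl
  have hsplit : ∀ x : Space N, oseenKernel i j k 1 x =
      (if i = j then 1 else 0) * G x -
      ∫ r in Ioi 1, ((c * r : ℝ) : ℂ) * 𝓕⁻ (fun ξ => heatSymbol (r ^ 2) ξ * cubicSymbol i j k ξ) x := by
    intro x
    have hg3 : Integrable fun ξ : Space N => 2 * Real.pi * (‖ξ‖ ^ 1 * ‖heatSymbol 1 ξ‖) :=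
      (integrable_norm_pow_mul_heatSymbol one_pos 1).const_mul _
    rw [← fourierInv_integral_heatSymbol_mul zero_le_one measurableSet_Ioi subset_rfl
      (continuous_cubicSymbol i j k)
      (by filter_upwards [ae_ne_zero hN] with ξ hξ using (integral_Ioi_heatSymbol zero_le_one hξ).1)
      hg3 (by
        filter_upwards [ae_ne_zero hN] with ξ hξ
        rw [(integral_Ioi_heatSymbol zero_le_one hξ).2]
        have : 0 < ‖ξ‖ := norm_pos_iff.2 hξ
        have h2 := norm_cubicSymbol_le i j k ξ
        rw [one_pow, pow_one]
        calc _ ≤ ‖heatSymbol 1 ξ‖ / ‖ξ‖ ^ 2 * (2 * Real.pi * ‖ξ‖ ^ 3) := by gcongr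
          _ = _ := by field_simp) x, hGx]
    have hae : (fun ξ : Space N => (∫ r in Ioi 1, ((2 * (4 * Real.pi ^ 2) * r : ℝ) : ℂ) * heatSymbol (r ^ 2) ξ) *
        cubicSymbol i j k ξ) =ᵐ[volume] fun ξ => (if i = j then 1 else 0) * (gradSymbol k ξ * heatSymbol 1 ξ) -
          oseenSymbol i j k 1 ξ := by
      filter_upwards [ae_ne_zero hN] with ξ hξ
      rw [integral_Ioi_heatSymbol_complex zero_le_one hξ, oseenSymbol_eq, one_pow]; ring
    rw [Real.fourierInv_congr_ae hae, fourierInv_sub (hi1.const_mul _) (integrable_oseenSymbol i j k one_pos),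
      fourierInv_const_smul, oseenKernel]
    ring
  refine ⟨CG + c * CH * (N + 1 : ℝ)⁻¹, by positivity, fun x => ?_⟩
  rw [hsplit x]
  refine (norm_sub_le _ _).trans ?_
  rw [add_mul]
  refine add_le_add ?_ ?_
  · rw [norm_mul]
    calc _ ≤ 1 * (CG * decay x) := by gcongr; exacts [norm_ite_one_le _, hG' x]
      _ = _ := one_mul _
  · obtain ⟨hI1, hI2⟩ := integral_Ioi_inv_add_pow N (norm_nonneg x)
    have hb := norm_integral_le_of_norm_le (hI1.const_mul (c * CH)) (f := fun r =>
      ((c * r : ℝ) : ℂ) * 𝓕⁻ (fun ξ => heatSymbol (r ^ 2) ξ * cubicSymbol i j k ξ) x) (by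
        refine (ae_restrict_iff' measurableSet_Ioi).2 (ae_of_all _ fun r hr => ?_)
        have hr0 : 0 < r := zero_lt_one.trans hr
        rw [hHr r hr0, norm_mul, Complex.norm_real, Real.norm_of_nonneg (by positivity), norm_mul,
          Complex.norm_real, Real.norm_of_nonneg (by positivity)]
        have h1 := hH' (r⁻¹ • x)
        rw [norm_smul, Real.norm_of_nonneg (by positivity)] at h1
        calc _ ≤ c * r * ((r ^ (N + 3))⁻¹ * (CH * ((1 + r⁻¹ * ‖x‖) ^ (N + 2))⁻¹)) := by gcongr
          _ = c * CH * ((r + ‖x‖) ^ (N + 2))⁻¹ := by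
            have : r + ‖x‖ = r * (1 + r⁻¹ * ‖x‖) := by field_simp
            rw [this, mul_pow, mul_inv, show N + 3 = N + 2 + 1 from rfl, pow_succ r (N + 2)]
            field_simp)
    refine hb.trans_eq ?_
    rw [integral_const_mul, hI2, decay]; ring

end LogBesovNS

end

noncomputable section

namespace LogBesovNS

open Filter Topology
open scoped RealInnerProductSpace

variable {N : ℕ}

/-! ### Kernel bounds at all positive times -/

theorem exists_norm_oseenKernel_one_le (N : ℕ) :
    ∃ C : ℝ, 0 < C ∧ ∀ (i j k : Fin N) (x : Space N), ‖oseenKernel i j k 1 x‖ ≤ C * decay x := by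
  rcases eq_or_ne N 0 with rfl | hN
  · exact ⟨1, one_pos, fun i => i.elim0⟩
  choose C hC h using exists_norm_oseenKernel_one_le_aux hN
  have hsum : ∀ i j k, C i j k ≤ ∑ i, ∑ j, ∑ k, C i j k := fun i j k => by
    calc C i j k ≤ ∑ k, C i j k :=
          Finset.single_le_sum (f := fun k => C i j k) (fun _ _ => (hC _ _ _).le) (Finset.mem_univ k)
      _ ≤ ∑ j, ∑ k, C i j k :=
          Finset.single_le_sum (f := fun j => ∑ k, C i j k)
            (fun _ _ => Finset.sum_nonneg fun _ _ => (hC _ _ _).le) (Finset.mem_univ j)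
      _ ≤ _ := Finset.single_le_sum (f := fun i => ∑ j, ∑ k, C i j k)
            (fun _ _ => Finset.sum_nonneg fun _ _ => Finset.sum_nonneg fun _ _ => (hC _ _ _).le)
            (Finset.mem_univ i)
  have hS0 : 0 ≤ ∑ i, ∑ j, ∑ k, C i j k :=
    Finset.sum_nonneg fun _ _ => Finset.sum_nonneg fun _ _ => Finset.sum_nonneg fun _ _ => (hC _ _ _).le
  refine ⟨1 + ∑ i, ∑ j, ∑ k, C i j k, by positivity, fun i j k x => (h i j k x).trans ?_⟩
  have := (decay_pos x).le
  have := hsum i j k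
  gcongr; linarith

/-- A constant in the pointwise bound for the Oseen kernel. -/
def kernelConst (N : ℕ) : ℝ := (exists_norm_oseenKernel_one_le N).choose

theorem kernelConst_pos : 0 < kernelConst N := (exists_norm_oseenKernel_one_le N).choose_spec.1

theorem norm_oseenKernel_one_le (i j k : Fin N) (x : Space N) :
    ‖oseenKernel i j k 1 x‖ ≤ kernelConst N * decay x :=
  (exists_norm_oseenKernel_one_le N).choose_spec.2 i j k x

theorem oseenKernel_eq (i j k : Fin N) {t : ℝ} (ht : 0 < t) (x : Space N) :
    oseenKernel i j k t x = (((√t) ^ (N + 1))⁻¹ : ℝ) * oseenKernel i j k 1 ((√t)⁻¹ • x) := by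
  conv_lhs => rw [← Real.sq_sqrt ht.le]
  exact oseenKernel_sq i j k (Real.sqrt_pos.2 ht) x

/-- The Oseen kernel is jointly measurable for positive times. -/
theorem exists_measurable_oseenKernel (i j k : Fin N) :
    ∃ K : ℝ → Space N → ℂ, Measurable (Function.uncurry K) ∧
      ∀ t, 0 < t → K t = oseenKernel i j k t := by
  refine ⟨fun t x => (((√t) ^ (N + 1))⁻¹ : ℝ) * oseenKernel i j k 1 ((√t)⁻¹ • x), ?_,
    fun t ht => funext fun x => (oseenKernel_eq i j k ht x).symm⟩
  have h := (continuous_oseenKernel i j k one_pos).measurable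
  have h2 : Measurable fun p : ℝ × Space N => oseenKernel i j k 1 ((√p.1)⁻¹ • p.2) :=
    h.comp (by fun_prop)
  unfold Function.uncurry
  fun_prop

theorem norm_oseenKernel_le_decay (i j k : Fin N) {t : ℝ} (ht : 0 < t) (x : Space N) :
    ‖oseenKernel i j k t x‖ ≤ kernelConst N * (((√t) ^ (N + 1))⁻¹ * decay ((√t)⁻¹ • x)) := by
  rw [oseenKernel_eq i j k ht, norm_mul, Complex.norm_real, Real.norm_of_nonneg (by positivity)]
  have := norm_oseenKernel_one_le i j k ((√t)⁻¹ • x)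
  calc _ ≤ ((√t) ^ (N + 1))⁻¹ * (kernelConst N * decay ((√t)⁻¹ • x)) := by gcongr
    _ = _ := by ring

/-- `|K_t(x)| ≤ C (√t + |x|)^{-N-1}`. -/
theorem norm_oseenKernel_le (i j k : Fin N) {t : ℝ} (ht : 0 < t) (x : Space N) :
    ‖oseenKernel i j k t x‖ ≤ kernelConst N * ((√t + ‖x‖) ^ (N + 1))⁻¹ := by
  refine (norm_oseenKernel_le_decay i j k ht x).trans_eq ?_
  have hr : 0 < √t := Real.sqrt_pos.2 ht
  have : √t + ‖x‖ = √t * (1 + (√t)⁻¹ * ‖x‖) := by field_simp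
  rw [decay, norm_smul, Real.norm_of_nonneg (by positivity), this, mul_pow, mul_inv]

/-- A constant in the `L¹` bound for the Oseen kernel. -/
def kernelMass (N : ℕ) : ℝ := kernelConst N * ∫ x : Space N, decay x

theorem integral_decay_pos : 0 < ∫ x : Space N, decay x := by
  refine integral_pos_of_integrable_nonneg_nonzero (x := 0) continuous_decay integrable_decay
    (fun x => (decay_pos x).le) (decay_pos 0).ne'

theorem kernelMass_pos : 0 < kernelMass N := mul_pos kernelConst_pos integral_decay_pos

theorem integrable_oseenKernel (i j k : Fin N) {t : ℝ} (ht : 0 < t) :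
    Integrable (oseenKernel i j k t : Space N → ℂ) ∧
      ∫ x : Space N, ‖oseenKernel i j k t x‖ ≤ kernelMass N * (√t)⁻¹ := by
  have hr : 0 < √t := Real.sqrt_pos.2 ht
  have hi : Integrable fun x : Space N => kernelConst N * (((√t) ^ (N + 1))⁻¹ * decay ((√t)⁻¹ • x)) :=
    ((integrable_decay.comp_smul (inv_ne_zero hr.ne')).const_mul _).const_mul _
  have hK : Integrable (oseenKernel i j k t : Space N → ℂ) :=
    hi.mono' (continuous_oseenKernel i j k ht).aestronglyMeasurable
      (ae_of_all _ (norm_oseenKernel_le_decay i j k ht))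
  refine ⟨hK, (integral_mono hK.norm hi (norm_oseenKernel_le_decay i j k ht)).trans_eq ?_⟩
  rw [integral_const_mul, integral_const_mul, Measure.integral_comp_inv_smul_of_nonneg _ _ hr.le,
    finrank_euclideanSpace_fin, smul_eq_mul, kernelMass, pow_succ]
  field_simp

theorem lintegral_oseenKernel_le (i j k : Fin N) {t : ℝ} (ht : 0 < t) :
    ∫⁻ x : Space N, ‖oseenKernel i j k t x‖ₑ ≤ ENNReal.ofReal (kernelMass N * (√t)⁻¹) := by
  obtain ⟨h1, h2⟩ := integrable_oseenKernel i j k ht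
  rw [← ofReal_integral_norm_eq_lintegral_enorm h1]
  exact ENNReal.ofReal_le_ofReal h2

theorem norm_oseenKernel_le_const_mul_decay (i j k : Fin N) {t : ℝ} (ht : 0 < t) :
    ∃ C : ℝ, 0 < C ∧ ∀ x : Space N, ‖oseenKernel i j k t x‖ ≤ C * decay x := by
  have hr : 0 < √t := Real.sqrt_pos.2 ht
  set m := min (√t) 1 with hm
  have hm0 : 0 < m := lt_min hr one_pos
  refine ⟨kernelConst N * (m ^ (N + 1))⁻¹, mul_pos kernelConst_pos (by positivity), fun x => ?_⟩
  refine (norm_oseenKernel_le i j k ht x).trans ?_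
  rw [decay, mul_assoc, ← mul_inv, ← mul_pow]
  have : m * (1 + ‖x‖) ≤ √t + ‖x‖ := by
    have h1 : m ≤ √t := min_le_left _ _
    have h2 : m ≤ 1 := min_le_right _ _
    nlinarith [norm_nonneg x]
  have := kernelConst_pos (N := N)
  gcongr

/-! ### Correlations with test functions -/

theorem fourier_eq_fourierInv_neg (f : Space N → ℂ) (y : Space N) : 𝓕 f y = 𝓕⁻ f (-y) := by
  rw [Real.fourierInv_eq_fourier_neg, neg_neg]

/-- The function `y ↦ ∫ φ(x) K_t(x - y) dx`. -/
def oseenCorr (i j k : Fin N) (t : ℝ) (φ : 𝓢(Space N, ℂ)) (y : Space N) : ℂ :=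
  𝓕 (fun ξ => oseenSymbol i j k t ξ * (𝓕⁻ φ : 𝓢(Space N, ℂ)) ξ) y

theorem integral_mul_oseenKernel_sub (i j k : Fin N) {t : ℝ} (ht : 0 < t) (φ : 𝓢(Space N, ℂ))
    (y : Space N) : ∫ x, φ x * oseenKernel i j k t (x - y) = oseenCorr i j k t φ y := by
  rw [oseenCorr, SchwartzMap.fourierInv_coe]
  exact integral_mul_fourierInv_sub (integrable_oseenSymbol i j k ht) φ y

/-- The path s ↦ 𝓕(e^{-4π²s|ξ|²}χ) is continuous from the compact interval [0,T] into the Schwartz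
space, so every seminorm is bounded along it. The seminorms of orders 0 and N + 1 control
(1+|y|)^{N+1}. -/
theorem exists_norm_fourier_heatSymbol_mul_le (χ : 𝓢(Space N, ℂ)) (T : ℝ) :
    ∃ C : ℝ, 0 < C ∧ ∀ s ∈ Icc 0 T, ∀ y,
      ‖𝓕 (fun ξ => heatSymbol s ξ * χ ξ) y‖ ≤ C * decay y := by
  set Φ : ℝ → 𝓢(Space N, ℂ) := fun s => 𝓕 (SchwartzMap.smulLeftCLM ℂ (heatSymbol s) χ) with hΦ
  have hΦc : ContinuousOn Φ (Icc 0 T) :=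
    (FourierTransform.fourierCLM ℂ 𝓢(Space N, ℂ)).continuous.comp_continuousOn
      ((continuousOn_smulLeftCLM_heatSymbol χ).mono Icc_subset_Ici_self)
  have hb : ∀ p : ℕ × ℕ, ∃ C : ℝ, ∀ s ∈ Icc 0 T, SchwartzMap.seminorm ℂ p.1 p.2 (Φ s) ≤ C := by
    intro p
    have hc : ContinuousOn (fun s => SchwartzMap.seminorm ℂ p.1 p.2 (Φ s)) (Icc 0 T) :=
      ((schwartz_withSeminorms ℂ (Space N) ℂ).continuous_seminorm p).comp_continuousOn hΦc
    obtain ⟨C, hC⟩ := isCompact_Icc.exists_bound_of_continuousOn hc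
    exact ⟨C, fun s hs => (le_abs_self _).trans (hC s hs)⟩
  obtain ⟨C0, h0⟩ := hb (0, 0)
  obtain ⟨C1, h1⟩ := hb (N + 1, 0)
  refine ⟨2 ^ N * (max C0 0 + max C1 0) + 1, by positivity, fun s hs y => ?_⟩
  have hfun : 𝓕 (fun ξ => heatSymbol s ξ * χ ξ) y = Φ s y := by
    rw [hΦ, SchwartzMap.fourier_coe]
    refine congrFun (congrArg (fun f : Space N → ℂ => 𝓕 f) (funext fun ξ => ?_)) y
    rw [SchwartzMap.smulLeftCLM_apply_apply (hasTemperateGrowth_heatSymbol hs.1)]; rfl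
  rw [hfun, decay, ← div_eq_mul_inv, le_div_iff₀ (by positivity)]
  have e0 := ((SchwartzMap.norm_le_seminorm ℂ (Φ s) y).trans (h0 s hs)).trans (le_max_left C0 0)
  have e1 := ((SchwartzMap.norm_pow_mul_le_seminorm ℂ (Φ s) (N + 1) y).trans (h1 s hs)).trans
    (le_max_left C1 0)
  have e2 : (1 + ‖y‖) ^ (N + 1) ≤ 2 ^ N * (1 + ‖y‖ ^ (N + 1)) := by
    have := add_pow_le (zero_le_one (α := ℝ)) (norm_nonneg y) (N + 1)
    simpa using this
  calc ‖Φ s y‖ * (1 + ‖y‖) ^ (N + 1) ≤ ‖Φ s y‖ * (2 ^ N * (1 + ‖y‖ ^ (N + 1))) := by gcongr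
    _ = 2 ^ N * (‖Φ s y‖ + ‖y‖ ^ (N + 1) * ‖Φ s y‖) := by ring
    _ ≤ 2 ^ N * (max C0 0 + max C1 0) := by gcongr
    _ ≤ _ := by linarith

theorem integrable_oseenSymbol_mul (i j k : Fin N) {t : ℝ} (ht : 0 ≤ t) (ψ : 𝓢(Space N, ℂ)) :
    Integrable fun ξ => oseenSymbol i j k t ξ * ψ ξ := by
  refine ((ψ.integrable_pow_mul volume 1).const_mul (4 * Real.pi)).mono'
    ((measurable_oseenSymbol i j k t).mul ψ.continuous.measurable).aestronglyMeasurable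
    (ae_of_all _ fun ξ => ?_)
  rw [norm_mul, pow_one]
  have h1 := norm_oseenSymbol_le i j k t ξ
  have h2 := norm_heatSymbol_le_one ht ξ
  have hp := Real.pi_pos
  calc _ ≤ 4 * Real.pi * (‖ξ‖ * 1) * ‖ψ ξ‖ := by gcongr; exact h1.trans (by gcongr)
    _ = _ := by ring

theorem integrable_heatSymbol_mul {t : ℝ} (ht : 0 ≤ t) (ψ : 𝓢(Space N, ℂ)) :
    Integrable fun ξ => heatSymbol t ξ * ψ ξ := by
  refine ψ.integrable.norm.mono'
    ((continuous_heatSymbol t).mul ψ.continuous).aestronglyMeasurable (ae_of_all _ fun ξ => ?_)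
  rw [norm_mul]
  exact mul_le_of_le_one_left (norm_nonneg _) (norm_heatSymbol_le_one ht ξ)

/-- The correlations of a test function with the Oseen kernel are integrable, uniformly in time. -/
theorem exists_norm_oseenCorr_le (i j k : Fin N) {T : ℝ} (hT : 0 < T) (φ : 𝓢(Space N, ℂ)) :
    ∃ C : ℝ, 0 < C ∧ ∀ t ∈ Ioc 0 T, ∀ y, ‖oseenCorr i j k t φ y‖ ≤ C * decay y := by
  have hN : N ≠ 0 := by rintro rfl; exact i.elim0
  set c : ℝ := 2 * (4 * Real.pi ^ 2) with hc
  have hc0 : 0 < c := by positivity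
  set ψ : 𝓢(Space N, ℂ) := 𝓕⁻ φ with hψ
  set χ₁ : 𝓢(Space N, ℂ) := SchwartzMap.smulLeftCLM ℂ (gradSymbol k) ψ with hχ₁
  set χ₃ : 𝓢(Space N, ℂ) := SchwartzMap.smulLeftCLM ℂ (cubicSymbol i j k) ψ with hχ₃
  have hχ₁a : ∀ ξ, χ₁ ξ = gradSymbol k ξ * ψ ξ := fun ξ =>
    SchwartzMap.smulLeftCLM_apply_apply (hasTemperateGrowth_gradSymbol k) ψ ξ
  have hχ₃a : ∀ ξ, χ₃ ξ = cubicSymbol i j k ξ * ψ ξ := fun ξ =>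
    SchwartzMap.smulLeftCLM_apply_apply (hasTemperateGrowth_cubicSymbol i j k) ψ ξ
  obtain ⟨C₁, hC₁, h₁⟩ := exists_norm_fourier_heatSymbol_mul_le χ₁ T
  obtain ⟨C₃, hC₃, h₃⟩ := exists_norm_fourier_heatSymbol_mul_le χ₃ T
  obtain ⟨Cφ, hCφ, hφ⟩ := exists_schwartz_norm_le_decay φ
  obtain ⟨CK, hCK, hK⟩ := norm_oseenKernel_le_const_mul_decay i j k hT
  set CT : ℝ := Cφ * CK * (2 ^ (N + 2) * ∫ x : Space N, decay x) with hCT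
  have hCT0 : 0 < CT := by
    have := integral_decay_pos (N := N)
    positivity
  -- At the fixed time T the kernel itself decays, and the convolution of two decay functions is
  -- again dominated by one.
  have hcorrT : ∀ y, ‖oseenCorr i j k T φ y‖ ≤ CT * decay y := by
    intro y
    rw [← integral_mul_oseenKernel_sub i j k hT φ y]
    obtain ⟨hi, hle⟩ := integral_decay_mul_decay_sub_le y
    refine (norm_integral_le_of_norm_le (hi.const_mul (Cφ * CK)) (ae_of_all _ fun x => ?_)).trans ?_
    · rw [norm_mul]
      have := decay_pos x
      calc _ ≤ (Cφ * decay x) * (CK * decay (x - y)) := by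
            gcongr; exacts [hφ x, hK _]
        _ = _ := by ring
    · rw [integral_const_mul]
      calc _ ≤ Cφ * CK * (2 ^ (N + 2) * (∫ x : Space N, decay x) * decay y) := by gcongr
        _ = _ := by rw [hCT]; ring
  refine ⟨CT + (C₁ + C₁) + c * √T * C₃ * √T, by positivity, fun t ht y => ?_⟩
  have hst : 0 < √t := Real.sqrt_pos.2 ht.1
  have hstT : √t ≤ √T := Real.sqrt_le_sqrt ht.2
  have hsq : √t ^ 2 = t := Real.sq_sqrt ht.1.le
  have hsqT : √T ^ 2 = T := Real.sq_sqrt hT.le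
  have hdiv : ∀ ξ : Space N, ‖cubicSymbol i j k ξ‖ / ‖ξ‖ ^ 2 ≤ 2 * Real.pi * ‖ξ‖ := by
    intro ξ
    have h2 := norm_cubicSymbol_le i j k ξ
    rcases eq_or_ne ξ 0 with rfl | hξ
    · simp
    · have : 0 < ‖ξ‖ := norm_pos_iff.2 hξ
      rw [div_le_iff₀ (by positivity)]
      refine h2.trans_eq (by ring)
  -- The kernel bound degenerates as t → 0, so time t is compared with time T. The difference of the
  -- two symbols is δᵢⱼ times a difference of smooth terms, minus the superposition over √t < r <
  -- √T. All these pieces are Gaussians times fixed Schwartz functions, hence uniformly bounded down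
  -- to t = 0.
  have hsplit : oseenCorr i j k t φ y = oseenCorr i j k T φ y +
      (if i = j then 1 else 0) * (𝓕 (fun ξ => heatSymbol t ξ * χ₁ ξ) y - 𝓕 (fun ξ => heatSymbol T ξ * χ₁ ξ) y) -
      ∫ r in Ioo (√t) (√T), ((c * r : ℝ) : ℂ) * 𝓕 (fun ξ => heatSymbol (r ^ 2) ξ * χ₃ ξ) y := by
    simp_rw [oseenCorr, fourier_eq_fourierInv_neg]
    have hIoo : ∀ ξ : Space N, ξ ≠ 0 →
        IntegrableOn (fun r => 2 * (4 * Real.pi ^ 2) * r * ‖heatSymbol (r ^ 2) ξ‖) (Ioo (√t) (√T)) :=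
      fun ξ hξ => (integral_Ioi_heatSymbol (Real.sqrt_nonneg t) hξ).1.mono_set Ioo_subset_Ioi_self
    rw [← fourierInv_integral_heatSymbol_mul (Real.sqrt_nonneg t) measurableSet_Ioo Ioo_subset_Ioi_self
      χ₃.continuous
      (by filter_upwards [ae_ne_zero hN] with ξ hξ using hIoo ξ hξ)
      ((ψ.integrable_pow_mul volume 1).const_mul (2 * Real.pi)) (by
        filter_upwards [ae_ne_zero hN] with ξ hξ
        have hle : ∫ r in Ioo (√t) (√T), 2 * (4 * Real.pi ^ 2) * r * ‖heatSymbol (r ^ 2) ξ‖ ≤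
            1 / ‖ξ‖ ^ 2 := by
          refine (setIntegral_mono_set (integral_Ioi_heatSymbol (Real.sqrt_nonneg t) hξ).1
            ((ae_restrict_iff' measurableSet_Ioi).2 (ae_of_all _ fun r hr => ?_))
            Ioo_subset_Ioi_self.eventuallyLE).trans ?_
          · have : 0 < r := hst.trans hr
            show 0 ≤ _
            positivity
          · rw [(integral_Ioi_heatSymbol (Real.sqrt_nonneg t) hξ).2]
            gcongr
            exact norm_heatSymbol_le_one (sq_nonneg _) ξ
        rw [hχ₃a, norm_mul, pow_one]
        calc _ ≤ 1 / ‖ξ‖ ^ 2 * (‖cubicSymbol i j k ξ‖ * ‖ψ ξ‖) := by gcongr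
          _ = ‖cubicSymbol i j k ξ‖ / ‖ξ‖ ^ 2 * ‖ψ ξ‖ := by ring
          _ ≤ 2 * Real.pi * ‖ξ‖ * ‖ψ ξ‖ := by gcongr; exact hdiv ξ
          _ = _ := by ring) (-y)]
    have hiT := integrable_oseenSymbol_mul i j k hT.le ψ
    have hit := integrable_oseenSymbol_mul i j k ht.1.le ψ
    have hht := integrable_heatSymbol_mul ht.1.le χ₁
    have hhT := integrable_heatSymbol_mul hT.le χ₁
    have hae : (fun ξ : Space N => (∫ r in Ioo (√t) (√T), ((2 * (4 * Real.pi ^ 2) * r : ℝ) : ℂ) *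
        heatSymbol (r ^ 2) ξ) * χ₃ ξ) =ᵐ[volume] fun ξ =>
          (oseenSymbol i j k T ξ * ψ ξ + (if i = j then 1 else 0) * (heatSymbol t ξ * χ₁ ξ - heatSymbol T ξ * χ₁ ξ)) -
            oseenSymbol i j k t ξ * ψ ξ := by
      filter_upwards [ae_ne_zero hN] with ξ hξ
      rw [integral_Ioo_heatSymbol hstT hξ, hsq, hsqT, oseenSymbol_eq, oseenSymbol_eq, hχ₁a, hχ₃a]
      ring
    have hS : 𝓕⁻ (fun ξ : Space N => (oseenSymbol i j k T ξ * ψ ξ + (if i = j then 1 else 0) *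
        (heatSymbol t ξ * χ₁ ξ - heatSymbol T ξ * χ₁ ξ)) - oseenSymbol i j k t ξ * ψ ξ) (-y) =
        𝓕⁻ (fun ξ => oseenSymbol i j k T ξ * ψ ξ) (-y) + (if i = j then 1 else 0) *
          (𝓕⁻ (fun ξ => heatSymbol t ξ * χ₁ ξ) (-y) - 𝓕⁻ (fun ξ => heatSymbol T ξ * χ₁ ξ) (-y)) -
          𝓕⁻ (fun ξ => oseenSymbol i j k t ξ * ψ ξ) (-y) := by
      have hdiff : Integrable fun ξ : Space N => (if i = j then (1 : ℂ) else 0) *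
          (heatSymbol t ξ * χ₁ ξ - heatSymbol T ξ * χ₁ ξ) := (hht.sub hhT).const_mul _
      have hsum : Integrable fun ξ : Space N => oseenSymbol i j k T ξ * ψ ξ + (if i = j then (1 : ℂ) else 0) *
          (heatSymbol t ξ * χ₁ ξ - heatSymbol T ξ * χ₁ ξ) := hiT.add hdiff
      rw [fourierInv_sub hsum hit, fourierInv_add hiT hdiff, fourierInv_const_smul,
        fourierInv_sub hht hhT]
    rw [Real.fourierInv_congr_ae hae, hS]
    ring
  have hdy := decay_pos y
  have hlast : ‖∫ r in Ioo (√t) (√T), ((c * r : ℝ) : ℂ) * 𝓕 (fun ξ => heatSymbol (r ^ 2) ξ * χ₃ ξ) y‖ ≤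
      c * √T * C₃ * √T * decay y := by
    refine (norm_setIntegral_le_of_norm_le_const (C := c * √T * (C₃ * decay y)) ?_ fun r hr => ?_).trans ?_
    · simp
    · have hr0 : 0 < r := hst.trans hr.1
      rw [norm_mul, Complex.norm_real, Real.norm_of_nonneg (by positivity)]
      have := h₃ (r ^ 2) ⟨by positivity, by
        rw [← hsqT]; exact pow_le_pow_left₀ hr0.le hr.2.le 2⟩ y
      have hr2 := hr.2.le
      gcongr
    · rw [Measure.real, Real.volume_Ioo, ENNReal.toReal_ofReal (by linarith)]
      calc _ ≤ c * √T * (C₃ * decay y) * √T := by gcongr; linarith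
        _ = _ := by ring
  rw [hsplit]
  refine (norm_sub_le _ _).trans ?_
  rw [add_mul]
  refine add_le_add ((norm_add_le _ _).trans ?_) hlast
  rw [add_mul]
  refine add_le_add (hcorrT y) ?_
  rw [norm_mul]
  have e1 := h₁ t ⟨ht.1.le, ht.2⟩ y
  have e2 := h₁ T ⟨hT.le, le_rfl⟩ y
  calc _ ≤ 1 * (C₁ * decay y + C₁ * decay y) := by
        gcongr
        · exact norm_ite_one_le _
        · exact (norm_sub_le _ _).trans (add_le_add e1 e2)
    _ = _ := by ring

theorem continuousOn_oseenCorr (i j k : Fin N) (φ : 𝓢(Space N, ℂ)) (y : Space N) :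
    ContinuousOn (fun t => oseenCorr i j k t φ y) (Ici 0) := by
  set ψ : 𝓢(Space N, ℂ) := 𝓕⁻ φ with hψ
  simp only [oseenCorr, Real.fourier_eq]
  refine continuousOn_of_dominated (bound := fun ξ => 4 * Real.pi * (‖ξ‖ ^ 1 * ‖ψ ξ‖)) ?_ ?_
    ((ψ.integrable_pow_mul volume 1).const_mul (4 * Real.pi)) ?_
  · intro t ht
    exact ((Real.fourierIntegral_convergent_iff y).2 (integrable_oseenSymbol_mul i j k ht ψ)).aestronglyMeasurable
  · intro t ht
    refine ae_of_all _ fun ξ => ?_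
    rw [Circle.norm_smul, norm_mul, pow_one]
    have h1 := norm_oseenSymbol_le i j k t ξ
    have h2 := norm_heatSymbol_le_one ht ξ
    have hp := Real.pi_pos
    calc _ ≤ 4 * Real.pi * (‖ξ‖ * 1) * ‖ψ ξ‖ := by gcongr; exact h1.trans (by gcongr)
      _ = _ := by ring
  · refine ae_of_all _ fun ξ => Continuous.continuousOn ?_
    have h1 : Continuous fun t => heatSymbol t ξ :=
      continuous_heatSymbol_uncurry.comp (by fun_prop : Continuous fun t : ℝ => (t, ξ))
    unfold oseenSymbol
    fun_prop

/-! ### Semigroup, divergence and reality of the kernel, by duality -/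

/-- The heat semigroup on test functions, in the form dual to `heat`. -/
def heatTest (s : ℝ) (φ : 𝓢(Space N, ℂ)) : 𝓢(Space N, ℂ) :=
  𝓕 (SchwartzMap.smulLeftCLM ℂ (heatSymbol s) (𝓕⁻ φ))

theorem heat_apply (s : ℝ) (f : VDist N) (φ : 𝓢(Space N, ℂ)) : heat s f φ = f (heatTest s φ) := rfl

/-- Heat symbols multiply, so moving e^{sΔ} onto the test function merely shifts the time of the
kernel by s. -/
theorem oseenCorr_heatTest (i j k : Fin N) (t : ℝ) {s : ℝ} (hs : 0 ≤ s) (φ : 𝓢(Space N, ℂ))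
    (y : Space N) : oseenCorr i j k t (heatTest s φ) y = oseenCorr i j k (s + t) φ y := by
  unfold oseenCorr heatTest
  rw [FourierTransform.fourierInv_fourier_eq]
  refine congrFun (congrArg (fun f : Space N → ℂ => 𝓕 f) (funext fun ξ => ?_)) y
  rw [SchwartzMap.smulLeftCLM_apply_apply (hasTemperateGrowth_heatSymbol hs), smul_eq_mul, ← mul_assoc]
  congr 1
  rw [oseenSymbol_eq, oseenSymbol_eq, heatSymbol_add]
  ring

/-- The Leray symbol annihilates ξ; the other factors do not depend on i. -/
theorem sum_oseenSymbol_mul_coord (j k : Fin N) (t : ℝ) (ξ : Space N) :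
    ∑ i, oseenSymbol i j k t ξ * (ξ i : ℂ) = 0 := by
  rcases eq_or_ne ξ 0 with rfl | hξ
  · simp
  have h0 : (‖ξ‖ : ℂ) ^ 2 ≠ 0 := pow_ne_zero 2 (by exact_mod_cast norm_ne_zero_iff.2 hξ)
  have hn : ∑ i, (ξ i : ℂ) ^ 2 = (‖ξ‖ : ℂ) ^ 2 := by
    have := EuclideanSpace.real_norm_sq_eq ξ
    exact_mod_cast this.symm
  have h1 : ∀ i, oseenSymbol i j k t ξ * (ξ i : ℂ) =
      heatSymbol t ξ * gradSymbol k ξ * ((if i = j then (ξ i : ℂ) else 0) -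
        (ξ j : ℂ) / (‖ξ‖ : ℂ) ^ 2 * (ξ i : ℂ) ^ 2) := by
    intro i
    unfold oseenSymbol gradSymbol
    push_cast
    split_ifs <;> push_cast <;> ring
  simp_rw [h1, ← Finset.mul_sum, Finset.sum_sub_distrib, ← Finset.mul_sum, hn]
  rw [Finset.sum_ite_eq' Finset.univ j]
  simp only [Finset.mem_univ, if_true]
  rw [div_mul_cancel₀ _ h0, sub_self, mul_zero]

/-- The Oseen kernel is divergence free. -/
theorem sum_oseenCorr_lineDeriv (j k : Fin N) {t : ℝ} (ht : 0 ≤ t) (φ : 𝓢(Space N, ℂ)) (y : Space N) :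
    ∑ i, oseenCorr i j k t (∂_{(EuclideanSpace.single i 1 : Space N)} φ) y = 0 := by
  set ψ : 𝓢(Space N, ℂ) := 𝓕⁻ φ with hψ
  have h1 : ∀ i : Fin N, ∀ ξ, (𝓕⁻ (∂_{(EuclideanSpace.single i 1 : Space N)} φ) : 𝓢(Space N, ℂ)) ξ =
      -(2 * Real.pi * Complex.I) * ((ξ i : ℂ) * ψ ξ) := by
    intro i ξ
    rw [SchwartzMap.fourierInv_lineDerivOp_eq]
    have : (fun x : Space N => ⟪x, (EuclideanSpace.single i 1 : Space N)⟫).HasTemperateGrowth := by fun_prop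
    rw [smul_apply, SchwartzMap.smulLeftCLM_apply_apply this]
    simp [hψ, EuclideanSpace.inner_single_right]
  simp only [oseenCorr, h1, Real.fourier_eq]
  rw [← integral_finsetSum]
  · rw [← integral_zero (Space N) ℂ]
    congr 1; funext ξ
    have h2 : ∀ i : Fin N, Real.fourierChar (-⟪ξ, y⟫) • (oseenSymbol i j k t ξ *
        (-(2 * Real.pi * Complex.I) * ((ξ i : ℂ) * ψ ξ))) =
        (Real.fourierChar (-⟪ξ, y⟫) : ℂ) * (-(2 * Real.pi * Complex.I)) * ψ ξ *
          (oseenSymbol i j k t ξ * (ξ i : ℂ)) := by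
      intro i
      simp only [Circle.smul_def, smul_eq_mul]; ring
    simp_rw [h2, ← Finset.mul_sum, sum_oseenSymbol_mul_coord, mul_zero]
  · intro i _
    refine (Real.fourierIntegral_convergent_iff y).2 ?_
    refine (integrable_oseenSymbol_mul i j k ht
      (𝓕⁻ (∂_{(EuclideanSpace.single i 1 : Space N)} φ))).congr (ae_of_all _ fun ξ => ?_)
    simp only [h1]

/-- The Oseen kernel is real. -/
theorem conj_oseenKernel (i j k : Fin N) (t : ℝ) (x : Space N) :
    (starRingEnd ℂ) (oseenKernel i j k t x) = oseenKernel i j k t x := by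
  have hconj : ∀ ξ : Space N, (starRingEnd ℂ) (oseenSymbol i j k t ξ) = oseenSymbol i j k t (-ξ) := by
    intro ξ
    simp only [oseenSymbol, heatSymbol, map_mul, Complex.conj_ofReal, Complex.conj_I, norm_neg,
      PiLp.neg_apply, Complex.ofReal_neg, map_ofNat]
    ring_nf
  rw [oseenKernel, Real.fourierInv_eq, ← integral_conj, ← integral_neg_eq_self]
  congr 1; funext ξ
  simp only [Circle.smul_def, smul_eq_mul, map_mul, hconj, neg_neg, inner_neg_left]
  rw [AddChar.map_neg_eq_inv, Circle.coe_inv_eq_conj, Complex.conj_conj]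

end LogBesovNS

end

noncomputable section

namespace LogBesovNS

open Filter Topology

variable {N : ℕ}

/-! ### Distributions given by bounded functions -/

/-- The distribution `f` is given by the function `g`, which is bounded by `c`. -/
structure IsRep (f : VDist N) (g : Space N → Vec N) (c : ℝ) : Prop where
  meas : AEStronglyMeasurable g volume
  bound : ∀ᵐ x, ‖g x‖ ≤ c
  eq : ∀ φ : 𝓢(Space N, ℂ), f φ = ∫ x, φ x • g x

theorem IsRep.memLp {f : VDist N} {g : Space N → Vec N} {c : ℝ} (h : IsRep f g c) :
    MemLp g ∞ volume := memLp_top_of_bound h.meas c h.bound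

theorem IsRep.toLp_eq {f : VDist N} {g : Space N → Vec N} {c : ℝ} (h : IsRep f g c) :
    Lp.toTemperedDistribution (h.memLp.toLp g) = f := by
  ext φ : 1
  rw [Lp.toTemperedDistribution_apply, h.eq]
  refine integral_congr_ae ?_
  filter_upwards [h.memLp.coeFn_toLp] with x hx
  rw [hx]

theorem IsRep.linfNorm_le {f : VDist N} {g : Space N → Vec N} {c : ℝ} (h : IsRep f g c) :
    linfNorm f ≤ ENNReal.ofReal c := by
  unfold linfNorm
  refine (iInf₂_le (h.memLp.toLp g) h.toLp_eq).trans ?_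
  rw [Lp.enorm_toLp]
  have := eLpNorm_le_of_ae_bound (p := ∞) h.bound
  simpa using this

theorem Lp.toTemperedDistribution_injective :
    Function.Injective (Lp.toTemperedDistribution :
      Lp (Vec N) ∞ (volume : Measure (Space N)) → VDist N) := by
  have h := Lp.ker_toTemperedDistributionCLM_eq_bot (F := Vec N) (μ := (volume : Measure (Space N))) (p := ∞)
  exact LinearMap.ker_eq_bot.1 h

theorem isRep_coe (g : Lp (Vec N) ∞ (volume : Measure (Space N))) :
    IsRep (Lp.toTemperedDistribution g) g ‖g‖ where
  meas := Lp.aestronglyMeasurable g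
  bound := by
    have h := ae_le_eLpNormEssSup (f := (g : Space N → Vec N)) (μ := volume)
    filter_upwards [h] with x hx
    rw [Lp.norm_def, eLpNorm_exponent_top]
    have hfin : eLpNormEssSup (g : Space N → Vec N) volume ≠ ∞ := by
      rw [← eLpNorm_exponent_top]; exact Lp.eLpNorm_ne_top g
    rw [← toReal_enorm]
    exact ENNReal.toReal_mono hfin hx
  eq φ := Lp.toTemperedDistribution_apply g φ

theorem IsRep.ae_eq {f : VDist N} {g g' : Space N → Vec N} {c c' : ℝ} (h : IsRep f g c)
    (h' : IsRep f g' c') : g =ᵐ[volume] g' := by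
  have := Lp.toTemperedDistribution_injective (h.toLp_eq.trans h'.toLp_eq.symm)
  exact h.memLp.coeFn_toLp.symm.trans ((Filter.EventuallyEq.of_eq (by rw [this])).trans h'.memLp.coeFn_toLp)

/-- By injectivity the infimum defining `linfNorm` runs over at most one function, so whichever
representative was chosen attains it. A finite norm excludes the empty infimum. -/
theorem isRep_linfRep {f : VDist N} {c : ℝ} (hc : 0 ≤ c) (h : linfNorm f ≤ ENNReal.ofReal c) :
    IsRep f (linfRep f) c := by
  have hex : ∃ g : Lp (Vec N) ∞ (volume : Measure (Space N)), Lp.toTemperedDistribution g = f := by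
    by_contra hcon
    push Not at hcon
    have : linfNorm f = ∞ := by simp [linfNorm, hcon]
    rw [this] at h
    exact absurd h (by simp)
  have hrep : linfRep f = hex.choose := by rw [linfRep, dif_pos hex]
  have hspec := hex.choose_spec
  set g := hex.choose with hg
  have hle : ‖g‖ ≤ c := by
    have : ‖g‖ₑ ≤ ENNReal.ofReal c := by
      refine le_trans (le_iInf₂ fun g' hg' => ?_) h
      rw [Lp.toTemperedDistribution_injective (hg'.trans hspec.symm)]
    rwa [← ofReal_norm, ENNReal.ofReal_le_ofReal_iff hc] at this
  rw [hrep]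
  have h0 := isRep_coe g
  rw [hspec] at h0
  exact ⟨h0.meas, h0.bound.mono fun x hx => hx.trans hle, h0.eq⟩

theorem IsRep.congr {f : VDist N} {g g' : Space N → Vec N} {c : ℝ} (h : IsRep f g c)
    (hg : g =ᵐ[volume] g') : IsRep f g' c where
  meas := h.meas.congr hg
  bound := by filter_upwards [h.bound, hg] with x hx he; rwa [← he]
  eq φ := by
    rw [h.eq]
    exact integral_congr_ae (by filter_upwards [hg] with x he; rw [he])

theorem integrable_schwartz_smul (φ : 𝓢(Space N, ℂ)) {g : Space N → Vec N} {c : ℝ}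
    (hg : AEStronglyMeasurable g volume) (hb : ∀ᵐ x, ‖g x‖ ≤ c) :
    Integrable fun x => φ x • g x := by
  refine (φ.integrable.norm.mul_const c).mono' (φ.continuous.aestronglyMeasurable.smul hg) ?_
  filter_upwards [hb] with x hx
  rw [norm_smul]; gcongr

theorem integral_coord {α : Type*} [MeasurableSpace α] {μ : Measure α} {g : α → Vec N}
    (hg : Integrable g μ) (i : Fin N) : (∫ x, g x ∂μ) i = ∫ x, g x i ∂μ :=
  ((EuclideanSpace.proj (𝕜 := ℂ) i : Vec N →L[ℂ] ℂ).integral_comp_comm hg).symm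

theorem IsRep.apply_coord {f : VDist N} {g : Space N → Vec N} {c : ℝ} (h : IsRep f g c)
    (φ : 𝓢(Space N, ℂ)) (i : Fin N) : f φ i = ∫ x, φ x * g x i := by
  rw [h.eq, integral_coord (integrable_schwartz_smul φ h.meas h.bound)]
  rfl

theorem isRep_of_coord {f : VDist N} {g : Space N → Vec N} {c : ℝ}
    (hg : AEStronglyMeasurable g volume) (hb : ∀ᵐ x, ‖g x‖ ≤ c)
    (h : ∀ (φ : 𝓢(Space N, ℂ)) i, f φ i = ∫ x, φ x * g x i) : IsRep f g c where
  meas := hg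
  bound := hb
  eq φ := by
    ext i
    rw [h, integral_coord (integrable_schwartz_smul φ hg hb)]
    rfl

theorem IsRep.sub {f f' : VDist N} {g g' : Space N → Vec N} {c c' : ℝ} (h : IsRep f g c)
    (h' : IsRep f' g' c') : IsRep (f - f') (g - g') (c + c') where
  meas := h.meas.sub h'.meas
  bound := by
    filter_upwards [h.bound, h'.bound] with x hx hx'
    exact (norm_sub_le _ _).trans (add_le_add hx hx')
  eq φ := by
    have : (f - f') φ = f φ - f' φ := rfl
    rw [this, h.eq, h'.eq, ← integral_sub (integrable_schwartz_smul φ h.meas h.bound)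
      (integrable_schwartz_smul φ h'.meas h'.bound)]
    simp [smul_sub]

/-! ### Bounds for the heat semigroup -/

/-- The heat kernel `𝓕⁻ e^{-4π²t|ξ|²}`. -/
def heatKernel (t : ℝ) : Space N → ℂ := 𝓕⁻ (heatSymbol t)

theorem heatKernel_sq {r : ℝ} (hr : 0 < r) (x : Space N) :
    heatKernel (r ^ 2) x = ((r ^ N)⁻¹ : ℝ) * heatKernel 1 (r⁻¹ • x) := by
  have h := fourierInv_comp_smul (heatSymbol 1 : Space N → ℂ) hr x
  have h1 : (fun ξ : Space N => heatSymbol 1 (r • ξ)) = heatSymbol (r ^ 2) := by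
    funext ξ; rw [heatSymbol_sq_smul, mul_one]
  rw [h1] at h
  unfold heatKernel
  rw [h, Complex.real_smul]

theorem integrable_heatKernel_one : Integrable (heatKernel 1 : Space N → ℂ) := by
  have h : (heatKernel 1 : Space N → ℂ) = (𝓕⁻ (heatSchwartz 1 one_pos) : 𝓢(Space N, ℂ)) := by
    rw [SchwartzMap.fourierInv_coe]
    rfl
  rw [h]
  exact SchwartzMap.integrable _

/-- The `L¹` norm of the heat kernel. -/
def heatMass (N : ℕ) : ℝ := ∫ x : Space N, ‖heatKernel 1 x‖

theorem heatMass_nonneg : 0 ≤ heatMass N := integral_nonneg fun _ => norm_nonneg _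

theorem integrable_heatKernel {t : ℝ} (ht : 0 < t) :
    Integrable (heatKernel t : Space N → ℂ) ∧ ∫ x : Space N, ‖heatKernel t x‖ = heatMass N := by
  have hr : 0 < √t := Real.sqrt_pos.2 ht
  have he : (heatKernel t : Space N → ℂ) = fun x => (((√t) ^ N)⁻¹ : ℝ) * heatKernel 1 ((√t)⁻¹ • x) := by
    funext x
    conv_lhs => rw [← Real.sq_sqrt ht.le]
    exact heatKernel_sq hr x
  rw [he]
  refine ⟨(integrable_heatKernel_one.comp_smul (inv_ne_zero hr.ne')).const_mul _, ?_⟩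
  simp_rw [norm_mul, Complex.norm_real]
  rw [integral_const_mul, Measure.integral_comp_inv_smul_of_nonneg volume (fun x : Space N => ‖heatKernel 1 x‖) hr.le,
    finrank_euclideanSpace_fin, smul_eq_mul, heatMass, Real.norm_of_nonneg (by positivity)]
  field_simp

theorem heatTest_apply {t : ℝ} (ht : 0 < t) (φ : 𝓢(Space N, ℂ)) (y : Space N) :
    heatTest t φ y = ∫ x, φ x * heatKernel t (x - y) := by
  unfold heatKernel
  rw [integral_mul_fourierInv_sub (integrable_heatSymbol ht) φ y, heatTest, SchwartzMap.fourier_coe]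
  refine congrFun (congrArg (fun f : Space N → ℂ => 𝓕 f) (funext fun ξ => ?_)) y
  rw [SchwartzMap.smulLeftCLM_apply_apply (hasTemperateGrowth_heatSymbol ht.le), ← SchwartzMap.fourierInv_coe]
  rfl

theorem heatSymbol_zero : (heatSymbol 0 : Space N → ℂ) = fun _ => 1 := by
  funext ξ; simp [heatSymbol]

theorem heatTest_zero (φ : 𝓢(Space N, ℂ)) : heatTest 0 φ = φ := by
  have : SchwartzMap.smulLeftCLM ℂ (heatSymbol 0) (𝓕⁻ φ) = (𝓕⁻ φ : 𝓢(Space N, ℂ)) := by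
    ext ξ
    rw [SchwartzMap.smulLeftCLM_apply_apply (hasTemperateGrowth_heatSymbol le_rfl), heatSymbol_zero]
    simp
  rw [heatTest, this, FourierTransform.fourier_fourierInv_eq]

theorem heatTest_heatTest {s t : ℝ} (hs : 0 ≤ s) (ht : 0 ≤ t) (φ : 𝓢(Space N, ℂ)) :
    heatTest s (heatTest t φ) = heatTest (s + t) φ := by
  unfold heatTest
  rw [FourierTransform.fourierInv_fourier_eq]
  congr 1
  ext ξ
  rw [SchwartzMap.smulLeftCLM_apply_apply (hasTemperateGrowth_heatSymbol hs),
    SchwartzMap.smulLeftCLM_apply_apply (hasTemperateGrowth_heatSymbol ht),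
    SchwartzMap.smulLeftCLM_apply_apply (hasTemperateGrowth_heatSymbol (add_nonneg hs ht)),
    heatSymbol_add, smul_smul]

theorem heat_zero (f : VDist N) : heat 0 f = f := by
  ext φ : 1
  rw [heat_apply, heatTest_zero]

theorem heat_heat {s t : ℝ} (hs : 0 ≤ s) (ht : 0 ≤ t) (f : VDist N) :
    heat s (heat t f) = heat (s + t) f := by
  ext φ : 1
  rw [heat_apply, heat_apply, heat_apply, heatTest_heatTest ht hs, add_comm]

theorem continuousOn_heat_apply (f : VDist N) (φ : 𝓢(Space N, ℂ)) :
    ContinuousOn (fun t => heat t f φ) (Ici 0) := by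
  have h : ContinuousOn (fun t => heatTest t φ) (Ici 0) :=
    (FourierTransform.fourierCLM ℂ 𝓢(Space N, ℂ)).continuous.comp_continuousOn
      (continuousOn_smulLeftCLM_heatSymbol (𝓕⁻ φ))
  exact (show Continuous fun ψ : 𝓢(Space N, ℂ) => f ψ from
    ContinuousLinearMap.continuous (id f : 𝓢(Space N, ℂ) →L[ℂ] Vec N)).comp_continuousOn h

theorem continuous_heatKernel {t : ℝ} (ht : 0 < t) : Continuous (heatKernel t : Space N → ℂ) :=
  VectorFourier.fourierIntegral_continuous Real.continuous_fourierChar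
    (by
      have : Continuous fun p : Space N × Space N => -(inner ℝ p.1 p.2) := by fun_prop
      exact this)
    (integrable_heatSymbol ht)

theorem integrable_mul_sub {φ k : Space N → ℂ} (hφ : Integrable φ) (hk : Integrable k) :
    Integrable (fun p : Space N × Space N => φ p.1 * k (p.1 - p.2)) (volume.prod volume) := by
  have h := (hφ.convolution_integrand (ContinuousLinearMap.mul ℝ ℂ) hk.comp_neg).swap
  refine h.congr (ae_of_all _ fun p => ?_)
  simp

theorem integrable_mul_sub_smul {φ k : Space N → ℂ} (hφ : Integrable φ) (hk : Integrable k)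
    {g : Space N → Vec N} {c : ℝ} (hg : AEStronglyMeasurable g volume) (hb : ∀ᵐ x, ‖g x‖ ≤ c) :
    Integrable (fun p : Space N × Space N => (φ p.1 * k (p.1 - p.2)) • g p.2)
      (volume.prod volume) := by
  have h := integrable_mul_sub hφ hk
  refine (h.norm.mul_const c).mono' (h.aestronglyMeasurable.smul hg.comp_snd) ?_
  filter_upwards [Measure.quasiMeasurePreserving_snd.ae hb] with p hp
  rw [norm_smul]; gcongr

/-- Young's inequality with an L¹ kernel. The extra 1 in the constant covers t = 0, where there is
no kernel, and keeps the constant nonzero when the right-hand norm is infinite; only the finiteness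
of the kernel's mass is used. -/
theorem linfNorm_heat_le {t : ℝ} (ht : 0 ≤ t) (f : VDist N) :
    linfNorm (heat t f) ≤ ENNReal.ofReal (1 + heatMass N) * linfNorm f := by
  rcases ht.eq_or_lt with rfl | ht
  · rw [heat_zero]
    refine le_mul_of_one_le_left bot_le ?_
    rw [ENNReal.one_le_ofReal]
    linarith [heatMass_nonneg (N := N)]
  rcases eq_or_ne (linfNorm f) ∞ with h | h
  · rw [h, ENNReal.mul_top]
    · exact le_top
    · simp; linarith [heatMass_nonneg (N := N)]
  set c := (linfNorm f).toReal with hc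
  have hfc : linfNorm f = ENNReal.ofReal c := (ENNReal.ofReal_toReal h).symm
  have hc0 : 0 ≤ c := ENNReal.toReal_nonneg
  have hrep := isRep_linfRep hc0 hfc.le
  set g := linfRep f with hg
  obtain ⟨hK, hKm⟩ := integrable_heatKernel (N := N) ht
  rw [hfc, ← ENNReal.ofReal_mul (by linarith [heatMass_nonneg (N := N)])]
  have hsm : AEStronglyMeasurable (fun x => ∫ y, heatKernel t (x - y) • g y) volume := by
    have hm : AEStronglyMeasurable (fun p : Space N × Space N => heatKernel t (p.1 - p.2) • g p.2)
        (volume.prod volume) :=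
      ((continuous_heatKernel ht).comp (by fun_prop)).aestronglyMeasurable.smul hrep.meas.comp_snd
    exact hm.integral_prod_right'
  refine IsRep.linfNorm_le (g := fun x => ∫ y, heatKernel t (x - y) • g y) ⟨hsm, ?_, ?_⟩
  · refine ae_of_all _ fun x => ?_
    have hx : Integrable fun y => heatKernel t (x - y) := hK.comp_sub_left x
    refine (norm_integral_le_of_norm_le (hx.norm.mul_const c) ?_).trans ?_
    · filter_upwards [hrep.bound] with y hy
      rw [norm_smul]; gcongr
    · rw [integral_mul_const, integral_sub_left_eq_self (fun y : Space N => ‖heatKernel t y‖) volume x, hKm]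
      gcongr; linarith
  · intro φ
    have hprod := integrable_mul_sub_smul φ.integrable hK hrep.meas hrep.bound
    rw [heat_apply, hrep.eq]
    simp_rw [heatTest_apply ht, ← integral_smul_const, ← integral_smul, smul_smul]
    exact (integral_integral_swap hprod).symm

/-! ### Real fields and divergence-free fields -/

/-- The heat symbol is real and even. -/
theorem heatTest_im {t : ℝ} (ht : 0 ≤ t) {φ : 𝓢(Space N, ℂ)} (hφ : ∀ x, (φ x).im = 0) (x : Space N) :
    (heatTest t φ x).im = 0 := by
  have h1 : ∀ y, (starRingEnd ℂ) (φ y) = φ y := fun y => Complex.conj_eq_iff_im.2 (hφ y)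
  have h2 : ∀ ξ, (starRingEnd ℂ) ((𝓕⁻ φ : 𝓢(Space N, ℂ)) ξ) = (𝓕⁻ φ : 𝓢(Space N, ℂ)) (-ξ) := by
    intro ξ
    rw [SchwartzMap.fourierInv_coe, Real.fourierInv_eq, Real.fourierInv_eq, ← integral_conj]
    congr 1; funext y
    simp only [Circle.smul_def, smul_eq_mul, map_mul, h1, inner_neg_right]
    rw [AddChar.map_neg_eq_inv, Circle.coe_inv_eq_conj]
  refine Complex.conj_eq_iff_im.1 ?_
  rw [heatTest, SchwartzMap.fourier_coe, Real.fourier_eq, ← integral_conj, ← integral_neg_eq_self]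
  congr 1; funext ξ
  simp only [Circle.smul_def, smul_eq_mul, map_mul, inner_neg_left, neg_neg]
  rw [SchwartzMap.smulLeftCLM_apply_apply (hasTemperateGrowth_heatSymbol ht),
    SchwartzMap.smulLeftCLM_apply_apply (hasTemperateGrowth_heatSymbol ht), smul_eq_mul, smul_eq_mul,
    map_mul, h2, neg_neg, AddChar.map_neg_eq_inv, Circle.coe_inv_eq_conj]
  rw [heatSymbol, Complex.conj_ofReal, norm_neg, heatSymbol]

theorem isReal_heat {t : ℝ} (ht : 0 ≤ t) {f : VDist N} (hf : IsReal f) : IsReal (heat t f) :=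
  fun φ hφ i => by rw [heat_apply]; exact hf _ (heatTest_im ht hφ) i

theorem heatTest_lineDeriv {t : ℝ} (ht : 0 ≤ t) (φ : 𝓢(Space N, ℂ)) (m : Space N) :
    heatTest t (∂_{m} φ) = ∂_{m} (heatTest t φ) := by
  rw [heatTest, heatTest, SchwartzMap.fourierInv_lineDerivOp_eq, SchwartzMap.lineDerivOp_fourier_eq,
    map_smul]
  congr 2
  have h1 : (fun x : Space N => inner ℝ x m).HasTemperateGrowth := by fun_prop
  ext ξ
  simp only [SchwartzMap.smulLeftCLM_apply_apply (hasTemperateGrowth_heatSymbol ht),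
    SchwartzMap.smulLeftCLM_apply_apply h1]
  rw [smul_comm]

theorem isDivFree_iff (f : VDist N) : IsDivFree f ↔ ∀ φ : 𝓢(Space N, ℂ),
    ∑ j, f (∂_{(EuclideanSpace.single j 1 : Space N)} φ) j = 0 := by
  refine forall_congr' fun φ => ?_
  have : ∀ j, ((∂_{(EuclideanSpace.single j 1 : Space N)} f : VDist N) φ) j =
      -(f (∂_{(EuclideanSpace.single j 1 : Space N)} φ) j) := by
    intro j
    rw [TemperedDistribution.lineDerivOp_apply_apply, map_neg]
    rfl
  simp_rw [this, Finset.sum_neg_distrib, neg_eq_zero]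

theorem isDivFree_heat {t : ℝ} (ht : 0 ≤ t) {f : VDist N} (hf : IsDivFree f) :
    IsDivFree (heat t f) := by
  rw [isDivFree_iff] at hf ⊢
  intro φ
  simp_rw [heat_apply, heatTest_lineDeriv ht]
  exact hf _

end LogBesovNS

end

noncomputable section

namespace LogBesovNS

open Filter Topology

variable {N : ℕ}

/-! ### The Duhamel integral -/

/-- The Oseen kernel, extended by zero to nonpositive times. -/
def kern (i j k : Fin N) (t : ℝ) (x : Space N) : ℂ := if 0 < t then oseenKernel i j k t x else 0

theorem kern_of_pos (i j k : Fin N) {t : ℝ} (ht : 0 < t) : kern i j k t = oseenKernel i j k t := by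
  funext x; simp [kern, ht]

theorem measurable_kern (i j k : Fin N) : Measurable (Function.uncurry (kern i j k)) := by
  obtain ⟨K, hK, h⟩ := exists_measurable_oseenKernel i j k
  have : Function.uncurry (kern i j k) = fun p : ℝ × Space N => if 0 < p.1 then Function.uncurry K p else 0 := by
    funext p
    simp only [Function.uncurry, kern]
    split_ifs with hp
    · rw [h _ hp]
    · rfl
  rw [this]
  exact Measurable.ite (measurableSet_lt measurable_const measurable_fst) hK measurable_const

theorem lintegral_kern_le (i j k : Fin N) (t : ℝ) (x : Space N) :
    ∫⁻ y : Space N, ‖kern i j k t (x - y)‖ₑ ≤ ENNReal.ofReal (kernelMass N * (√t)⁻¹) := by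
  rw [lintegral_sub_left_eq_self (fun y => ‖kern i j k t y‖ₑ) x]
  by_cases ht : 0 < t
  · rw [kern_of_pos i j k ht]; exact lintegral_oseenKernel_le i j k ht
  · simp [kern, ht]

/-- Lebesgue measure on `(0,t) × ℝᴺ`. -/
def slab (N : ℕ) (t : ℝ) : Measure (ℝ × Space N) := (volume.restrict (Ioo 0 t)).prod volume

instance (t : ℝ) : SFinite (slab N t) := by unfold slab; infer_instance

theorem ae_slab (t : ℝ) : ∀ᵐ p ∂slab N t, p.1 ∈ Ioo 0 t :=
  Measure.quasiMeasurePreserving_fst.ae (ae_restrict_mem measurableSet_Ioo)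

theorem lintegral_slab (t : ℝ) {f : ℝ × Space N → ℝ≥0∞} (hf : Measurable f) :
    ∫⁻ p, f p ∂slab N t = ∫⁻ τ in Ioo 0 t, ∫⁻ y, f (τ, y) :=
  lintegral_prod f hf.aemeasurable

theorem slab_eq_restrict {t T : ℝ} (h : t ≤ T) :
    slab N t = (slab N T).restrict {p | p.1 < t} := by
  have : {p : ℝ × Space N | p.1 < t} = Iio t ×ˢ univ := by ext p; simp
  rw [slab, slab, this, ← Measure.prod_restrict, Measure.restrict_univ,
    Measure.restrict_restrict measurableSet_Iio]
  congr 2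
  ext τ; simp only [mem_Ioo, mem_inter_iff, mem_Iio]
  constructor
  · rintro ⟨h1, h2⟩; exact ⟨h2, h1, h2.trans_le h⟩
  · rintro ⟨h1, h2, _⟩; exact ⟨h2, h1⟩

/-- A source on `(0,T)` of size `M`. -/
structure IsSource (T M : ℝ) (F : ℝ → Space N → ℂ) : Prop where
  meas : Measurable (Function.uncurry F)
  nonneg : 0 ≤ M
  bound : ∀ τ ∈ Ioo 0 T, ∀ y, ‖F τ y‖ ≤ M * (weight T τ ^ 2)⁻¹

/-- `e^{sΔ} ∫₀ᵗ e^{(t-τ)Δ} ℙ∇ F(τ) dτ`, component `(i,j,k)`. -/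
def duhamel (i j k : Fin N) (s : ℝ) (F : ℝ → Space N → ℂ) (t : ℝ) (x : Space N) : ℂ :=
  ∫ p, kern i j k (s + (t - p.1)) (x - p.2) * F p.1 p.2 ∂slab N t

theorem measurable_duhamel_integrand (i j k : Fin N) (s t : ℝ) {T M : ℝ} {F : ℝ → Space N → ℂ}
    (hF : IsSource T M F) :
    Measurable fun q : Space N × (ℝ × Space N) =>
      kern i j k (s + (t - q.2.1)) (q.1 - q.2.2) * F q.2.1 q.2.2 := by
  have h1 : Measurable fun q : Space N × (ℝ × Space N) => kern i j k (s + (t - q.2.1)) (q.1 - q.2.2) :=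
    (measurable_kern i j k).comp (by fun_prop :
      Measurable fun q : Space N × (ℝ × Space N) => (s + (t - q.2.1), q.1 - q.2.2))
  exact h1.mul (hF.meas.comp measurable_snd)

/-- At time τ the source is at most M w(τ)⁻² and the kernel has mass O((s+t-τ)^{-1/2}); the constant
3 comes from the resulting time integral. The bound is stated for absolute values so that it also
justifies the exchanges of integrals below. -/
theorem lintegral_duhamel_le (i j k : Fin N) {T M : ℝ} {F : ℝ → Space N → ℂ}
    (hF : IsSource T M F) {s t : ℝ} (hs : s ∈ Icc 0 T) (ht : t ∈ Ioc 0 T) (x : Space N) :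
    ∫⁻ p, ‖kern i j k (s + (t - p.1)) (x - p.2) * F p.1 p.2‖ₑ ∂slab N t ≤
      ENNReal.ofReal (3 * kernelMass N * M * (weight T (max s t))⁻¹) := by
  have hm : Measurable fun p : ℝ × Space N => kern i j k (s + (t - p.1)) (x - p.2) * F p.1 p.2 :=
    (measurable_duhamel_integrand i j k s t hF).comp (measurable_const.prodMk measurable_id)
  have hkm := kernelMass_pos (N := N)
  rw [lintegral_slab t hm.enorm]
  calc _ ≤ ∫⁻ τ in Ioo 0 t, ENNReal.ofReal (kernelMass N * M) *
        ENNReal.ofReal ((√(s + (t - τ)))⁻¹ * (weight T τ ^ 2)⁻¹) := by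
        refine setLIntegral_mono' measurableSet_Ioo fun τ hτ => ?_
        have hτ' : τ ∈ Ioo 0 T := ⟨hτ.1, hτ.2.trans_le ht.2⟩
        have hb : ∀ y, ‖F τ y‖ₑ ≤ ENNReal.ofReal (M * (weight T τ ^ 2)⁻¹) := fun y => by
          rw [← ofReal_norm]; exact ENNReal.ofReal_le_ofReal (hF.bound τ hτ' y)
        calc _ ≤ ∫⁻ y, ‖kern i j k (s + (t - τ)) (x - y)‖ₑ * ENNReal.ofReal (M * (weight T τ ^ 2)⁻¹) := by
              refine lintegral_mono fun y => ?_
              rw [enorm_mul]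
              gcongr
              exact hb y
          _ ≤ ENNReal.ofReal (kernelMass N * (√(s + (t - τ)))⁻¹) * ENNReal.ofReal (M * (weight T τ ^ 2)⁻¹) := by
              rw [lintegral_mul_const' _ _ ENNReal.ofReal_ne_top]
              gcongr
              exact lintegral_kern_le i j k _ x
          _ = _ := by
              rw [← ENNReal.ofReal_mul (by positivity), ← ENNReal.ofReal_mul (mul_nonneg hkm.le hF.nonneg)]
              congr 1; ring
    _ ≤ ENNReal.ofReal (kernelMass N * M) * ENNReal.ofReal (3 * (weight T (max s t))⁻¹) := by
        rw [lintegral_const_mul' _ _ ENNReal.ofReal_ne_top]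
        gcongr
        exact lintegral_inv_sqrt_mul_inv_weight_sq hs.1 hs.2 ht.1 ht.2
    _ = _ := by
        rw [← ENNReal.ofReal_mul (mul_nonneg hkm.le hF.nonneg)]
        congr 1; ring

theorem integrable_duhamel (i j k : Fin N) {T M : ℝ} {F : ℝ → Space N → ℂ}
    (hF : IsSource T M F) {s t : ℝ} (hs : s ∈ Icc 0 T) (ht : t ∈ Ioc 0 T) (x : Space N) :
    Integrable (fun p => kern i j k (s + (t - p.1)) (x - p.2) * F p.1 p.2) (slab N t) :=
  ⟨((measurable_duhamel_integrand i j k s t hF).comp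
    (measurable_const.prodMk measurable_id)).aestronglyMeasurable,
    (lintegral_duhamel_le i j k hF hs ht x).trans_lt ENNReal.ofReal_lt_top⟩

theorem norm_duhamel_le (i j k : Fin N) {T M : ℝ} {F : ℝ → Space N → ℂ}
    (hF : IsSource T M F) {s t : ℝ} (hs : s ∈ Icc 0 T) (ht : t ∈ Ioc 0 T) (x : Space N) :
    ‖duhamel i j k s F t x‖ ≤ 3 * kernelMass N * M * (weight T (max s t))⁻¹ := by
  have h := (enorm_integral_le_lintegral_enorm (μ := slab N t)
    fun p => kern i j k (s + (t - p.1)) (x - p.2) * F p.1 p.2).trans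
    (lintegral_duhamel_le i j k hF hs ht x)
  have hw : 0 < weight T (max s t) := weight_pos (lt_max_of_lt_right ht.1) (max_le hs.2 ht.2)
  have hkm := kernelMass_pos (N := N)
  have hM := hF.nonneg
  rwa [← ofReal_norm, ENNReal.ofReal_le_ofReal_iff (by positivity)] at h

theorem measurable_duhamel (i j k : Fin N) {T M : ℝ} {F : ℝ → Space N → ℂ}
    (hF : IsSource T M F) (s : ℝ) : Measurable (Function.uncurry (duhamel i j k s F)) := by
  -- All slabs are restrictions of one fixed measure, so that t enters only through an indicator and
  -- joint measurability in (t,x) follows from that of the integrand.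
  set μ : Measure (ℝ × Space N) := (volume.restrict (Ioi 0)).prod volume with hμ
  have hslab : ∀ t, slab N t = μ.restrict {p | p.1 < t} := by
    intro t
    have : {p : ℝ × Space N | p.1 < t} = Iio t ×ˢ univ := by ext p; simp
    rw [slab, hμ, this, ← Measure.prod_restrict, Measure.restrict_univ,
      Measure.restrict_restrict measurableSet_Iio, Iio_inter_Ioi]
  have hset : MeasurableSet {q : (ℝ × Space N) × (ℝ × Space N) | q.2.1 < q.1.1} :=
    measurableSet_lt (by fun_prop) (by fun_prop)
  have hm : Measurable fun q : (ℝ × Space N) × (ℝ × Space N) =>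
      {q : (ℝ × Space N) × (ℝ × Space N) | q.2.1 < q.1.1}.indicator
        (fun q => kern i j k (s + (q.1.1 - q.2.1)) (q.1.2 - q.2.2) * F q.2.1 q.2.2) q := by
    refine Measurable.indicator (Measurable.mul ?_ (hF.meas.comp measurable_snd)) hset
    exact (measurable_kern i j k).comp (by fun_prop :
      Measurable fun q : (ℝ × Space N) × (ℝ × Space N) => (s + (q.1.1 - q.2.1), q.1.2 - q.2.2))
  have h2 := (hm.stronglyMeasurable.integral_prod_right' (ν := μ)).measurable
  convert h2 using 1
  funext q
  simp only [Function.uncurry, duhamel]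
  rw [hslab, ← integral_indicator (measurableSet_lt (by fun_prop) (by fun_prop))]
  rfl

/-- Fubini puts the test function on the kernel. The correlation remains bounded as the kernel time
tends to 0, unlike the kernel, which makes continuity in time and the divergence accessible. -/
theorem integral_mul_duhamel (i j k : Fin N) {T M : ℝ} {F : ℝ → Space N → ℂ}
    (hF : IsSource T M F) {s t : ℝ} (hs : s ∈ Icc 0 T) (ht : t ∈ Ioc 0 T) (φ : 𝓢(Space N, ℂ)) :
    ∫ x, φ x * duhamel i j k s F t x =
      ∫ p, oseenCorr i j k (s + (t - p.1)) φ p.2 * F p.1 p.2 ∂slab N t := by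
  have hm := measurable_duhamel_integrand i j k s t hF
  have hi : Integrable (fun q : Space N × (ℝ × Space N) =>
      φ q.1 * (kern i j k (s + (t - q.2.1)) (q.1 - q.2.2) * F q.2.1 q.2.2))
      (volume.prod (slab N t)) := by
    have hm' : Measurable fun q : Space N × (ℝ × Space N) =>
        φ q.1 * (kern i j k (s + (t - q.2.1)) (q.1 - q.2.2) * F q.2.1 q.2.2) :=
      (φ.continuous.measurable.comp measurable_fst).mul hm
    refine ⟨hm'.aestronglyMeasurable, ?_⟩
    rw [HasFiniteIntegral, lintegral_prod _ hm'.enorm.aemeasurable]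
    calc _ ≤ ∫⁻ x, ‖φ x‖ₑ * ENNReal.ofReal (3 * kernelMass N * M * (weight T (max s t))⁻¹) := by
          refine lintegral_mono fun x => ?_
          simp_rw [enorm_mul (φ x)]
          rw [lintegral_const_mul' _ _ enorm_ne_top]
          gcongr
          exact lintegral_duhamel_le i j k hF hs ht x
      _ < ∞ := by
          rw [lintegral_mul_const' _ _ ENNReal.ofReal_ne_top]
          exact ENNReal.mul_lt_top φ.integrable.2 ENNReal.ofReal_lt_top
  simp_rw [duhamel, ← integral_const_mul]
  rw [integral_integral_swap hi]
  refine integral_congr_ae ?_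
  filter_upwards [ae_slab t] with p hp
  have hpos : 0 < s + (t - p.1) := by have := hs.1; have := hp.2; linarith
  rw [← integral_mul_oseenKernel_sub i j k hpos, ← integral_mul_const, kern_of_pos i j k hpos]
  congr 1; funext x; ring

theorem integral_heatTest_mul_duhamel (i j k : Fin N) {T M : ℝ} (hT : 0 < T) {F : ℝ → Space N → ℂ}
    (hF : IsSource T M F) {s t : ℝ} (hs : s ∈ Icc 0 T) (ht : t ∈ Ioc 0 T) (φ : 𝓢(Space N, ℂ)) :
    ∫ x, heatTest s φ x * duhamel i j k 0 F t x = ∫ x, φ x * duhamel i j k s F t x := by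
  rw [integral_mul_duhamel i j k hF ⟨le_rfl, hT.le⟩ ht, integral_mul_duhamel i j k hF hs ht]
  simp_rw [oseenCorr_heatTest i j k _ hs.1, zero_add]

/-! ### Continuity in time of the Duhamel integral against test functions -/

/-- The majorant for dominated convergence: correlations are O(decay) uniformly in time, and sources
are O(w⁻²), which is integrable on (0,T). -/
theorem integrable_decay_mul_inv_weight_sq {T : ℝ} (hT : 0 < T) :
    Integrable (fun p => decay p.2 * (weight T p.1 ^ 2)⁻¹) (slab N T) := by
  have h1 : Integrable (fun τ => (weight T τ ^ 2)⁻¹) (volume.restrict (Ioo 0 T)) := by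
    refine ⟨((measurable_weight T).pow_const 2).inv.aestronglyMeasurable, ?_⟩
    rw [HasFiniteIntegral]
    have : ∀ τ, ‖(weight T τ ^ 2)⁻¹‖ₑ = ENNReal.ofReal ((weight T τ ^ 2)⁻¹) := fun τ => by
      rw [← ofReal_norm, Real.norm_of_nonneg (by positivity)]
    simp_rw [this]
    rw [lintegral_inv_weight_sq hT le_rfl]
    exact ENNReal.ofReal_lt_top
  refine (h1.mul_prod integrable_decay).congr (ae_of_all _ fun p => ?_)
  exact mul_comm _ _

theorem integral_slab_indicator {t T : ℝ} (h : t ≤ T) (f : ℝ × Space N → ℂ) :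
    ∫ p, f p ∂slab N t = ∫ p, {p : ℝ × Space N | p.1 < t}.indicator f p ∂slab N T := by
  rw [slab_eq_restrict h, integral_indicator (measurableSet_lt measurable_fst measurable_const)]

theorem aestronglyMeasurable_oseenCorr (i j k : Fin N) (φ : 𝓢(Space N, ℂ)) (t : ℝ) {μ : Measure (ℝ × Space N)} :
    AEStronglyMeasurable (fun p : ℝ × Space N => oseenCorr i j k (t - p.1) φ p.2)
      (μ.restrict {p | p.1 < t}) := by
  have h1 : Measurable fun q : (ℝ × Space N) × Space N =>
      φ q.2 * kern i j k (t - q.1.1) (q.2 - q.1.2) :=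
    (φ.continuous.measurable.comp measurable_snd).mul ((measurable_kern i j k).comp (by fun_prop :
      Measurable fun q : (ℝ × Space N) × Space N => (t - q.1.1, q.2 - q.1.2)))
  have h2 := h1.stronglyMeasurable.integral_prod_right' (ν := (volume : Measure (Space N)))
  refine h2.aestronglyMeasurable.congr ?_
  filter_upwards [ae_restrict_mem (measurableSet_lt measurable_fst measurable_const)] with p hp
  have hpos : 0 < t - p.1 := sub_pos.2 hp
  rw [← integral_mul_oseenKernel_sub i j k hpos, kern_of_pos i j k hpos]

/-- Continuity of a Volterra integral on a slab. -/
theorem continuousOn_integral_slab {T : ℝ} {f : ℝ → ℝ × Space N → ℂ} {b : ℝ × Space N → ℝ}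
    (hb : Integrable b (slab N T)) (hb0 : ∀ p, p.1 ∈ Ioo 0 T → 0 ≤ b p)
    (hmeas : ∀ t, AEStronglyMeasurable (f t) ((slab N T).restrict {p | p.1 < t}))
    (hle : ∀ t ∈ Icc 0 T, ∀ p, p.1 ∈ Ioo 0 T → p.1 < t → ‖f t p‖ ≤ b p)
    (hcont : ∀ p t, p.1 < t → ContinuousAt (fun t => f t p) t) :
    ContinuousOn (fun t => ∫ p, f t p ∂slab N t) (Icc 0 T) := by
  have hms : ∀ t : ℝ, MeasurableSet {p : ℝ × Space N | p.1 < t} :=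
    fun t => measurableSet_lt measurable_fst measurable_const
  have hcongr : ∀ t ∈ Icc 0 T, (∫ p, f t p ∂slab N t) =
      ∫ p, {p : ℝ × Space N | p.1 < t}.indicator (f t) p ∂slab N T :=
    fun t ht => integral_slab_indicator ht.2 _
  refine ContinuousOn.congr ?_ hcongr
  have hin : ∀ t (p : ℝ × Space N), p.1 < t → {p : ℝ × Space N | p.1 < t}.indicator (f t) p = f t p :=
    fun t p h => indicator_of_mem (by exact h) _
  have hout : ∀ t (p : ℝ × Space N), t ≤ p.1 → {p : ℝ × Space N | p.1 < t}.indicator (f t) p = 0 :=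
    fun t p h => indicator_of_notMem (by exact h.not_gt) _
  intro t₀ ht₀
  refine continuousWithinAt_of_dominated (bound := b)
    (Eventually.of_forall fun t => (aestronglyMeasurable_indicator_iff (hms t)).2 (hmeas t)) ?_ hb ?_
  · filter_upwards [self_mem_nhdsWithin] with t ht
    filter_upwards [ae_slab T] with p hp
    by_cases h : p.1 < t
    · rw [hin _ _ h]
      exact hle t ht p hp h
    · rw [hout _ _ (not_lt.1 h), norm_zero]
      exact hb0 p hp
  · have hne : ∀ᵐ p ∂slab N T, p.1 ≠ t₀ :=
      Measure.quasiMeasurePreserving_fst.ae (ae_restrict_of_ae (compl_mem_ae_iff.2 (measure_singleton t₀)))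
    filter_upwards [hne] with p hp
    rcases lt_or_gt_of_ne hp with h | h
    · refine ((hcont p t₀ h).congr ?_).continuousWithinAt
      filter_upwards [Ioi_mem_nhds h] with t ht
      rw [hin _ _ ht]
    · have hc : ContinuousAt (fun _ : ℝ => (0 : ℂ)) t₀ := continuousAt_const
      refine (hc.congr ?_).continuousWithinAt
      filter_upwards [Iio_mem_nhds h] with t ht
      rw [hout _ _ (le_of_lt ht)]

/-- The Duhamel integral depends continuously on time in the sense of distributions. -/
theorem continuousOn_integral_oseenCorr (i j k : Fin N) {T M : ℝ} (hT : 0 < T) {F : ℝ → Space N → ℂ}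
    (hF : IsSource T M F) (φ : 𝓢(Space N, ℂ)) :
    ContinuousOn (fun t => ∫ p, oseenCorr i j k (t - p.1) φ p.2 * F p.1 p.2 ∂slab N t) (Icc 0 T) := by
  obtain ⟨C, hC, hCb⟩ := exists_norm_oseenCorr_le i j k hT φ
  have hM := hF.nonneg
  refine continuousOn_integral_slab (f := fun t p => oseenCorr i j k (t - p.1) φ p.2 * F p.1 p.2)
    (b := fun p => C * M * (decay p.2 * (weight T p.1 ^ 2)⁻¹))
    ((integrable_decay_mul_inv_weight_sq hT).const_mul _) ?_ ?_ ?_ ?_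
  · intro p _
    have hd := decay_pos p.2
    positivity
  · intro t
    exact (aestronglyMeasurable_oseenCorr i j k φ t).mul hF.meas.aestronglyMeasurable
  · intro t ht p hp h
    have hd := decay_pos p.2
    rw [norm_mul]
    have h1 := hCb (t - p.1) ⟨by linarith, by linarith [ht.2, hp.1]⟩ p.2
    have h2 := hF.bound p.1 hp p.2
    calc _ ≤ (C * decay p.2) * (M * (weight T p.1 ^ 2)⁻¹) := by gcongr
      _ = _ := by ring
  · intro p t h
    refine ContinuousAt.mul ?_ continuousAt_const
    have h1 : ContinuousAt (fun t => oseenCorr i j k t φ p.2) (t - p.1) :=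
      (continuousOn_oseenCorr i j k φ p.2).continuousAt (Ici_mem_nhds (by linarith))
    exact ContinuousAt.comp (f := fun t => t - p.1) h1 (by fun_prop)

end LogBesovNS

end

noncomputable section

namespace LogBesovNS

open Filter Topology

variable {N : ℕ}

/-! ### Jointly measurable representatives -/

/-- A sequence of bump functions shrinking to the origin. -/
def shrinkingBump (N n : ℕ) : ContDiffBump (0 : Space N) where
  rIn := ((n : ℝ) + 1)⁻¹
  rOut := 2 * ((n : ℝ) + 1)⁻¹
  rIn_pos := by positivity
  rIn_lt_rOut := by
    have : 0 < ((n : ℝ) + 1)⁻¹ := by positivity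
    linarith

theorem tendsto_shrinkingBump_rOut (N : ℕ) :
    Tendsto (fun n => (shrinkingBump N n).rOut) atTop (𝓝 0) := by
  have h := tendsto_one_div_add_atTop_nhds_zero_nat (𝕜 := ℝ)
  simpa [shrinkingBump] using h.const_mul 2

/-- The test function `y ↦ ρ_n(x - y)`. -/
def bumpTest (n : ℕ) (x : Space N) : 𝓢(Space N, ℂ) :=
  HasCompactSupport.toSchwartzMap
    (f := fun y => (((shrinkingBump N n).normed volume (x - y) : ℝ) : ℂ))
    (by
      have h := ((shrinkingBump N n).hasCompactSupport_normed (μ := volume)).comp_homeomorph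
        (Homeomorph.subLeft x)
      exact h.comp_left (g := Complex.ofReal) Complex.ofReal_zero)
    (by
      have h := (shrinkingBump N n).contDiff_normed (μ := volume) (n := (⊤ : ℕ∞))
      exact Complex.ofRealCLM.contDiff.comp (h.comp (contDiff_const.sub contDiff_id)))

open scoped Convolution in
theorem IsRep.apply_bumpTest {f : VDist N} {g : Space N → Vec N} {c : ℝ} (h : IsRep f g c) (n : ℕ)
    (x : Space N) : f (bumpTest n x) =
      ((shrinkingBump N n).normed volume ⋆[ContinuousLinearMap.lsmul ℝ ℝ, volume] g) x := by
  rw [h.eq, convolution_eq_swap]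
  rfl

theorem IsRep.locallyIntegrable {f : VDist N} {g : Space N → Vec N} {c : ℝ} (h : IsRep f g c) :
    LocallyIntegrable g volume := h.memLp.locallyIntegrable le_top

theorem IsRep.tendsto_bumpTest {f : VDist N} {g : Space N → Vec N} {c : ℝ} (h : IsRep f g c) :
    ∀ᵐ x, Tendsto (fun n => f (bumpTest n x)) atTop (𝓝 (g x)) := by
  have := ContDiffBump.ae_convolution_tendsto_right_of_locallyIntegrable
    (φ := shrinkingBump N) (K := 2) (tendsto_shrinkingBump_rOut N) (Eventually.of_forall fun n => le_rfl)
    h.locallyIntegrable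
  simpa only [h.apply_bumpTest] using this

theorem IsRep.continuous_bumpTest {f : VDist N} {g : Space N → Vec N} {c : ℝ} (h : IsRep f g c) (n : ℕ) :
    Continuous fun x => f (bumpTest n x) := by
  simp only [h.apply_bumpTest]
  exact HasCompactSupport.continuous_convolution_left _ (shrinkingBump N n).hasCompactSupport_normed
    (shrinkingBump N n).continuous_normed h.locallyIntegrable

/-- A weakly continuous path of bounded functions has a jointly measurable representative. -/
theorem exists_measurable_rep {T : ℝ} {p : ℝ → VDist N} {m : ℝ → ℝ}
    (hp : ∀ φ, ContinuousOn (fun t => p t φ) (Ioo 0 T)) (hm : Measurable m)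
    (hm0 : ∀ t ∈ Ioo 0 T, 0 ≤ m t) (hle : ∀ t ∈ Ioo 0 T, linfNorm (p t) ≤ ENNReal.ofReal (m t)) :
    ∃ U : ℝ → Space N → Vec N, Measurable (Function.uncurry U) ∧
      (∀ t ∈ Ioo 0 T, ∀ x, ‖U t x‖ ≤ m t) ∧ ∀ t ∈ Ioo 0 T, IsRep (p t) (U t) (m t) := by
  classical
  have hrep : ∀ t ∈ Ioo 0 T, IsRep (p t) (linfRep (p t)) (m t) := fun t ht =>
    isRep_linfRep (hm0 t ht) (hle t ht)
  set S : Set (ℝ × Space N) := {q | q.1 ∈ Ioo 0 T} with hS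
  have hSm : MeasurableSet S := measurable_fst measurableSet_Ioo
  -- `linfRep` chooses a function separately at each time, which says nothing about joint
  -- measurability. The mollified values are continuous in t by weak continuity and continuous in x,
  -- hence jointly measurable; by Lebesgue differentiation they converge to the representative for
  -- almost every x.
  set B : ℕ → ℝ × Space N → Vec N := fun n q => if q ∈ S then p q.1 (bumpTest n q.2) else 0 with hB
  have hBm : ∀ n, Measurable (B n) := by
    intro n
    have h1 : Measurable (Function.uncurry fun (t : Ioo (0 : ℝ) T) (x : Space N) => p t (bumpTest n x)) := by
      refine measurable_uncurry_of_continuous_of_measurable (fun x => ?_) fun t => ?_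
      · exact continuousOn_iff_continuous_domRestrict.1 (hp (bumpTest n x))
      · exact ((hrep t t.2).continuous_bumpTest n).measurable
    have h2 : Measurable fun q : S => p q.1.1 (bumpTest n q.1.2) :=
      h1.comp (g := Function.uncurry fun (t : Ioo (0 : ℝ) T) (x : Space N) => p t (bumpTest n x))
        (f := fun q : S => ((⟨q.1.1, q.2⟩ : Ioo (0 : ℝ) T), q.1.2)) (by fun_prop)
    exact Measurable.dite (s := S) h2 (g := fun _ => 0) measurable_const hSm
  set L : ℝ × Space N → Vec N := fun q => limUnder atTop fun n => B n q with hL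
  have hLm : Measurable L :=
    (StronglyMeasurable.limUnder fun n => (hBm n).stronglyMeasurable).measurable
  -- Truncation makes the bound hold at every point instead of almost everywhere; it changes each
  -- slice on a null set only.
  set U : ℝ → Space N → Vec N := fun t x => if ‖L (t, x)‖ ≤ m t ∧ t ∈ Ioo 0 T then L (t, x) else 0 with hU
  refine ⟨U, ?_, ?_, ?_⟩
  · refine Measurable.ite (MeasurableSet.inter ?_ hSm) hLm measurable_const
    exact measurableSet_le hLm.norm (hm.comp measurable_fst)
  · intro t ht x
    simp only [hU]
    split_ifs with h
    · exact h.1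
    · rw [norm_zero]; exact hm0 t ht
  · intro t ht
    refine (hrep t ht).congr ?_
    filter_upwards [(hrep t ht).tendsto_bumpTest, (hrep t ht).bound] with x hx hb
    have h1 : L (t, x) = linfRep (p t) x := by
      refine Tendsto.limUnder_eq (hx.congr fun n => ?_)
      simp only [hB]
      rw [if_pos (show (t, x) ∈ S from ht)]
    simp only [hU]
    rw [h1, if_pos ⟨hb, ht⟩]

/-! ### Real-valued representatives -/

theorem IsRep.ae_im_eq_zero {f : VDist N} {g : Space N → Vec N} {c : ℝ} (h : IsRep f g c)
    (hf : IsReal f) : ∀ᵐ x, ∀ i, (g x i).im = 0 := by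
  rw [ae_all_iff]
  intro i
  have hgm : AEStronglyMeasurable (fun x => g x i) volume :=
    (EuclideanSpace.proj (𝕜 := ℂ) i : Vec N →L[ℂ] ℂ).continuous.comp_aestronglyMeasurable h.meas
  have hli : LocallyIntegrable (fun x => (g x i).im) volume := by
    have : MemLp (fun x => (g x i).im) ∞ volume := by
      refine memLp_top_of_bound (Complex.continuous_im.comp_aestronglyMeasurable hgm) c ?_
      filter_upwards [h.bound] with x hx
      exact (Complex.abs_im_le_norm _).trans ((PiLp.norm_apply_le _ i).trans hx)
    exact this.locallyIntegrable le_top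
  refine ae_eq_zero_of_integral_contDiff_smul_eq_zero hli fun ψ hψ hc => ?_
  set φ : 𝓢(Space N, ℂ) := HasCompactSupport.toSchwartzMap (f := fun x => ((ψ x : ℝ) : ℂ))
    (hc.comp_left (g := Complex.ofReal) Complex.ofReal_zero) (Complex.ofRealCLM.contDiff.comp hψ) with hφ
  have h1 := hf φ (fun x => Complex.ofReal_im _) i
  have hint : Integrable fun x => φ x * g x i :=
    (EuclideanSpace.proj (𝕜 := ℂ) i : Vec N →L[ℂ] ℂ).integrable_comp
      (integrable_schwartz_smul φ h.meas h.bound)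
  rw [h.apply_coord, ← RCLike.im_eq_complex_im, ← integral_im hint] at h1
  rw [← h1]
  congr 1; funext x
  have hx : φ x = ((ψ x : ℝ) : ℂ) := rfl
  rw [hx]
  simp

/-- A vector field with real entries replaced by their real parts. -/
def realPart (v : Vec N) : Vec N := WithLp.toLp 2 fun i => ((v i).re : ℂ)

theorem norm_realPart_le (v : Vec N) : ‖realPart v‖ ≤ ‖v‖ := by
  rw [EuclideanSpace.norm_eq, EuclideanSpace.norm_eq]
  refine Real.sqrt_le_sqrt (Finset.sum_le_sum fun i _ => ?_)
  refine pow_le_pow_left₀ (norm_nonneg _) ?_ 2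
  rw [realPart, Complex.norm_real]
  exact Complex.abs_re_le_norm _

theorem measurable_realPart : Measurable (realPart : Vec N → Vec N) := by
  unfold realPart
  refine (WithLp.measurable_toLp 2 _).comp (measurable_pi_lambda _ fun i => ?_)
  exact Complex.measurable_ofReal.comp (Complex.measurable_re.comp (by fun_prop))

/-- Reality is arranged at every point, so that it passes through the bilinear term and the Picard
iterates without null sets. -/
theorem exists_measurable_real_rep {T : ℝ} {p : ℝ → VDist N} {m : ℝ → ℝ}
    (hp : ∀ φ, ContinuousOn (fun t => p t φ) (Ioo 0 T)) (hm : Measurable m)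
    (hm0 : ∀ t ∈ Ioo 0 T, 0 ≤ m t) (hle : ∀ t ∈ Ioo 0 T, linfNorm (p t) ≤ ENNReal.ofReal (m t))
    (hr : ∀ t ∈ Ioo 0 T, IsReal (p t)) :
    ∃ U : ℝ → Space N → Vec N, Measurable (Function.uncurry U) ∧
      (∀ t ∈ Ioo 0 T, ∀ x, ‖U t x‖ ≤ m t) ∧ (∀ t ∈ Ioo 0 T, IsRep (p t) (U t) (m t)) ∧
      ∀ t x i, (U t x i).im = 0 := by
  obtain ⟨U, hU, hb, hrep⟩ := exists_measurable_rep hp hm hm0 hle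
  refine ⟨fun t x => realPart (U t x), measurable_realPart.comp hU,
    fun t ht x => (norm_realPart_le _).trans (hb t ht x), fun t ht => (hrep t ht).congr ?_,
    fun t x i => Complex.ofReal_im _⟩
  filter_upwards [(hrep t ht).ae_im_eq_zero (hr t ht)] with x hx
  ext i
  refine Complex.ext ?_ ?_
  · exact (Complex.ofReal_re _).symm
  · rw [hx i]; exact (Complex.ofReal_im _).symm

end LogBesovNS

end

noncomputable section

namespace LogBesovNS

open Filter Topology

variable {N : ℕ}

/-! ### The bilinear term for jointly measurable fields -/

/-- A field on `(0,T)` of size `M` in the norm `sup w(t) ‖u(t)‖_∞`. -/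
structure IsField (T M : ℝ) (U : ℝ → Space N → Vec N) : Prop where
  meas : Measurable (Function.uncurry U)
  nonneg : 0 ≤ M
  bound : ∀ τ ∈ Ioo 0 T, ∀ y, ‖U τ y‖ ≤ M * (weight T τ)⁻¹

theorem measurable_coord (i : Fin N) : Measurable fun v : Vec N => v i := by fun_prop

theorem IsField.sub {T M M' : ℝ} {U V : ℝ → Space N → Vec N} (hU : IsField T M U)
    (hV : IsField T M' V) : IsField T (M + M') (U - V) where
  meas := hU.meas.sub hV.meas
  nonneg := add_nonneg hU.nonneg hV.nonneg
  bound τ hτ y := by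
    rw [add_mul]
    exact (norm_sub_le _ _).trans (add_le_add (hU.bound τ hτ y) (hV.bound τ hτ y))

theorem IsField.mono {T M M' : ℝ} {U : ℝ → Space N → Vec N} (hU : IsField T M U) (h : M ≤ M') :
    IsField T M' U where
  meas := hU.meas
  nonneg := hU.nonneg.trans h
  bound τ hτ y := (hU.bound τ hτ y).trans (by
    have := weight_pos hτ.1 hτ.2.le
    gcongr)

theorem IsField.isSource {T M M' : ℝ} {U V : ℝ → Space N → Vec N} (hU : IsField T M U)
    (hV : IsField T M' V) (j k : Fin N) : IsSource T (M * M') fun τ y => U τ y k * V τ y j where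
  meas := ((measurable_coord k).comp hU.meas).mul ((measurable_coord j).comp hV.meas)
  nonneg := mul_nonneg hU.nonneg hV.nonneg
  bound τ hτ y := by
    have h1 := (PiLp.norm_apply_le (U τ y) k).trans (hU.bound τ hτ y)
    have h2 := (PiLp.norm_apply_le (V τ y) j).trans (hV.bound τ hτ y)
    have hw := weight_pos hτ.1 hτ.2.le
    have := hU.nonneg
    rw [norm_mul]
    calc _ ≤ (M * (weight T τ)⁻¹) * (M' * (weight T τ)⁻¹) := by gcongr
      _ = _ := by rw [sq, mul_inv]; ring

/-- `e^{sΔ} B(U,V)(t)`. -/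
def nlin (U V : ℝ → Space N → Vec N) (s t : ℝ) (x : Space N) : Vec N :=
  WithLp.toLp 2 fun i => ∑ j, ∑ k, duhamel i j k s (fun τ y => U τ y k * V τ y j) t x

theorem nlin_apply (U V : ℝ → Space N → Vec N) (s t : ℝ) (x : Space N) (i : Fin N) :
    nlin U V s t x i = ∑ j, ∑ k, duhamel i j k s (fun τ y => U τ y k * V τ y j) t x := rfl

theorem norm_le_sum_coord (v : Vec N) : ‖v‖ ≤ ∑ i, ‖v i‖ := by
  have h : v = ∑ i, EuclideanSpace.single i (v i) := by
    ext j; simp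
  calc ‖v‖ = ‖∑ i, (EuclideanSpace.single i (v i) : Vec N)‖ := by rw [← h]
    _ ≤ ∑ i, ‖(EuclideanSpace.single i (v i) : Vec N)‖ := norm_sum_le _ _
    _ = _ := by simp

/-- The constant in the bilinear estimate. -/
def nlinConst (N : ℕ) : ℝ := N * (N * (N * (3 * kernelMass N)))

theorem nlinConst_nonneg : 0 ≤ nlinConst N := by
  have := kernelMass_pos (N := N)
  unfold nlinConst; positivity

theorem norm_nlin_le {T M M' : ℝ} {U V : ℝ → Space N → Vec N} (hU : IsField T M U)
    (hV : IsField T M' V) {s t : ℝ} (hs : s ∈ Icc 0 T) (ht : t ∈ Ioc 0 T) (x : Space N) :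
    ‖nlin U V s t x‖ ≤ nlinConst N * (M * M') * (weight T (max s t))⁻¹ := by
  have h1 : ∀ i j k : Fin N, ‖duhamel i j k s (fun τ y => U τ y k * V τ y j) t x‖ ≤
      3 * kernelMass N * (M * M') * (weight T (max s t))⁻¹ :=
    fun i j k => norm_duhamel_le i j k (hU.isSource hV j k) hs ht x
  calc ‖nlin U V s t x‖ ≤ ∑ i, ‖nlin U V s t x i‖ := norm_le_sum_coord _
    _ ≤ ∑ _i : Fin N, ∑ _j : Fin N, ∑ _k : Fin N, 3 * kernelMass N * (M * M') * (weight T (max s t))⁻¹ := by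
        refine Finset.sum_le_sum fun i _ => ?_
        rw [nlin_apply]
        refine (norm_sum_le _ _).trans (Finset.sum_le_sum fun j _ => (norm_sum_le _ _).trans ?_)
        exact Finset.sum_le_sum fun k _ => h1 i j k
    _ = _ := by
        simp only [Finset.sum_const, Finset.card_univ, Fintype.card_fin, nsmul_eq_mul, nlinConst]
        ring

theorem measurable_nlin {T M M' : ℝ} {U V : ℝ → Space N → Vec N} (hU : IsField T M U)
    (hV : IsField T M' V) (s : ℝ) : Measurable (Function.uncurry (nlin U V s)) := by
  refine (WithLp.measurable_toLp 2 _).comp (measurable_pi_lambda _ fun i => ?_)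
  exact Finset.measurable_fun_sum _ fun j _ => Finset.measurable_fun_sum _ fun k _ =>
    measurable_duhamel i j k (hU.isSource hV j k) s

theorem isField_nlin {T M M' : ℝ} {U V : ℝ → Space N → Vec N} (hU : IsField T M U)
    (hV : IsField T M' V) : IsField T (nlinConst N * (M * M')) (nlin U V 0) where
  meas := measurable_nlin hU hV 0
  nonneg := mul_nonneg nlinConst_nonneg (mul_nonneg hU.nonneg hV.nonneg)
  bound t ht x := by
    have h := norm_nlin_le hU hV (s := 0) ⟨le_rfl, (ht.1.trans ht.2).le⟩ ⟨ht.1, ht.2.le⟩ x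
    rwa [max_eq_right ht.1.le] at h

/-- Bilinearity, B(U,U) - B(V,V) = B(U,U-V) + B(U-V,V). It holds at every point because all four
integrals converge absolutely. -/
theorem nlin_sub_nlin {T M M' : ℝ} {U V : ℝ → Space N → Vec N} (hU : IsField T M U)
    (hV : IsField T M' V) {s t : ℝ} (hs : s ∈ Icc 0 T) (ht : t ∈ Ioc 0 T) (x : Space N) :
    nlin U U s t x - nlin V V s t x = nlin U (U - V) s t x + nlin (U - V) V s t x := by
  ext i
  have hd := hU.sub hV
  have key : ∀ j k, duhamel i j k s (fun τ y => U τ y k * U τ y j) t x -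
      duhamel i j k s (fun τ y => V τ y k * V τ y j) t x =
      duhamel i j k s (fun τ y => U τ y k * (U - V) τ y j) t x +
      duhamel i j k s (fun τ y => (U - V) τ y k * V τ y j) t x := by
    intro j k
    have i1 := integrable_duhamel i j k (hU.isSource hU j k) hs ht x
    have i2 := integrable_duhamel i j k (hV.isSource hV j k) hs ht x
    have i3 := integrable_duhamel i j k (hU.isSource hd j k) hs ht x
    have i4 := integrable_duhamel i j k (hd.isSource hV j k) hs ht x
    unfold duhamel
    rw [← integral_sub i1 i2, ← integral_add i3 i4]
    congr 1; funext p
    simp only [Pi.sub_apply, PiLp.sub_apply]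
    ring
  simp only [PiLp.sub_apply, PiLp.add_apply, nlin_apply, ← Finset.sum_sub_distrib,
    ← Finset.sum_add_distrib, key]

theorem duhamel_im (i j k : Fin N) {s t : ℝ} {F : ℝ → Space N → ℂ} (hF : ∀ τ y, (F τ y).im = 0)
    (x : Space N) : (duhamel i j k s F t x).im = 0 := by
  refine Complex.conj_eq_iff_im.1 ?_
  rw [duhamel, ← integral_conj]
  congr 1; funext p
  rw [map_mul, Complex.conj_eq_iff_im.2 (hF _ _)]
  congr 1
  unfold kern
  split_ifs
  · exact conj_oseenKernel i j k _ _
  · simp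

theorem nlin_im {U V : ℝ → Space N → Vec N} (hU : ∀ τ y i, (U τ y i).im = 0)
    (hV : ∀ τ y i, (V τ y i).im = 0) (s t : ℝ) (x : Space N) (i : Fin N) :
    (nlin U V s t x i).im = 0 := by
  rw [nlin_apply, Complex.im_sum]
  refine Finset.sum_eq_zero fun j _ => ?_
  rw [Complex.im_sum]
  refine Finset.sum_eq_zero fun k _ => duhamel_im i j k (fun τ y => ?_) x
  simp [hU, hV]

/-! ### The bilinear term as a distribution -/

theorem integrable_mul_duhamel (i j k : Fin N) {T M : ℝ} {F : ℝ → Space N → ℂ}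
    (hF : IsSource T M F) {s t : ℝ} (hs : s ∈ Icc 0 T) (ht : t ∈ Ioc 0 T) (φ : 𝓢(Space N, ℂ)) :
    Integrable fun x => φ x * duhamel i j k s F t x := by
  have hm : Measurable (duhamel i j k s F t) :=
    (measurable_duhamel i j k hF s).comp (measurable_const.prodMk measurable_id)
  refine (φ.integrable.norm.mul_const (3 * kernelMass N * M * (weight T (max s t))⁻¹)).mono'
    (φ.continuous.aestronglyMeasurable.mul hm.aestronglyMeasurable) (ae_of_all _ fun x => ?_)
  rw [norm_mul]
  gcongr
  exact norm_duhamel_le i j k hF hs ht x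

theorem integral_mul_nlin {T M M' : ℝ} {U V : ℝ → Space N → Vec N} (hU : IsField T M U)
    (hV : IsField T M' V) {s t : ℝ} (hs : s ∈ Icc 0 T) (ht : t ∈ Ioc 0 T) (φ : 𝓢(Space N, ℂ))
    (i : Fin N) : ∫ x, φ x * nlin U V s t x i =
      ∑ j, ∑ k, ∫ x, φ x * duhamel i j k s (fun τ y => U τ y k * V τ y j) t x := by
  simp_rw [nlin_apply, Finset.mul_sum]
  rw [integral_finsetSum]
  · refine Finset.sum_congr rfl fun j _ => ?_
    rw [integral_finsetSum]
    exact fun k _ => integrable_mul_duhamel i j k (hU.isSource hV j k) hs ht φ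
  · exact fun j _ => integrable_finsetSum _ fun k _ =>
      integrable_mul_duhamel i j k (hU.isSource hV j k) hs ht φ

open Classical in
/-- The distribution given by a bounded function. -/
def ofBounded (g : Space N → Vec N) : VDist N :=
  if h : MemLp g ∞ volume then Lp.toTemperedDistribution (h.toLp g) else 0

theorem isRep_ofBounded {g : Space N → Vec N} {c : ℝ} (hg : AEStronglyMeasurable g volume)
    (hb : ∀ᵐ x, ‖g x‖ ≤ c) : IsRep (ofBounded g) g c where
  meas := hg
  bound := hb
  eq φ := by
    have h : MemLp g ∞ volume := memLp_top_of_bound hg c hb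
    rw [ofBounded, dif_pos h, Lp.toTemperedDistribution_apply]
    refine integral_congr_ae ?_
    filter_upwards [h.coeFn_toLp] with x hx
    rw [hx]

/-- `B(U,V)(t)` as a distribution. -/
def nlinDist (U V : ℝ → Space N → Vec N) (t : ℝ) : VDist N := ofBounded (nlin U V 0 t)

theorem measurable_nlin_apply {T M M' : ℝ} {U V : ℝ → Space N → Vec N} (hU : IsField T M U)
    (hV : IsField T M' V) (s t : ℝ) : Measurable (nlin U V s t) :=
  (measurable_nlin hU hV s).of_uncurry_left

theorem isRep_nlinDist {T M M' : ℝ} {U V : ℝ → Space N → Vec N} (hU : IsField T M U)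
    (hV : IsField T M' V) {t : ℝ} (ht : t ∈ Ioc 0 T) :
    IsRep (nlinDist U V t) (nlin U V 0 t) (nlinConst N * (M * M') * (weight T t)⁻¹) := by
  refine isRep_ofBounded (measurable_nlin_apply hU hV 0 t).aestronglyMeasurable (ae_of_all _ fun x => ?_)
  have h := norm_nlin_le hU hV (s := 0) ⟨le_rfl, (ht.1.le.trans ht.2)⟩ ht x
  rwa [max_eq_right ht.1.le] at h

theorem nlin_zero_time (U V : ℝ → Space N → Vec N) (s : ℝ) : nlin U V s 0 = 0 := by
  have h : slab N 0 = 0 := by simp [slab]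
  funext x
  ext i
  simp [nlin_apply, duhamel, h]

theorem nlinDist_zero_time (U V : ℝ → Space N → Vec N) : nlinDist U V 0 = 0 := by
  have h : IsRep (nlinDist U V 0) (nlin U V 0 0) 0 := by
    rw [nlinDist, nlin_zero_time]
    exact isRep_ofBounded aestronglyMeasurable_zero (ae_of_all _ fun x => by simp)
  ext φ : 1
  rw [h.eq, nlin_zero_time]
  simp

/-- The closed interval is allowed: at t = 0 the slab is null and both sides vanish. Continuity up
to t = 0 and the vanishing of the divergence are read off from this formula. -/
theorem nlinDist_apply {T M M' : ℝ} {U V : ℝ → Space N → Vec N} (hU : IsField T M U)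
    (hV : IsField T M' V) {t : ℝ} (ht : t ∈ Icc 0 T) (φ : 𝓢(Space N, ℂ)) (i : Fin N) :
    nlinDist U V t φ i = ∑ j, ∑ k, ∫ p, oseenCorr i j k (t - p.1) φ p.2 *
      (U p.1 p.2 k * V p.1 p.2 j) ∂slab N t := by
  rcases ht.1.eq_or_lt with rfl | h0
  · rw [nlinDist_zero_time]
    have h : slab N 0 = 0 := by simp [slab]
    simp only [h, integral_zero_measure, Finset.sum_const_zero]
    rfl
  · have ht' : t ∈ Ioc 0 T := ⟨h0, ht.2⟩
    have hs : (0 : ℝ) ∈ Icc 0 T := ⟨le_rfl, ht.1.trans ht.2⟩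
    rw [(isRep_nlinDist hU hV ht').apply_coord, integral_mul_nlin hU hV hs ht']
    refine Finset.sum_congr rfl fun j _ => Finset.sum_congr rfl fun k _ => ?_
    rw [integral_mul_duhamel i j k (hU.isSource hV j k) hs ht']
    simp_rw [zero_add]

/-- Applying e^{sΔ} replaces the kernel time t - τ by s + t - τ; this is why the Duhamel integral
carries the parameter s. -/
theorem isRep_heat_nlinDist {T M M' : ℝ} {U V : ℝ → Space N → Vec N} (hU : IsField T M U)
    (hV : IsField T M' V) {s t : ℝ} (hs : s ∈ Icc 0 T) (ht : t ∈ Ioc 0 T) :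
    IsRep (heat s (nlinDist U V t)) (nlin U V s t)
      (nlinConst N * (M * M') * (weight T (max s t))⁻¹) := by
  refine isRep_of_coord (measurable_nlin_apply hU hV s t).aestronglyMeasurable
    (ae_of_all _ fun x => norm_nlin_le hU hV hs ht x) fun φ i => ?_
  have h0 : (0 : ℝ) ∈ Icc 0 T := ⟨le_rfl, hs.1.trans hs.2⟩
  rw [heat_apply, (isRep_nlinDist hU hV ht).apply_coord, integral_mul_nlin hU hV h0 ht,
    integral_mul_nlin hU hV hs ht]
  refine Finset.sum_congr rfl fun j _ => Finset.sum_congr rfl fun k _ => ?_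
  exact integral_heatTest_mul_duhamel i j k (ht.1.trans_le ht.2) (hU.isSource hV j k) hs ht φ

/-- Since w is increasing, w(s)/w(max(s,t)) ≤ 1. This is what the maximum in the time integral is
for: the bound is uniform in t down to 0. -/
theorem logBesovNorm_nlinDist_le {T M M' : ℝ} {U V : ℝ → Space N → Vec N} (hU : IsField T M U)
    (hV : IsField T M' V) {t : ℝ} (ht : t ∈ Icc 0 T) :
    logBesovNorm T (nlinDist U V t) ≤ ENNReal.ofReal (nlinConst N * (M * M')) := by
  refine iSup₂_le fun (s : ℝ) (hs : s ∈ Ioo (0 : ℝ) T) => ?_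
  rcases ht.1.eq_or_lt with rfl | h0
  · rw [nlinDist_zero_time, map_zero, linfNorm_zero, mul_zero]; exact bot_le
  have ht' : t ∈ Ioc 0 T := ⟨h0, ht.2⟩
  have hs' : s ∈ Icc 0 T := ⟨hs.1.le, hs.2.le⟩
  have h1 := (isRep_heat_nlinDist hU hV hs' ht').linfNorm_le
  have hws := weight_pos hs.1 hs.2.le
  have hwm := inv_weight_anti hs.1 (le_max_left s t) (max_le hs.2.le ht.2)
  have hC : 0 ≤ nlinConst N * (M * M') := mul_nonneg nlinConst_nonneg (mul_nonneg hU.nonneg hV.nonneg)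
  calc _ ≤ ENNReal.ofReal (weight T s) *
        ENNReal.ofReal (nlinConst N * (M * M') * (weight T (max s t))⁻¹) := by gcongr
    _ = ENNReal.ofReal (weight T s * (nlinConst N * (M * M') * (weight T (max s t))⁻¹)) := by
        rw [ENNReal.ofReal_mul hws.le]
    _ ≤ _ := by
        refine ENNReal.ofReal_le_ofReal ?_
        calc _ ≤ weight T s * (nlinConst N * (M * M') * (weight T s)⁻¹) := by gcongr
          _ = _ := by field_simp

/-- The norm only sees times below T; any later time is reached from one of these by the semigroup,
which is bounded on L^∞. -/
theorem mem_logBesov_of_norm {T : ℝ} (hT : 0 < T) {f : VDist N} (h : logBesovNorm T f < ∞) :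
    f ∈ LogBesov N T := by
  refine ⟨fun t ht => ?_, h⟩
  have hlt : ∀ s ∈ Ioo 0 T, linfNorm (heat s f) < ∞ := by
    intro s hs
    have h1 : ENNReal.ofReal (weight T s) * linfNorm (heat s f) ≤ logBesovNorm T f :=
      le_iSup₂ (f := fun (s : ℝ) (_ : s ∈ Ioo (0 : ℝ) T) =>
        ENNReal.ofReal (weight T s) * linfNorm (heat s f)) s hs
    have h2 := h1.trans_lt h
    by_contra hcon
    have h3 : linfNorm (heat s f) = ∞ := by simpa using hcon
    rw [h3, ENNReal.mul_top (by simpa using weight_pos hs.1 hs.2.le)] at h2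
    exact lt_irrefl _ h2
  set s := min (t / 2) (T / 2) with hs
  have hs0 : 0 < s := lt_min (by positivity) (by positivity)
  have hst : s ≤ t := (min_le_left _ _).trans (by linarith)
  have hsT : s < T := (min_le_right _ _).trans_lt (by linarith)
  have h1 : heat t f = heat (t - s) (heat s f) := by
    rw [heat_heat (by linarith) hs0.le, sub_add_cancel]
  rw [h1]
  exact (linfNorm_heat_le (by linarith) _).trans_lt
    (ENNReal.mul_lt_top ENNReal.ofReal_lt_top (hlt s ⟨hs0, hsT⟩))

theorem continuousOn_nlinDist_apply {T M M' : ℝ} (hT : 0 < T) {U V : ℝ → Space N → Vec N} (hU : IsField T M U)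
    (hV : IsField T M' V) (φ : 𝓢(Space N, ℂ)) (i : Fin N) :
    ContinuousOn (fun t => nlinDist U V t φ i) (Icc 0 T) := by
  refine ContinuousOn.congr ?_ fun t ht => nlinDist_apply hU hV ht φ i
  exact continuousOn_finsetSum _ fun j _ => continuousOn_finsetSum _ fun k _ =>
    continuousOn_integral_oseenCorr i j k hT (hU.isSource hV j k) φ

theorem isReal_nlinDist {T M M' : ℝ} {U V : ℝ → Space N → Vec N} (hU : IsField T M U)
    (hV : IsField T M' V) (hUr : ∀ τ y i, (U τ y i).im = 0) (hVr : ∀ τ y i, (V τ y i).im = 0)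
    {t : ℝ} (ht : t ∈ Icc 0 T) : IsReal (nlinDist U V t) := by
  intro φ hφ i
  rcases ht.1.eq_or_lt with rfl | h0
  · rw [nlinDist_zero_time]; rfl
  rw [(isRep_nlinDist hU hV ⟨h0, ht.2⟩).apply_coord]
  refine Complex.conj_eq_iff_im.1 ?_
  rw [← integral_conj]
  congr 1; funext x
  rw [map_mul, Complex.conj_eq_iff_im.2 (hφ x), Complex.conj_eq_iff_im.2 (nlin_im hUr hVr 0 t x i)]

theorem integrable_oseenCorr_mul (i j k : Fin N) {T M : ℝ} (hT : 0 < T) {F : ℝ → Space N → ℂ}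
    (hF : IsSource T M F) {t : ℝ} (ht : t ∈ Icc 0 T) (φ : 𝓢(Space N, ℂ)) :
    Integrable (fun p => oseenCorr i j k (t - p.1) φ p.2 * F p.1 p.2) (slab N t) := by
  obtain ⟨C, hC, hCb⟩ := exists_norm_oseenCorr_le i j k hT φ
  have hb : Integrable (fun p => C * M * (decay p.2 * (weight T p.1 ^ 2)⁻¹)) (slab N t) := by
    rw [slab_eq_restrict ht.2]
    exact ((integrable_decay_mul_inv_weight_sq hT).const_mul _).restrict
  refine hb.mono' ?_ ?_
  · rw [slab_eq_restrict ht.2]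
    exact (aestronglyMeasurable_oseenCorr i j k φ t).mul hF.meas.aestronglyMeasurable
  · filter_upwards [ae_slab t] with p hp
    have hd := decay_pos p.2
    rw [norm_mul]
    have h1 := hCb (t - p.1) ⟨by linarith [hp.2], by linarith [ht.2, hp.1]⟩ p.2
    have h2 := hF.bound p.1 ⟨hp.1, hp.2.trans_le ht.2⟩ p.2
    calc _ ≤ (C * decay p.2) * (M * (weight T p.1 ^ 2)⁻¹) := by gcongr
      _ = _ := by ring

/-- After exchanging the sums, the sum over i of the correlations with ∂ᵢφ vanishes pointwise,
because ℙ projects onto divergence-free fields. -/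
theorem isDivFree_nlinDist {T M M' : ℝ} (hT : 0 < T) {U V : ℝ → Space N → Vec N} (hU : IsField T M U)
    (hV : IsField T M' V) {t : ℝ} (ht : t ∈ Icc 0 T) : IsDivFree (nlinDist U V t) := by
  rw [isDivFree_iff]
  intro φ
  simp_rw [nlinDist_apply hU hV ht]
  rw [Finset.sum_comm]
  refine Finset.sum_eq_zero fun j _ => ?_
  rw [Finset.sum_comm]
  refine Finset.sum_eq_zero fun k _ => ?_
  rw [← integral_finsetSum]
  · rw [← integral_zero (ℝ × Space N) ℂ (μ := slab N t)]
    refine integral_congr_ae ?_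
    filter_upwards [ae_slab t] with p hp
    rw [← Finset.sum_mul, sum_oseenCorr_lineDeriv j k (by linarith [hp.2]), zero_mul]
  · exact fun i _ => integrable_oseenCorr_mul i j k hT (hU.isSource hV j k) ht _

end LogBesovNS

end

noncomputable section

namespace LogBesovNS

open Filter Topology

variable {N : ℕ}

/-! ### Paths and fields -/

theorem linfNorm_le_of_weight_mul_le {T t A : ℝ} (ht : t ∈ Ioo 0 T) {f : VDist N}
    (h : ENNReal.ofReal (weight T t) * linfNorm f ≤ ENNReal.ofReal A) :
    linfNorm f ≤ ENNReal.ofReal (A * (weight T t)⁻¹) := by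
  have hw := weight_pos ht.1 ht.2.le
  rw [← div_eq_mul_inv, ENNReal.ofReal_div_of_pos hw,
    ENNReal.le_div_iff_mul_le (Or.inl (by simpa using hw)) (Or.inl ENNReal.ofReal_ne_top), mul_comm]
  exact h

theorem weight_mul_linfNorm_le {T t A : ℝ} (ht : t ∈ Ioo 0 T) {f : VDist N}
    (h : linfNorm f ≤ ENNReal.ofReal (A * (weight T t)⁻¹)) :
    ENNReal.ofReal (weight T t) * linfNorm f ≤ ENNReal.ofReal A := by
  have hw := weight_pos ht.1 ht.2.le
  calc _ ≤ ENNReal.ofReal (weight T t) * ENNReal.ofReal (A * (weight T t)⁻¹) := by gcongr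
    _ = ENNReal.ofReal A := by
        rw [← ENNReal.ofReal_mul hw.le]; congr 1; field_simp

theorem exists_field_of_path {T A : ℝ} (hA : 0 ≤ A) {p : ℝ → VDist N}
    (hp : ∀ φ, ContinuousOn (fun t => p t φ) (Ioo 0 T))
    (hle : ∀ t ∈ Ioo 0 T, ENNReal.ofReal (weight T t) * linfNorm (p t) ≤ ENNReal.ofReal A)
    (hr : ∀ t ∈ Ioo 0 T, IsReal (p t)) :
    ∃ U : ℝ → Space N → Vec N, IsField T A U ∧
      (∀ t ∈ Ioo 0 T, IsRep (p t) (U t) (A * (weight T t)⁻¹)) ∧ ∀ t x i, (U t x i).im = 0 := by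
  obtain ⟨U, h1, h2, h3, h4⟩ := exists_measurable_real_rep (m := fun t => A * (weight T t)⁻¹) hp
    ((measurable_weight T).inv.const_mul A)
    (fun t ht => mul_nonneg hA (inv_nonneg.2 (weight_pos ht.1 ht.2.le).le))
    (fun t ht => linfNorm_le_of_weight_mul_le ht (hle t ht)) hr
  exact ⟨U, ⟨h1, hA, h2⟩, h3, h4⟩

theorem continuousOn_of_coord {s : Set ℝ} {f : ℝ → Vec N}
    (h : ∀ i, ContinuousOn (fun t => f t i) s) : ContinuousOn f s := by
  have h1 : ContinuousOn (fun t => WithLp.toLp 2 fun i => f t i : ℝ → Vec N) s :=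
    (PiLp.continuous_toLp 2 _).comp_continuousOn (continuousOn_pi.2 h)
  exact h1

/-- Weak-`*` continuity yields continuity against test functions. -/
theorem WeakStarContinuous.continuousOn_apply {T : ℝ} {u : ℝ → LogBesov N T}
    (hu : WeakStarContinuous T u) (φ : 𝓢(Space N, ℂ)) :
    ContinuousOn (fun t => (u t : VDist N) φ) (Icc 0 T) := by
  classical
  refine continuousOn_of_coord fun i => ?_
  let ℓ : LogBesov N T →ₗ[ℂ] ℂ :=
    { toFun := fun f => (f : VDist N) φ i
      map_add' := fun f g => rfl
      map_smul' := fun c f => rfl }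
  refine hu ℓ fun ε _ => ⟨Pi.single i φ, fun f => ?_⟩
  have : ∑ j, (f : VDist N) ((Pi.single i φ : Fin N → 𝓢(Space N, ℂ)) j) j = (f : VDist N) φ i := by
    rw [Finset.sum_eq_single i]
    · rw [Pi.single_eq_same]
    · intro j _ hj
      rw [Pi.single_eq_of_ne hj, map_zero]; rfl
    · simp
  have h0 : ℓ f - (f : VDist N) φ i = 0 := sub_self _
  rw [this, h0, enorm_zero]
  exact bot_le

/-- A bounded path that is continuous against test functions is weak-`*` continuous. -/
theorem weakStarContinuous_of_bounded {T B : ℝ} {u : ℝ → LogBesov N T}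
    (hB : ∀ t ∈ Icc 0 T, logBesovNorm T (u t : VDist N) ≤ ENNReal.ofReal B)
    (hu : ∀ (φ : 𝓢(Space N, ℂ)) i, ContinuousOn (fun t => (u t : VDist N) φ i) (Icc 0 T)) :
    WeakStarContinuous T u := by
  intro ℓ hℓ
  -- A predual functional is a norm limit of pairings with Schwartz functions. Along a bounded path
  -- the approximation is uniform in t, and uniform limits of continuous functions are continuous.
  -- The denominator 2(|B|+1) makes the error strictly less than ε for every real B.
  refine continuousOn_of_uniform_approx_of_continuousOn fun W hW => ?_
  obtain ⟨ε, hε, hεW⟩ := Metric.mem_uniformity_dist.1 hW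
  have hden : 0 < 2 * (|B| + 1) := by positivity
  obtain ⟨Φ, hΦ⟩ := hℓ (ε / (2 * (|B| + 1))) (by positivity)
  refine ⟨fun t => ∑ i, (u t : VDist N) (Φ i) i,
    continuousOn_finsetSum _ fun i _ => hu (Φ i) i, fun t ht => hεW ?_⟩
  have h1 := (hΦ (u t)).trans (mul_le_mul_right (hB t ht) _)
  rw [← ENNReal.ofReal_mul (by positivity), ← ofReal_norm,
    ENNReal.ofReal_le_ofReal_iff' ] at h1
  rw [dist_eq_norm]
  have h2 : ε / (2 * (|B| + 1)) * B < ε := by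
    have : B < 2 * (|B| + 1) := by linarith [le_abs_self B, abs_nonneg B]
    rw [div_mul_eq_mul_div, div_lt_iff₀ hden]
    nlinarith
  rcases h1 with h1 | h1
  · exact h1.trans_lt h2
  · exact h1.trans_lt hε

/-- The bilinear term of a path in terms of a jointly measurable representative. -/
theorem bilin_eq_nlin {T M : ℝ} {p : ℝ → VDist N} {U : ℝ → Space N → Vec N} (hU : IsField T M U)
    (hp : ∀ τ ∈ Ioo 0 T, linfRep (p τ) =ᵐ[volume] U τ) {t : ℝ} (ht : t ∈ Icc 0 T) (x : Space N)
    (i : Fin N) : bilin p p t x i = nlin U U 0 t x i := by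
  rcases ht.1.eq_or_lt with rfl | h0
  · rw [nlin_zero_time]; simp [bilin]
  have hs : (0 : ℝ) ∈ Icc 0 T := ⟨le_rfl, ht.1.trans ht.2⟩
  have hi : ∀ j k, Integrable (fun q => kern i j k (0 + (t - q.1)) (x - q.2) * (U q.1 q.2 k * U q.1 q.2 j))
      ((volume.restrict (Ioo 0 t)).prod volume) :=
    fun j k => integrable_duhamel i j k (hU.isSource hU j k) hs ⟨h0, ht.2⟩ x
  -- The representatives are exchanged inside the y integral, separately for every τ. Joint
  -- measurability of `linfRep` is therefore never needed, and Fubini is applied only to U.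
  have h1 : bilin p p t x i = ∫ τ in Ioo 0 t, ∑ j, ∑ k, ∫ y, kern i j k (0 + (t - τ)) (x - y) *
      (U τ y k * U τ y j) := by
    refine setIntegral_congr_fun measurableSet_Ioo fun τ hτ => ?_
    refine Finset.sum_congr rfl fun j _ => Finset.sum_congr rfl fun k _ => ?_
    rw [zero_add, kern_of_pos i j k (sub_pos.2 hτ.2)]
    refine integral_congr_ae ?_
    filter_upwards [hp τ (⟨hτ.1, hτ.2.trans_le ht.2⟩)] with y hy
    rw [hy]
  rw [h1, integral_finsetSum]
  · rw [nlin_apply]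
    refine Finset.sum_congr rfl fun j _ => ?_
    rw [integral_finsetSum]
    · refine Finset.sum_congr rfl fun k _ => ?_
      rw [duhamel, slab, integral_prod _ (hi j k)]
    · exact fun k _ => (hi j k).integral_prod_left
  · exact fun j _ => integrable_finsetSum _ fun k _ => (hi j k).integral_prod_left

/-- Frees the equation from the arbitrary choice in `linfRep`: with any measurable field
representing the path it becomes an identity between distributions at each time, including t = 0. -/
theorem isMildSolution_iff {T M : ℝ} {u₀ : LogBesov N T} {u : ℝ → LogBesov N T}
    {U : ℝ → Space N → Vec N} (hU : IsField T M U)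
    (hp : ∀ τ ∈ Ioo 0 T, linfRep (u τ : VDist N) =ᵐ[volume] U τ) :
    IsMildSolution T u₀ u ↔
      ∀ t ∈ Icc 0 T, (u t : VDist N) = heat t (u₀ : VDist N) - nlinDist U U t := by
  have key : ∀ t ∈ Icc 0 T, ∀ (φ : 𝓢(Space N, ℂ)) i,
      ∫ x, φ x * bilin (fun τ => (u τ : VDist N)) (fun τ => (u τ : VDist N)) t x i =
        nlinDist U U t φ i := by
    intro t ht φ i
    simp_rw [bilin_eq_nlin hU hp ht]
    rcases ht.1.eq_or_lt with rfl | h0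
    · rw [nlin_zero_time, nlinDist_zero_time]; simp
    · rw [(isRep_nlinDist hU hU ⟨h0, ht.2⟩).apply_coord]
  refine forall₂_congr fun t ht => ?_
  constructor
  · intro h
    ext φ i
    rw [h φ i, key t ht φ i]; rfl
  · intro h φ i
    rw [h, key t ht φ i]; rfl

theorem isReal_sub {f g : VDist N} (hf : IsReal f) (hg : IsReal g) : IsReal (f - g) := by
  intro φ hφ i
  have : (f - g) φ i = f φ i - g φ i := rfl
  rw [this, Complex.sub_im, hf φ hφ i, hg φ hφ i, sub_zero]

theorem isDivFree_sub {f g : VDist N} (hf : IsDivFree f) (hg : IsDivFree g) : IsDivFree (f - g) := by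
  rw [isDivFree_iff] at *
  intro φ
  have : ∀ j, (f - g) (∂_{(EuclideanSpace.single j 1 : Space N)} φ) j =
    f (∂_{(EuclideanSpace.single j 1 : Space N)} φ) j - g (∂_{(EuclideanSpace.single j 1 : Space N)} φ) j :=
    fun j => rfl
  simp_rw [this, Finset.sum_sub_distrib, hf φ, hg φ, sub_zero]

theorem logBesovNorm_sub_le (T : ℝ) (f g : VDist N) :
    logBesovNorm T (f - g) ≤ logBesovNorm T f + logBesovNorm T g := by
  have h1 : f - g = f + (-1 : ℂ) • g := by
    rw [neg_one_smul ℂ g]; exact sub_eq_add_neg _ _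
  have h2 := logBesovNorm_smul_le T (-1) g
  rw [enorm_neg, enorm_one, one_mul] at h2
  rw [h1]
  exact (logBesovNorm_add_le T _ _).trans (add_le_add le_rfl h2)

theorem logBesovNorm_heat_le {T t : ℝ} (ht : 0 ≤ t) (f : VDist N) :
    logBesovNorm T (heat t f) ≤ ENNReal.ofReal (1 + heatMass N) * logBesovNorm T f := by
  refine iSup₂_le fun (s : ℝ) (hs : s ∈ Ioo (0 : ℝ) T) => ?_
  rw [heat_heat hs.1.le ht, add_comm, ← heat_heat ht hs.1.le]
  calc _ ≤ ENNReal.ofReal (weight T s) * (ENNReal.ofReal (1 + heatMass N) * linfNorm (heat s f)) := by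
        gcongr
        exact linfNorm_heat_le ht _
    _ = ENNReal.ofReal (1 + heatMass N) * (ENNReal.ofReal (weight T s) * linfNorm (heat s f)) := by ring
    _ ≤ _ := by
        gcongr
        exact le_iSup₂ (f := fun (s : ℝ) (_ : s ∈ Ioo (0 : ℝ) T) =>
          ENNReal.ofReal (weight T s) * linfNorm (heat s f)) s hs

theorem weight_mul_linfNorm_le_logBesovNorm {T t : ℝ} (ht : t ∈ Ioo 0 T) (f : VDist N) :
    ENNReal.ofReal (weight T t) * linfNorm (heat t f) ≤ logBesovNorm T f :=
  le_iSup₂ (f := fun (s : ℝ) (_ : s ∈ Ioo (0 : ℝ) T) =>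
    ENNReal.ofReal (weight T s) * linfNorm (heat s f)) t ht

/-! ### Picard iteration -/

/-- The Picard iterates. -/
def picard (U₀ : ℝ → Space N → Vec N) : ℕ → ℝ → Space N → Vec N
  | 0 => U₀
  | n + 1 => U₀ - nlin (picard U₀ n) (picard U₀ n) 0

theorem picard_im {U₀ : ℝ → Space N → Vec N} (h : ∀ t x i, (U₀ t x i).im = 0) (n : ℕ) :
    ∀ t x i, (picard U₀ n t x i).im = 0 := by
  induction n with
  | zero => exact h
  | succ n ih =>
    intro t x i
    have : picard U₀ (n + 1) t x i = U₀ t x i - nlin (picard U₀ n) (picard U₀ n) 0 t x i := rfl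
    rw [this, Complex.sub_im, h, nlin_im ih ih, sub_zero]

/-- With C the bilinear constant, the ball of radius 2A is preserved as soon as A + C(2A)² ≤ 2A,
that is 4CA ≤ 1. The stronger 8CA ≤ 1 is what makes the contraction ratio 1/2. -/
theorem isField_picard {T A : ℝ} {U₀ : ℝ → Space N → Vec N} (hU : IsField T A U₀)
    (hA : 8 * nlinConst N * A ≤ 1) (n : ℕ) : IsField T (2 * A) (picard U₀ n) := by
  have hA0 := hU.nonneg
  induction n with
  | zero => exact hU.mono (by linarith)
  | succ n ih =>
    refine (hU.sub (isField_nlin ih ih)).mono ?_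
    nlinarith

/-- The bilinear term is Lipschitz on balls. -/
theorem norm_nlin_sub_nlin_le {T M D : ℝ} {U V : ℝ → Space N → Vec N} (hU : IsField T M U)
    (hV : IsField T M V) (hd : IsField T D (U - V)) {s t : ℝ} (hs : s ∈ Icc 0 T) (ht : t ∈ Ioc 0 T)
    (x : Space N) : ‖nlin U U s t x - nlin V V s t x‖ ≤
      2 * nlinConst N * M * D * (weight T (max s t))⁻¹ := by
  rw [nlin_sub_nlin hU hV hs ht]
  refine (norm_add_le _ _).trans ((add_le_add (norm_nlin_le hU hd hs ht x)
    (norm_nlin_le hd hV hs ht x)).trans_eq ?_)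
  ring

theorem isField_nlin_sub_nlin {T M D : ℝ} {U V : ℝ → Space N → Vec N} (hU : IsField T M U)
    (hV : IsField T M V) (hd : IsField T D (U - V)) :
    IsField T (2 * nlinConst N * M * D) (nlin U U 0 - nlin V V 0) where
  meas := (measurable_nlin hU hU 0).sub (measurable_nlin hV hV 0)
  nonneg := by
    have := nlinConst_nonneg (N := N)
    have := hU.nonneg
    have := hd.nonneg
    positivity
  bound t ht x := by
    have h := norm_nlin_sub_nlin_le hU hV hd (s := 0) ⟨le_rfl, (ht.1.trans ht.2).le⟩ ⟨ht.1, ht.2.le⟩ x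
    rwa [max_eq_right ht.1.le] at h

/-- On the ball of radius 2A the quadratic term has Lipschitz constant 2C · 2A = 4CA ≤ 1/2. -/
theorem isField_picard_succ_sub {T A : ℝ} {U₀ : ℝ → Space N → Vec N} (hU : IsField T A U₀)
    (hA : 8 * nlinConst N * A ≤ 1) (n : ℕ) :
    IsField T (A * (1 / 2) ^ n) (picard U₀ (n + 1) - picard U₀ n) := by
  have hA0 := hU.nonneg
  have hC := nlinConst_nonneg (N := N)
  induction n with
  | zero =>
    have h : picard U₀ (0 + 1) - picard U₀ 0 = 0 - nlin U₀ U₀ 0 := by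
      funext t x
      simp only [picard, Pi.sub_apply, Pi.zero_apply]
      abel
    rw [h]
    have h0 : IsField T 0 (0 : ℝ → Space N → Vec N) := ⟨measurable_const, le_rfl, fun τ _ y => by simp⟩
    refine (h0.sub (isField_nlin hU hU)).mono ?_
    nlinarith
  | succ n ih =>
    have h : picard U₀ (n + 1 + 1) - picard U₀ (n + 1) =
        nlin (picard U₀ n) (picard U₀ n) 0 - nlin (picard U₀ (n + 1)) (picard U₀ (n + 1)) 0 := by
      funext t x
      simp only [picard, Pi.sub_apply]
      abel
    rw [h]
    have ih' : IsField T (A * (1 / 2) ^ n) (picard U₀ n - picard U₀ (n + 1)) := by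
      refine ⟨(isField_picard hU hA n).meas.sub (isField_picard hU hA (n + 1)).meas, ih.nonneg, ?_⟩
      intro τ hτ y
      have := ih.bound τ hτ y
      rwa [Pi.sub_apply, Pi.sub_apply, norm_sub_rev] at this
    refine (isField_nlin_sub_nlin (isField_picard hU hA n) (isField_picard hU hA (n + 1)) ih').mono ?_
    have h2 : 0 ≤ A * (1 / 2 : ℝ) ^ n := by positivity
    rw [pow_succ]
    nlinarith

/-- All Picard estimates hold at every point, so the iterates converge pointwise on (0,T) × ℝᴺ. The
limit is measurable and satisfies the equation at every x, with no exceptional set. -/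
theorem exists_picard_limit {T A : ℝ} {U₀ : ℝ → Space N → Vec N} (hU : IsField T A U₀)
    (hA : 8 * nlinConst N * A ≤ 1) (hr : ∀ t x i, (U₀ t x i).im = 0) :
    ∃ U, IsField T (2 * A) U ∧ (∀ t x i, (U t x i).im = 0) ∧
      ∀ t ∈ Ioo 0 T, ∀ x, U t x = U₀ t x - nlin U U 0 t x := by
  classical
  have hA0 := hU.nonneg
  have hC := nlinConst_nonneg (N := N)
  set L : ℝ × Space N → Vec N := fun q => limUnder atTop fun n => picard U₀ n q.1 q.2 with hL
  have hLm : Measurable L := (StronglyMeasurable.limUnder fun n =>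
    ((isField_picard hU hA n).meas.stronglyMeasurable : StronglyMeasurable fun q : ℝ × Space N =>
      picard U₀ n q.1 q.2)).measurable
  set U : ℝ → Space N → Vec N := fun t x => if t ∈ Ioo 0 T then L (t, x) else 0 with hUdef
  have hUm : Measurable (Function.uncurry U) :=
    Measurable.ite (measurable_fst measurableSet_Ioo) hLm measurable_const
  have hgeo : ∀ t ∈ Ioo 0 T, ∀ x n, dist (picard U₀ n t x) (picard U₀ (n + 1) t x) ≤
      A * (weight T t)⁻¹ * (1 / 2) ^ n := by
    intro t ht x n
    rw [dist_comm, dist_eq_norm]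
    exact ((isField_picard_succ_sub hU hA n).bound t ht x).trans_eq (by ring)
  have hlim : ∀ t ∈ Ioo 0 T, ∀ x, Tendsto (fun n => picard U₀ n t x) atTop (𝓝 (U t x)) := by
    intro t ht x
    have hc : CauchySeq fun n => picard U₀ n t x :=
      cauchySeq_of_le_geometric _ _ (by norm_num) (hgeo t ht x)
    have := tendsto_nhds_limUnder (cauchySeq_tendsto_of_complete hc)
    simp only [hUdef, if_pos ht]
    exact this
  -- The tail of the geometric series of increments: A(1/2)ⁿ summed from n on is 2A(1/2)ⁿ.
  have hdist : ∀ n, IsField T (2 * A * (1 / 2) ^ n) (U - picard U₀ n) := by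
    intro n
    refine ⟨hUm.sub (isField_picard hU hA n).meas, by positivity, fun t ht x => ?_⟩
    have := dist_le_of_le_geometric_of_tendsto _ _ (by norm_num) (hgeo t ht x) (hlim t ht x) n
    rw [dist_comm, dist_eq_norm] at this
    refine this.trans_eq ?_
    ring
  have hUf : IsField T (2 * A) U := by
    refine ⟨hUm, by positivity, fun t ht x => ?_⟩
    exact le_of_tendsto (hlim t ht x).norm (Eventually.of_forall fun n => (isField_picard hU hA n).bound t ht x)
  refine ⟨U, hUf, fun t x i => ?_, fun t ht x => ?_⟩
  · by_cases ht : t ∈ Ioo 0 T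
    · have h1 : Tendsto (fun n => (picard U₀ n t x i).im) atTop (𝓝 (U t x i).im) :=
        (Complex.continuous_im.comp (EuclideanSpace.proj (𝕜 := ℂ) i : Vec N →L[ℂ] ℂ).continuous).continuousAt.tendsto.comp
          (hlim t ht x)
      simp_rw [picard_im hr] at h1
      exact tendsto_nhds_unique tendsto_const_nhds h1 |>.symm
    · simp only [hUdef, if_neg ht]; rfl
  · have h1 := (hlim t ht x).comp (tendsto_add_atTop_nat 1)
    refine tendsto_nhds_unique h1 ?_
    have h2 : Tendsto (fun n => nlin (picard U₀ n) (picard U₀ n) 0 t x) atTop (𝓝 (nlin U U 0 t x)) := by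
      rw [tendsto_iff_norm_sub_tendsto_zero]
      have hb : Tendsto (fun n : ℕ => 2 * nlinConst N * (2 * A) * (2 * A) * (weight T t)⁻¹ * (1 / 2 : ℝ) ^ n)
          atTop (𝓝 0) := by
        simpa using (tendsto_pow_atTop_nhds_zero_of_lt_one (by norm_num) (by norm_num : (1 / 2 : ℝ) < 1)).const_mul
          (2 * nlinConst N * (2 * A) * (2 * A) * (weight T t)⁻¹)
      refine squeeze_zero (fun n => norm_nonneg _) (fun n => ?_) hb
      rw [norm_sub_rev]
      have := (isField_nlin_sub_nlin hUf (isField_picard hU hA n) (hdist n)).bound t ht x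
      refine this.trans_eq ?_
      ring
    exact tendsto_const_nhds.sub h2

/-- Existence of small mild solutions. -/
theorem exists_mildSolution {T A : ℝ} (hT : 0 < T) (hA0 : 0 ≤ A) (hA : 8 * nlinConst N * A ≤ 1)
    (u₀ : LogBesov N T) (hr : IsReal (u₀ : VDist N)) (hdiv : IsDivFree (u₀ : VDist N))
    (hle : logBesovNorm T (u₀ : VDist N) ≤ ENNReal.ofReal A) :
    ∃ u : ℝ → LogBesov N T, InClass T u ∧ IsMildSolution T u₀ u ∧
      pathNorm T u ≤ ENNReal.ofReal (2 * A) := by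
  classical
  obtain ⟨U₀, hU₀, hU₀rep, hU₀r⟩ := exists_field_of_path (p := fun t => heat t (u₀ : VDist N)) hA0
    (fun φ => (continuousOn_heat_apply _ φ).mono fun t ht => ht.1.le)
    (fun t ht => (weight_mul_linfNorm_le_logBesovNorm ht _).trans hle)
    (fun t ht => isReal_heat ht.1.le hr)
  obtain ⟨U, hU, hUr, hfix⟩ := exists_picard_limit hU₀ hA hU₀r
  have hC := nlinConst_nonneg (N := N)
  have hm := heatMass_nonneg (N := N)
  -- The Besov bound of e^{tΔ}u₀ plus that of the bilinear term for a field of size 2A.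
  set B : ℝ := (1 + heatMass N) * A + nlinConst N * (2 * A * (2 * A)) with hB
  set q : ℝ → VDist N := fun t => heat t (u₀ : VDist N) - nlinDist U U t with hq
  have hqB : ∀ t ∈ Icc 0 T, logBesovNorm T (q t) ≤ ENNReal.ofReal B := by
    intro t ht
    rw [hB, ENNReal.ofReal_add (by positivity) (by positivity)]
    refine (logBesovNorm_sub_le T _ _).trans (add_le_add ?_ ?_)
    · refine (logBesovNorm_heat_le ht.1 _).trans ?_
      rw [ENNReal.ofReal_mul (by positivity)]
      gcongr
    · exact logBesovNorm_nlinDist_le hU hU ht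
  -- The value 0 outside [0,T] is immaterial.
  set u : ℝ → LogBesov N T := fun t => if ht : t ∈ Icc 0 T then
    ⟨q t, mem_logBesov_of_norm hT ((hqB t ht).trans_lt ENNReal.ofReal_lt_top)⟩ else 0 with hu
  have huq : ∀ t ∈ Icc 0 T, (u t : VDist N) = q t := by
    intro t ht
    simp only [hu, dif_pos ht]
  have hurep : ∀ t ∈ Ioo 0 T, IsRep (u t : VDist N) (U t) (2 * A * (weight T t)⁻¹) := by
    intro t ht
    rw [huq t ⟨ht.1.le, ht.2.le⟩]
    have h1 := (hU₀rep t ht).sub (isRep_nlinDist hU hU ⟨ht.1, ht.2.le⟩)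
    have h2 := h1.congr (g' := U t) (Filter.EventuallyEq.of_eq (funext fun x => (hfix t ht x).symm))
    -- The difference of representatives only carries the sum of the two bounds; it is replaced by
    -- the bound 2A/w known for the limit U.
    exact ⟨h2.meas, ae_of_all _ (hU.bound t ht), h2.eq⟩
  have hpath : pathNorm T u ≤ ENNReal.ofReal (2 * A) :=
    iSup₂_le fun (t : ℝ) (ht : t ∈ Ioo (0 : ℝ) T) => weight_mul_linfNorm_le ht (hurep t ht).linfNorm_le
  have hlin : ∀ τ ∈ Ioo 0 T, linfRep (u τ : VDist N) =ᵐ[volume] U τ := fun τ hτ =>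
    (isRep_linfRep (by have := hU.bound τ hτ 0; exact (norm_nonneg _).trans this)
      (hurep τ hτ).linfNorm_le).ae_eq (hurep τ hτ)
  refine ⟨u, ⟨?_, ?_, ?_, hpath.trans_lt ENNReal.ofReal_lt_top⟩, ?_, hpath⟩
  · intro t ht
    rw [huq t ht]
    exact isReal_sub (isReal_heat ht.1 hr) (isReal_nlinDist hU hU hUr hUr ht)
  · refine weakStarContinuous_of_bounded (B := B) (fun t ht => ?_) fun φ i => ?_
    · rw [huq t ht]; exact hqB t ht
    · have h1 : ContinuousOn (fun t => heat t (u₀ : VDist N) φ i) (Icc 0 T) :=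
        (EuclideanSpace.proj (𝕜 := ℂ) i : Vec N →L[ℂ] ℂ).continuous.comp_continuousOn
          ((continuousOn_heat_apply _ φ).mono fun t ht => ht.1)
      refine (h1.sub (continuousOn_nlinDist_apply hT hU hU φ i)).congr fun t ht => ?_
      simp only [huq t ht]
      rfl
  · intro t ht
    rw [huq t ht]
    exact isDivFree_sub (isDivFree_heat ht.1 hdiv) (isDivFree_nlinDist hT hU hU ht)
  · exact (isMildSolution_iff hU hlin).2 huq

end LogBesovNS

end

noncomputable section

namespace LogBesovNS

open Filter Topology
open scoped RealInnerProductSpace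

variable {N : ℕ}

/-! ### Plancherel's theorem and the kernel as a Fourier multiplier -/

theorem fourier_smul_integral_eq {f g : Space N → ℂ} (hf : Integrable f) (hg : Integrable g) :
    ∫ ξ, 𝓕 f ξ * g ξ = ∫ x, f x * 𝓕 g x := by
  have h2 := VectorFourier.integral_fourierIntegral_smul_eq_flip (μ := volume) (ν := volume)
    (L := innerₗ (Space N)) Real.continuous_fourierChar (by
      have : Continuous fun p : Space N × Space N => ⟪p.1, p.2⟫ := by fun_prop
      exact this) hf hg
  have h3 : ∀ f : Space N → ℂ, VectorFourier.fourierIntegral Real.fourierChar volume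
      (innerₗ (Space N)) f = 𝓕 f := fun f => rfl
  have h4 : ∀ f : Space N → ℂ, VectorFourier.fourierIntegral Real.fourierChar volume
      (innerₗ (Space N)).flip f = 𝓕 f := by
    intro f
    rw [← h3]
    congr 1
    ext; simp
  rw [h3, h4] at h2
  simpa only [smul_eq_mul] using h2

theorem norm_fourier_le_integral (f : Space N → ℂ) (ξ : Space N) : ‖𝓕 f ξ‖ ≤ ∫ x, ‖f x‖ :=
  VectorFourier.norm_fourierIntegral_le_integral_norm _ _ _ _ _

theorem continuous_fourier {f : Space N → ℂ} (hf : Integrable f) : Continuous (𝓕 f) :=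
  VectorFourier.fourierIntegral_continuous Real.continuous_fourierChar
    (by
      have : Continuous fun p : Space N × Space N => ⟪p.1, p.2⟫ := by fun_prop
      exact this) hf

/-- Plancherel's theorem for `L¹ ∩ L²`. -/
theorem lintegral_enorm_fourier_sq {f : Space N → ℂ} (hf : Integrable f) (hf2 : MemLp f 2 volume) :
    ∫⁻ ξ, ‖𝓕 f ξ‖ₑ ^ 2 = ∫⁻ x, ‖f x‖ₑ ^ 2 := by
  set F := hf2.toLp f with hF
  have hG := Lp.fourier_toTemperedDistribution_eq F
  -- The abstract L² Fourier transform is identified with the Fourier integral by comparing the two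
  -- as distributions on compactly supported smooth functions; the isometry then transfers.
  have hae : (𝓕 F : Lp ℂ 2 (volume : Measure (Space N))) =ᵐ[volume] 𝓕 f := by
    refine ae_eq_of_integral_contDiff_smul_eq ((Lp.memLp _).locallyIntegrable (by norm_num))
      (continuous_fourier hf).locallyIntegrable fun ψ hψ hc => ?_
    set φ : 𝓢(Space N, ℂ) := HasCompactSupport.toSchwartzMap (f := fun x => ((ψ x : ℝ) : ℂ))
      (hc.comp_left (g := Complex.ofReal) Complex.ofReal_zero) (Complex.ofRealCLM.contDiff.comp hψ) with hφ
    have h1 := congrArg (fun D : 𝓢'(Space N, ℂ) => D φ) hG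
    simp only [TemperedDistribution.fourier_apply, Lp.toTemperedDistribution_apply] at h1
    have h2 : ∫ x, (𝓕 φ : 𝓢(Space N, ℂ)) x • F x = ∫ x, 𝓕 (φ : Space N → ℂ) x * f x := by
      refine integral_congr_ae ?_
      filter_upwards [hf2.coeFn_toLp] with x hx
      rw [hx, SchwartzMap.fourier_coe]; rfl
    rw [h2, fourier_smul_integral_eq φ.integrable hf] at h1
    have h3 : ∀ (x : Space N) (z : ℂ), ψ x • z = φ x * z := fun x z => Complex.real_smul
    simp_rw [h3]
    exact h1.symm
  have e1 : eLpNorm (𝓕 f) 2 volume = eLpNorm f 2 volume := by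
    have hn := Lp.norm_fourier_eq F
    rw [← eLpNorm_congr_ae hae, ← eLpNorm_congr_ae hf2.coeFn_toLp]
    rw [Lp.norm_def, Lp.norm_def] at hn
    exact (ENNReal.toReal_eq_toReal_iff' (Lp.eLpNorm_ne_top _) (Lp.eLpNorm_ne_top _)).1 hn
  have e2 : ∀ g : Space N → ℂ, ∫⁻ x, ‖g x‖ₑ ^ 2 = eLpNorm g 2 volume ^ 2 := by
    intro g
    have := eLpNorm_nnreal_pow_eq_lintegral (μ := volume) (f := g) (p := 2) two_ne_zero
    simp only [NNReal.coe_ofNat, ENNReal.coe_ofNat, ENNReal.rpow_ofNat] at this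
    exact this.symm
  rw [e2, e2, e1]

theorem integral_fourierInv_sub_mul {m h : Space N → ℂ} (hm : Integrable m) (hh : Integrable h)
    (x : Space N) : ∫ y, 𝓕⁻ m (x - y) * h y = 𝓕⁻ (fun ξ => m ξ * 𝓕 h ξ) x := by
  have h1 : ∀ y, 𝓕⁻ m (x - y) = 𝓕 (fun ξ => Real.fourierChar ⟪ξ, x⟫ • m ξ) y := by
    intro y
    rw [Real.fourierInv_eq, Real.fourier_eq]
    congr 1; funext ξ
    rw [smul_smul, ← AddChar.map_add_eq_mul, inner_sub_right, sub_eq_add_neg, add_comm]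
  have hm' : Integrable (fun ξ => Real.fourierChar ⟪ξ, x⟫ • m ξ) := integrable_fourierInv_integrand hm x
  simp_rw [h1]
  rw [fourier_smul_integral_eq hm' hh, Real.fourierInv_eq]
  congr 1; funext ξ
  rw [smul_mul_assoc]

/-! ### Square function bounds -/

/-- Convolution with the Oseen kernel. -/
def oseenConv (i j k : Fin N) (t : ℝ) (h : Space N → ℂ) (x : Space N) : ℂ :=
  ∫ y, kern i j k t (x - y) * h y

theorem measurable_oseenSymbol_uncurry (i j k : Fin N) :
    Measurable fun p : ℝ × Space N => oseenSymbol i j k p.1 p.2 := by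
  have h1 := (continuous_heatSymbol_uncurry (N := N)).measurable
  unfold oseenSymbol
  refine (h1.mul ?_).mul ?_ <;> fun_prop

theorem memLp_two_oseenSymbol (i j k : Fin N) {t : ℝ} (ht : 0 < t) :
    Integrable fun ξ : Space N => ‖oseenSymbol i j k t ξ‖ ^ 2 := by
  have h := (integrable_norm_pow_mul_heatSymbol (N := N) ht 2).const_mul ((4 * Real.pi) ^ 2)
  refine h.mono' ((measurable_oseenSymbol i j k t).norm.pow_const 2).aestronglyMeasurable
    (ae_of_all _ fun ξ => ?_)
  have h1 := norm_oseenSymbol_le i j k t ξ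
  have h2 := norm_heatSymbol_le_one ht.le ξ
  rw [Real.norm_of_nonneg (by positivity)]
  calc ‖oseenSymbol i j k t ξ‖ ^ 2 ≤ (4 * Real.pi * (‖ξ‖ * ‖heatSymbol t ξ‖)) ^ 2 := by gcongr
    _ = (4 * Real.pi) ^ 2 * (‖ξ‖ ^ 2 * (‖heatSymbol t ξ‖ * ‖heatSymbol t ξ‖)) := by ring
    _ ≤ (4 * Real.pi) ^ 2 * (‖ξ‖ ^ 2 * (‖heatSymbol t ξ‖ * 1)) := by gcongr
    _ = _ := by ring

/-- Convolution with the kernel is a Fourier multiplier. For integrable h the transform 𝓕h is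
bounded, so the product with the symbol lies in L¹ ∩ L² and Plancherel applies. -/
theorem lintegral_oseenConv_sq (i j k : Fin N) {t : ℝ} (ht : 0 < t) {h : Space N → ℂ}
    (hh : Integrable h) :
    ∫⁻ x, ‖oseenConv i j k t h x‖ₑ ^ 2 = ∫⁻ ξ, ‖oseenSymbol i j k t ξ‖ₑ ^ 2 * ‖𝓕 h ξ‖ₑ ^ 2 := by
  set m : Space N → ℂ := fun ξ => oseenSymbol i j k t ξ * 𝓕 h ξ with hm
  have hmm : AEStronglyMeasurable m volume := ((measurable_oseenSymbol i j k t).mul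
    (continuous_fourier hh).measurable).aestronglyMeasurable
  have hmi : Integrable m := by
    refine ((integrable_oseenSymbol i j k ht).norm.mul_const (∫ x, ‖h x‖)).mono' hmm
      (ae_of_all _ fun ξ => ?_)
    rw [norm_mul]
    gcongr
    exact norm_fourier_le_integral h ξ
  have hm2 : MemLp m 2 volume := by
    rw [memLp_two_iff_integrable_sq_norm hmm]
    refine ((memLp_two_oseenSymbol i j k ht).mul_const ((∫ x, ‖h x‖) ^ 2)).mono' (hmm.norm.pow 2)
      (ae_of_all _ fun ξ => ?_)
    rw [Real.norm_of_nonneg (by positivity), norm_mul, mul_pow]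
    have := norm_fourier_le_integral h ξ
    gcongr
  have h1 : ∀ x, oseenConv i j k t h x = 𝓕 m (-x) := by
    intro x
    rw [oseenConv, kern_of_pos i j k ht]
    unfold oseenKernel
    rw [integral_fourierInv_sub_mul (integrable_oseenSymbol i j k ht) hh, Real.fourierInv_eq_fourier_neg]
  simp_rw [h1]
  rw [lintegral_neg_eq_self (fun x => ‖𝓕 m x‖ₑ ^ 2), lintegral_enorm_fourier_sq hmi hm2]
  refine lintegral_congr fun ξ => ?_
  rw [hm, enorm_mul, mul_pow]

/-- With c = 8π²|ξ|² one has |σ_t(ξ)|² ≤ 2c e^{-ct}, whose time integral is at most 2 for every ξ.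
This is parabolic smoothing: integrating in time in L² recovers the whole derivative. -/
theorem lintegral_oseenSymbol_sq_le (i j k : Fin N) {T : ℝ} (hT : 0 < T) (ξ : Space N) :
    ∫⁻ t in Ioo 0 T, ‖oseenSymbol i j k t ξ‖ₑ ^ 2 ≤ 2 := by
  set c : ℝ := 8 * Real.pi ^ 2 * ‖ξ‖ ^ 2 with hc
  have hc0 : 0 ≤ c := by positivity
  have h := lintegral_deriv_of_nonneg (g := fun t => -(2 * Real.exp (-(c * t))))
    (g' := fun t => 2 * c * Real.exp (-(c * t))) hT.le (by fun_prop) (fun x _ => by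
      have h1 : HasDerivAt (fun t : ℝ => -(c * t)) (-(c * 1)) x := ((hasDerivAt_id x).const_mul c).neg
      have h2 := (h1.exp.const_mul 2).neg
      refine h2.congr_deriv ?_
      ring) (fun x _ => by positivity)
  calc _ ≤ ∫⁻ t in Ioo 0 T, ENNReal.ofReal (2 * c * Real.exp (-(c * t))) := by
        refine lintegral_mono fun t => ?_
        rw [← ofReal_norm, ← ENNReal.ofReal_pow (norm_nonneg _)]
        refine ENNReal.ofReal_le_ofReal ?_
        have h1 := norm_oseenSymbol_le i j k t ξ
        rw [norm_heatSymbol] at h1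
        calc ‖oseenSymbol i j k t ξ‖ ^ 2 ≤
            (4 * Real.pi * (‖ξ‖ * Real.exp (-(4 * Real.pi ^ 2 * t * ‖ξ‖ ^ 2)))) ^ 2 := by gcongr
          _ = 2 * c * (Real.exp (-(4 * Real.pi ^ 2 * t * ‖ξ‖ ^ 2)) * Real.exp (-(4 * Real.pi ^ 2 * t * ‖ξ‖ ^ 2))) := by
              rw [hc]; ring
          _ = _ := by
              rw [← Real.exp_add, hc]; congr 2; ring
    _ = ENNReal.ofReal (2 - 2 * Real.exp (-(c * T))) := by
        rw [h]; congr 1; simp; ring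
    _ ≤ ENNReal.ofReal 2 := ENNReal.ofReal_le_ofReal (by linarith [Real.exp_pos (-(c * T))])
    _ = 2 := by simp

/-- The square function of the Oseen kernel is bounded on `L²`. -/
theorem lintegral_lintegral_oseenConv_sq_le (i j k : Fin N) {T : ℝ} (hT : 0 < T) {h : Space N → ℂ}
    (hh : Integrable h) (hh2 : MemLp h 2 volume) :
    ∫⁻ t in Ioo 0 T, ∫⁻ x, ‖oseenConv i j k t h x‖ₑ ^ 2 ≤ 2 * ∫⁻ x, ‖h x‖ₑ ^ 2 := by
  have hm : Measurable fun p : ℝ × Space N => ‖oseenSymbol i j k p.1 p.2‖ₑ ^ 2 * ‖𝓕 h p.2‖ₑ ^ 2 :=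
    ((measurable_oseenSymbol_uncurry i j k).enorm.pow_const 2).mul
      (((continuous_fourier hh).measurable.comp measurable_snd).enorm.pow_const 2)
  calc _ = ∫⁻ t in Ioo 0 T, ∫⁻ ξ, ‖oseenSymbol i j k t ξ‖ₑ ^ 2 * ‖𝓕 h ξ‖ₑ ^ 2 :=
        setLIntegral_congr_fun measurableSet_Ioo fun t ht => lintegral_oseenConv_sq i j k ht.1 hh
    _ = ∫⁻ ξ, ∫⁻ t in Ioo 0 T, ‖oseenSymbol i j k t ξ‖ₑ ^ 2 * ‖𝓕 h ξ‖ₑ ^ 2 :=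
        lintegral_lintegral_swap hm.aemeasurable
    _ ≤ ∫⁻ ξ, 2 * ‖𝓕 h ξ‖ₑ ^ 2 := by
        refine lintegral_mono fun ξ => ?_
        rw [lintegral_mul_const' _ _ (by simp)]
        gcongr
        exact lintegral_oseenSymbol_sq_le i j k hT ξ
    _ = _ := by
        rw [lintegral_const_mul' _ _ (by simp), lintegral_enorm_fourier_sq hh hh2]

end LogBesovNS

end

noncomputable section

namespace LogBesovNS

open Filter Topology

variable {N : ℕ}

/-! ### Weighted square function bounds -/

/-- Cauchy-Schwarz for √w and √w f. It is used in space against the decay function and in time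
against a singular weight. -/
theorem sq_lintegral_mul_le {α : Type*} [MeasurableSpace α] {μ : Measure α} {w f : α → ℝ≥0∞}
    (hw : AEMeasurable w μ) (hf : AEMeasurable f μ) :
    (∫⁻ x, w x * f x ∂μ) ^ 2 ≤ (∫⁻ x, w x ∂μ) * ∫⁻ x, w x * f x ^ 2 ∂μ := by
  have hs : ∀ a : ℝ≥0∞, a ^ (1 / 2 : ℝ) * a ^ (1 / 2 : ℝ) = a := fun a => by
    rw [← ENNReal.rpow_add_of_nonneg _ _ (by norm_num) (by norm_num)]; norm_num
  have hs2 : ∀ a : ℝ≥0∞, (a ^ (1 / 2 : ℝ)) ^ 2 = a := fun a => by rw [sq, hs]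
  have h := ENNReal.lintegral_mul_le_Lp_mul_Lq μ (Real.HolderConjugate.two_two)
    (hw.pow_const (1 / 2 : ℝ)) ((hw.pow_const (1 / 2 : ℝ)).mul hf)
  have e1 : ∀ x, ((fun x => w x ^ (1 / 2 : ℝ)) * ((fun x => w x ^ (1 / 2 : ℝ)) * f)) x = w x * f x := by
    intro x
    simp only [Pi.mul_apply]
    rw [← mul_assoc, hs]
  have e2 : ∀ x, (w x ^ (1 / 2 : ℝ)) ^ (2 : ℝ) = w x := by
    intro x
    rw [ENNReal.rpow_two, hs2]
  have e3 : ∀ x, (((fun x => w x ^ (1 / 2 : ℝ)) * f) x) ^ (2 : ℝ) = w x * f x ^ 2 := by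
    intro x
    rw [ENNReal.rpow_two, Pi.mul_apply, mul_pow, hs2]
  simp only [e1, e2, e3] at h
  calc _ ≤ ((∫⁻ x, w x ∂μ) ^ (1 / 2 : ℝ) * (∫⁻ x, w x * f x ^ 2 ∂μ) ^ (1 / 2 : ℝ)) ^ 2 := by gcongr
    _ = _ := by rw [mul_pow, hs2, hs2]

theorem ennreal_add_sq_le (a b : ℝ≥0∞) : (a + b) ^ 2 ≤ 4 * (a ^ 2 + b ^ 2) := by
  rcases le_total a b with h | h
  · calc (a + b) ^ 2 ≤ (b + b) ^ 2 := by gcongr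
      _ = 4 * b ^ 2 := by ring
      _ ≤ _ := by gcongr; exact le_add_self
  · calc (a + b) ^ 2 ≤ (a + a) ^ 2 := by gcongr
      _ = 4 * a ^ 2 := by ring
      _ ≤ _ := by gcongr; exact le_self_add

theorem integrable_kern (i j k : Fin N) (t : ℝ) (x : Space N) :
    Integrable fun y : Space N => kern i j k t (x - y) := by
  have hm : Measurable fun y : Space N => kern i j k t (x - y) :=
    (measurable_kern i j k).comp (by fun_prop : Measurable fun y : Space N => (t, x - y))
  exact ⟨hm.aestronglyMeasurable, (lintegral_kern_le i j k t x).trans_lt ENNReal.ofReal_lt_top⟩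

theorem integrable_kern_mul (i j k : Fin N) (t : ℝ) (x : Space N) {h : Space N → ℂ}
    (hm : Measurable h) {B : ℝ} (hB : ∀ y, ‖h y‖ ≤ B) :
    Integrable fun y : Space N => kern i j k t (x - y) * h y :=
  (integrable_kern i j k t x).mul_bdd hm.aestronglyMeasurable (ae_of_all _ hB)

theorem measurable_oseenConv (i j k : Fin N) {h : Space N → ℂ} (hm : Measurable h) :
    Measurable fun p : ℝ × Space N => oseenConv i j k p.1 h p.2 := by
  have h1 : Measurable fun q : (ℝ × Space N) × Space N => kern i j k q.1.1 (q.1.2 - q.2) * h q.2 :=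
    ((measurable_kern i j k).comp (by fun_prop :
      Measurable fun q : (ℝ × Space N) × Space N => (q.1.1, q.1.2 - q.2))).mul (hm.comp measurable_snd)
  exact (h1.stronglyMeasurable.integral_prod_right' (ν := (volume : Measure (Space N)))).measurable

theorem lintegral_decay_ne_top : ∫⁻ x : Space N, ENNReal.ofReal (decay x) ≠ ∞ := by
  rw [← ofReal_integral_eq_lintegral_ofReal integrable_decay (ae_of_all _ fun x => (decay_pos x).le)]
  exact ENNReal.ofReal_ne_top

/-- Far from its centre, the Oseen kernel is bounded by the decay function, uniformly in time. -/
theorem norm_kern_le_of_one_le (i j k : Fin N) (t : ℝ) {x : Space N} (hx : 1 ≤ ‖x‖) :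
    ‖kern i j k t x‖ ≤ kernelConst N * 2 ^ (N + 1) * decay x := by
  have hk := kernelConst_pos (N := N)
  have hd := decay_pos x
  unfold kern
  split_ifs with ht
  · refine (norm_oseenKernel_le i j k ht x).trans ?_
    rw [mul_assoc]
    gcongr
    rw [decay, ← div_eq_mul_inv, ← one_div, div_le_div_iff₀ (by positivity) (by positivity), one_mul,
      ← mul_pow]
    have := Real.sqrt_nonneg t
    gcongr
    linarith
  · rw [norm_zero]; positivity

/-- Local square function bound for bounded data. -/
theorem exists_local_square_bound (i j k : Fin N) {T : ℝ} (hT : 0 < T) :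
    ∃ C : ℝ≥0∞, C ≠ ∞ ∧ ∀ (h : Space N → ℂ) (B : ℝ), Measurable h → (∀ y, ‖h y‖ ≤ B) →
      ∀ b : Space N, ∫⁻ t in Ioo 0 T, ∫⁻ x in Metric.ball b 1, ‖oseenConv i j k t h x‖ₑ ^ 2 ≤
        C * ∫⁻ y, ENNReal.ofReal (decay (b - y)) * ‖h y‖ₑ ^ 2 := by
  set D : ℝ≥0∞ := ∫⁻ x : Space N, ENNReal.ofReal (decay x) with hD
  set v : ℝ≥0∞ := volume (Metric.ball (0 : Space N) 1) with hv
  set A : ℝ≥0∞ := ENNReal.ofReal (kernelConst N * 2 ^ (N + 1)) with hA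
  set E : ℝ≥0∞ := ENNReal.ofReal (2 ^ (N + 1)) with hE
  set E3 : ℝ≥0∞ := ENNReal.ofReal (3 ^ (N + 1)) with hE3
  have hk := kernelConst_pos (N := N)
  refine ⟨4 * (2 * E3 + ENNReal.ofReal T * (v * (A ^ 2 * (D * E)))), ?_, ?_⟩
  · have hDt : D ≠ ∞ := lintegral_decay_ne_top
    have hvt : v ≠ ∞ := measure_ball_lt_top.ne
    finiteness
  intro h B hm hB b
  set J : ℝ≥0∞ := ∫⁻ y, ENNReal.ofReal (decay (b - y)) * ‖h y‖ₑ ^ 2 with hJ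
  -- The data are cut at distance 2 from b. The near part is in L² and the global square function
  -- bound applies, with 3^{N+1} bounding the inverse decay there. For the far part and x within 1
  -- of b the kernel is evaluated at distance at least 1, where it is dominated by the decay
  -- function uniformly in time. The bound B on h is only qualitative and does not enter the
  -- constant.
  set s : Set (Space N) := Metric.ball b 2 with hs
  have hsm : MeasurableSet s := measurableSet_ball
  set h₁ : Space N → ℂ := s.indicator h with hh₁
  set h₂ : Space N → ℂ := sᶜ.indicator h with hh₂
  have hm₁ : Measurable h₁ := hm.indicator hsm
  have hm₂ : Measurable h₂ := hm.indicator hsm.compl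
  have hB₁ : ∀ y, ‖h₁ y‖ ≤ B := fun y => (norm_indicator_le_norm_self _ _).trans (hB y)
  have hB₂ : ∀ y, ‖h₂ y‖ ≤ B := fun y => (norm_indicator_le_norm_self _ _).trans (hB y)
  have hsplit : ∀ t x, oseenConv i j k t h x = oseenConv i j k t h₁ x + oseenConv i j k t h₂ x := by
    intro t x
    rw [oseenConv, oseenConv, oseenConv, ← integral_add (integrable_kern_mul i j k t x hm₁ hB₁)
      (integrable_kern_mul i j k t x hm₂ hB₂)]
    congr 1; funext y
    rw [← mul_add]
    congr 1
    exact (congrFun (indicator_self_add_compl s h) y).symm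
  have hBd : ∀ y, 0 ≤ B := fun y => (norm_nonneg _).trans (hB y)
  have hnear : ∫⁻ t in Ioo 0 T, ∫⁻ x in Metric.ball b 1, ‖oseenConv i j k t h₁ x‖ₑ ^ 2 ≤ 2 * E3 * J := by
    have hi : Integrable h₁ := by
      refine (integrable_indicator_iff hsm).2 ?_
      exact Measure.integrableOn_of_bounded (M := B) measure_ball_lt_top.ne hm.aestronglyMeasurable
        (ae_of_all _ hB)
    have hi2 : MemLp h₁ 2 volume := by
      rw [memLp_two_iff_integrable_sq_norm hi.aestronglyMeasurable]
      refine (hi.norm.const_mul B).mono' (hi.aestronglyMeasurable.norm.pow 2) (ae_of_all _ fun y => ?_)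
      rw [Real.norm_of_nonneg (by positivity), sq]
      gcongr
      exact hB₁ y
    calc _ ≤ ∫⁻ t in Ioo 0 T, ∫⁻ x, ‖oseenConv i j k t h₁ x‖ₑ ^ 2 :=
          lintegral_mono fun t => setLIntegral_le_lintegral _ _
      _ ≤ 2 * ∫⁻ x, ‖h₁ x‖ₑ ^ 2 := lintegral_lintegral_oseenConv_sq_le i j k hT hi hi2
      _ ≤ 2 * ∫⁻ y, E3 * (ENNReal.ofReal (decay (b - y)) * ‖h y‖ₑ ^ 2) := by
          gcongr with y
          by_cases hy : y ∈ s
          · rw [hh₁, indicator_of_mem hy, ← mul_assoc, hE3, ← ENNReal.ofReal_mul (by positivity)]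
            refine le_mul_of_one_le_left bot_le ?_
            rw [ENNReal.one_le_ofReal, decay, ← div_eq_mul_inv, one_le_div (by positivity)]
            have : ‖b - y‖ < 2 := by rw [← dist_eq_norm, dist_comm]; exact hy
            exact pow_le_pow_left₀ (by positivity) (by linarith) _
          · rw [hh₁, indicator_of_notMem hy]; simp
      _ = _ := by rw [lintegral_const_mul' _ _ ENNReal.ofReal_ne_top, mul_assoc]
  have hfar : ∀ t, ∀ x ∈ Metric.ball b 1, ‖oseenConv i j k t h₂ x‖ₑ ^ 2 ≤ A ^ 2 * (D * E) * J := by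
    intro t x hx
    have hxb : ‖x - b‖ < 1 := by rwa [← dist_eq_norm]
    have hw : Measurable fun y : Space N => ENNReal.ofReal (decay (x - y)) :=
      (continuous_decay.measurable.comp (by fun_prop)).ennreal_ofReal
    have e1 : ‖oseenConv i j k t h₂ x‖ₑ ≤ A * ∫⁻ y, ENNReal.ofReal (decay (x - y)) * ‖h y‖ₑ := by
      rw [← lintegral_const_mul' _ _ ENNReal.ofReal_ne_top]
      refine (enorm_integral_le_lintegral_enorm _).trans (lintegral_mono fun y => ?_)
      by_cases hy : y ∈ s
      · rw [hh₂, indicator_of_notMem (by simpa using hy)]; simp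
      · rw [hh₂, indicator_of_mem hy, enorm_mul, ← mul_assoc, ← ENNReal.ofReal_mul (by positivity)]
        gcongr
        rw [← ofReal_norm]
        refine ENNReal.ofReal_le_ofReal (norm_kern_le_of_one_le i j k t ?_)
        have h2 : 2 ≤ ‖y - b‖ := by rw [← dist_eq_norm]; simpa [hs] using hy
        have h3 := norm_sub_le_norm_sub_add_norm_sub y x b
        rw [norm_sub_rev y x] at h3
        linarith
    have e2 := sq_lintegral_mul_le (μ := volume) hw.aemeasurable hm.enorm.aemeasurable
    have e3 : ∫⁻ y : Space N, ENNReal.ofReal (decay (x - y)) = D :=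
      lintegral_sub_left_eq_self (fun y => ENNReal.ofReal (decay y)) x
    have e4 : ∫⁻ y, ENNReal.ofReal (decay (x - y)) * ‖h y‖ₑ ^ 2 ≤ E * J := by
      rw [hJ, ← lintegral_const_mul' _ _ ENNReal.ofReal_ne_top]
      refine lintegral_mono fun y => ?_
      rw [← mul_assoc, ← ENNReal.ofReal_mul (by positivity)]
      gcongr
      refine decay_le_of_norm_le ?_
      have h3 := norm_sub_le_norm_sub_add_norm_sub b x y
      rw [norm_sub_rev b x] at h3
      linarith [norm_nonneg (x - y)]
    rw [e3] at e2
    calc ‖oseenConv i j k t h₂ x‖ₑ ^ 2 ≤ (A * ∫⁻ y, ENNReal.ofReal (decay (x - y)) * ‖h y‖ₑ) ^ 2 := by gcongr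
      _ = A ^ 2 * (∫⁻ y, ENNReal.ofReal (decay (x - y)) * ‖h y‖ₑ) ^ 2 := by rw [mul_pow]
      _ ≤ A ^ 2 * (D * (E * J)) := by gcongr; exact e2.trans (by gcongr)
      _ = _ := by ring
  have hmc : ∀ g : Space N → ℂ, Measurable g →
      Measurable fun t => ∫⁻ x in Metric.ball b 1, ‖oseenConv i j k t g x‖ₑ ^ 2 := fun g hg =>
    ((measurable_oseenConv i j k hg).enorm.pow_const 2).lintegral_prod_right'
  have hmx : ∀ g : Space N → ℂ, Measurable g → ∀ t, Measurable fun x => ‖oseenConv i j k t g x‖ₑ ^ 2 :=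
    fun g hg t => ((measurable_oseenConv i j k hg).comp (measurable_prodMk_left (x := t))).enorm.pow_const 2
  calc _ ≤ ∫⁻ t in Ioo 0 T, 4 * ((∫⁻ x in Metric.ball b 1, ‖oseenConv i j k t h₁ x‖ₑ ^ 2) +
        ∫⁻ x in Metric.ball b 1, ‖oseenConv i j k t h₂ x‖ₑ ^ 2) := by
        refine lintegral_mono fun t => ?_
        rw [← lintegral_add_left (hmx h₁ hm₁ t), ← lintegral_const_mul' _ _ (by simp)]
        refine lintegral_mono fun x => ?_
        rw [hsplit]
        exact (pow_le_pow_left₀ bot_le (enorm_add_le _ _) 2).trans (ennreal_add_sq_le _ _)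
    _ = 4 * ((∫⁻ t in Ioo 0 T, ∫⁻ x in Metric.ball b 1, ‖oseenConv i j k t h₁ x‖ₑ ^ 2) +
        ∫⁻ t in Ioo 0 T, ∫⁻ x in Metric.ball b 1, ‖oseenConv i j k t h₂ x‖ₑ ^ 2) := by
        rw [lintegral_const_mul' _ _ (by simp), lintegral_add_left (hmc h₁ hm₁)]
    _ ≤ 4 * (2 * E3 * J + ENNReal.ofReal T * (v * (A ^ 2 * (D * E) * J))) := by
        gcongr
        calc _ ≤ ∫⁻ _t in Ioo 0 T, v * (A ^ 2 * (D * E) * J) := by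
              refine lintegral_mono fun t => ?_
              refine (setLIntegral_mono' measurableSet_ball (hfar t)).trans ?_
              rw [setLIntegral_const, mul_comm, Measure.addHaar_ball_center]
          _ = _ := by
              rw [setLIntegral_const, Real.volume_Ioo, sub_zero, mul_comm]
    _ = _ := by ring

/-- Weighted integrals are controlled by averages of local integrals. -/
theorem lintegral_decay_mul_le_average {F : Space N → ℝ≥0∞} (hF : Measurable F) :
    volume (Metric.ball (0 : Space N) 1) * ∫⁻ x, ENNReal.ofReal (decay x) * F x ≤
      ENNReal.ofReal (2 ^ (N + 1)) *
        ∫⁻ b, ENNReal.ofReal (decay b) * ∫⁻ x in Metric.ball b 1, F x := by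
  set v : ℝ≥0∞ := volume (Metric.ball (0 : Space N) 1) with hv
  have hvt : v ≠ ∞ := measure_ball_lt_top.ne
  set E : ℝ≥0∞ := ENNReal.ofReal (2 ^ (N + 1)) with hE
  have hmd : Measurable fun x : Space N => ENNReal.ofReal (decay x) :=
    continuous_decay.measurable.ennreal_ofReal
  obtain ⟨χ, hχ1, hχ0, hχm⟩ : ∃ χ : Space N → Space N → ℝ≥0∞,
      (∀ b x, x ∈ Metric.ball b 1 → χ b x = 1) ∧ (∀ b x, x ∉ Metric.ball b 1 → χ b x = 0) ∧
      Measurable (Function.uncurry χ) := by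
    classical
    refine ⟨fun b x => if dist x b < 1 then 1 else 0, fun b x h => if_pos h, fun b x h => if_neg h, ?_⟩
    exact Measurable.ite (measurableSet_lt (by fun_prop) measurable_const) measurable_const measurable_const
  have h2 : ∀ x : Space N, v * ENNReal.ofReal (decay x) ≤ E * ∫⁻ b, ENNReal.ofReal (decay b) * χ b x := by
    intro x
    have e1 : ∀ b, ENNReal.ofReal (decay b) * χ b x =
        (Metric.ball x 1).indicator (fun b => ENNReal.ofReal (decay b)) b := by
      intro b
      by_cases hb : b ∈ Metric.ball x 1
      · rw [indicator_of_mem hb, hχ1 _ _ (Metric.mem_ball_comm.1 hb), mul_one]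
      · rw [indicator_of_notMem hb, hχ0 _ _ (fun h => hb (Metric.mem_ball_comm.1 h)), mul_zero]
    simp_rw [e1]
    rw [lintegral_indicator measurableSet_ball, ← lintegral_const_mul' _ _ ENNReal.ofReal_ne_top]
    calc _ = ∫⁻ _b in Metric.ball x 1, ENNReal.ofReal (decay x) := by
          rw [setLIntegral_const, Measure.addHaar_ball_center, mul_comm]
      _ ≤ _ := by
          refine setLIntegral_mono' measurableSet_ball fun b hb => ?_
          rw [← ENNReal.ofReal_mul (by positivity)]
          refine ENNReal.ofReal_le_ofReal (decay_le_of_norm_le ?_)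
          have h3 : ‖b - x‖ < 1 := by rw [← dist_eq_norm]; exact hb
          have h4 := norm_le_norm_add_norm_sub' b x
          linarith [norm_nonneg x]
  have hind : Measurable fun p : Space N × Space N => ENNReal.ofReal (decay p.1) * χ p.1 p.2 :=
    (hmd.comp measurable_fst).mul hχm
  have hindx : ∀ x, Measurable fun b => ENNReal.ofReal (decay b) * χ b x :=
    fun x => hmd.mul hχm.of_uncurry_right
  calc v * ∫⁻ x, ENNReal.ofReal (decay x) * F x
      = ∫⁻ x, v * ENNReal.ofReal (decay x) * F x := by
        rw [← lintegral_const_mul' _ _ hvt]; simp_rw [mul_assoc]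
    _ ≤ ∫⁻ x, E * ∫⁻ b, ENNReal.ofReal (decay b) * χ b x * F x := by
        refine lintegral_mono fun x => ?_
        rw [lintegral_mul_const _ (hindx x), ← mul_assoc]
        exact mul_le_mul' (h2 x) le_rfl
    _ = E * ∫⁻ b, ∫⁻ x, ENNReal.ofReal (decay b) * χ b x * F x := by
        rw [lintegral_const_mul' _ _ ENNReal.ofReal_ne_top,
          lintegral_lintegral_swap (f := fun b x => ENNReal.ofReal (decay b) * χ b x * F x)
            (hind.mul (hF.comp measurable_snd)).aemeasurable]
    _ = E * ∫⁻ b, ENNReal.ofReal (decay b) * ∫⁻ x in Metric.ball b 1, F x := by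
        congr 1
        refine lintegral_congr fun b => ?_
        simp_rw [mul_assoc]
        rw [lintegral_const_mul' _ _ ENNReal.ofReal_ne_top, ← lintegral_indicator measurableSet_ball]
        congr 1
        refine lintegral_congr fun x => ?_
        by_cases hx : x ∈ Metric.ball b 1
        · rw [indicator_of_mem hx, hχ1 _ _ hx, one_mul]
        · rw [indicator_of_notMem hx, hχ0 _ _ hx, zero_mul]

/-- Weighted square function bound for bounded data. -/
theorem exists_weighted_square_bound (i j k : Fin N) {T : ℝ} (hT : 0 < T) :
    ∃ C : ℝ≥0∞, C ≠ ∞ ∧ ∀ (h : Space N → ℂ) (B : ℝ), Measurable h → (∀ y, ‖h y‖ ≤ B) →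
      ∫⁻ t in Ioo 0 T, ∫⁻ x, ENNReal.ofReal (decay x) * ‖oseenConv i j k t h x‖ₑ ^ 2 ≤
        C * ∫⁻ y, ENNReal.ofReal (decay y) * ‖h y‖ₑ ^ 2 := by
  obtain ⟨C, hC, hloc⟩ := exists_local_square_bound i j k hT
  set v : ℝ≥0∞ := volume (Metric.ball (0 : Space N) 1) with hv
  have hv0 : v ≠ 0 := (Metric.measure_ball_pos volume _ one_pos).ne'
  have hvt : v ≠ ∞ := measure_ball_lt_top.ne
  set E : ℝ≥0∞ := ENNReal.ofReal (2 ^ (N + 1)) with hE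
  set D : ℝ≥0∞ := ENNReal.ofReal (2 ^ (N + 2) * ∫ x : Space N, decay x) with hD
  refine ⟨v⁻¹ * (E * (C * D)), by finiteness, fun h B hm hB => ?_⟩
  have hmd : Measurable fun x : Space N => ENNReal.ofReal (decay x) :=
    continuous_decay.measurable.ennreal_ofReal
  set F : Space N → ℝ≥0∞ := fun x => ∫⁻ t in Ioo 0 T, ‖oseenConv i j k t h x‖ₑ ^ 2 with hF
  have hjm : Measurable fun p : ℝ × Space N => ‖oseenConv i j k p.1 h p.2‖ₑ ^ 2 :=
    (measurable_oseenConv i j k hm).enorm.pow_const 2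
  have hFm : Measurable F := hjm.lintegral_prod_left'
  have hswap : ∀ s : Set (Space N), ∫⁻ t in Ioo 0 T, ∫⁻ x in s, ‖oseenConv i j k t h x‖ₑ ^ 2 =
      ∫⁻ x in s, F x := fun s => lintegral_lintegral_swap hjm.aemeasurable
  have h1 : ∫⁻ t in Ioo 0 T, ∫⁻ x, ENNReal.ofReal (decay x) * ‖oseenConv i j k t h x‖ₑ ^ 2 =
      ∫⁻ x, ENNReal.ofReal (decay x) * F x := by
    rw [lintegral_lintegral_swap ((hmd.comp measurable_snd).mul hjm).aemeasurable]
    refine lintegral_congr fun x => ?_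
    rw [lintegral_const_mul' _ _ ENNReal.ofReal_ne_top]
  -- Averaging the local bounds in b against the decay function convolves this function with itself,
  -- which reproduces it up to a constant.
  have h3 : ∀ y : Space N, ∫⁻ b, ENNReal.ofReal (decay b) * ENNReal.ofReal (decay (b - y)) ≤
      D * ENNReal.ofReal (decay y) := by
    intro y
    obtain ⟨hi, hle⟩ := integral_decay_mul_decay_sub_le y
    simp_rw [← ENNReal.ofReal_mul (decay_pos _).le]
    rw [← ofReal_integral_eq_lintegral_ofReal hi
      (ae_of_all _ fun x => mul_nonneg (decay_pos _).le (decay_pos _).le),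
      hD, ← ENNReal.ofReal_mul (by have := integral_decay_pos (N := N); positivity)]
    exact ENNReal.ofReal_le_ofReal hle
  have key : v * ∫⁻ x, ENNReal.ofReal (decay x) * F x ≤
      E * (C * D) * ∫⁻ y, ENNReal.ofReal (decay y) * ‖h y‖ₑ ^ 2 := by
    calc v * ∫⁻ x, ENNReal.ofReal (decay x) * F x
        ≤ E * ∫⁻ b, ENNReal.ofReal (decay b) * ∫⁻ x in Metric.ball b 1, F x :=
          lintegral_decay_mul_le_average hFm
      _ ≤ E * ∫⁻ b, ENNReal.ofReal (decay b) *
            (C * ∫⁻ y, ENNReal.ofReal (decay (b - y)) * ‖h y‖ₑ ^ 2) := by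
          gcongr with b
          rw [← hswap]
          exact hloc h B hm hB b
      _ = E * (C * ∫⁻ y, (∫⁻ b, ENNReal.ofReal (decay b) * ENNReal.ofReal (decay (b - y))) * ‖h y‖ₑ ^ 2) := by
          congr 1
          have hmm : Measurable fun p : Space N × Space N =>
              ENNReal.ofReal (decay p.1) * ENNReal.ofReal (decay (p.1 - p.2)) :=
            (hmd.comp measurable_fst).mul (hmd.comp (by fun_prop))
          simp_rw [mul_left_comm _ C]
          rw [lintegral_const_mul' _ _ hC]
          congr 1
          calc _ = ∫⁻ b, ∫⁻ y, ENNReal.ofReal (decay b) * ENNReal.ofReal (decay (b - y)) * ‖h y‖ₑ ^ 2 := by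
                refine lintegral_congr fun b => ?_
                rw [← lintegral_const_mul' _ _ ENNReal.ofReal_ne_top]
                simp_rw [mul_assoc]
            _ = _ := by
                rw [lintegral_lintegral_swap (f := fun b y =>
                  ENNReal.ofReal (decay b) * ENNReal.ofReal (decay (b - y)) * ‖h y‖ₑ ^ 2)
                  (hmm.mul ((hm.comp measurable_snd).enorm.pow_const 2)).aemeasurable]
                refine lintegral_congr fun y => ?_
                rw [lintegral_mul_const' _ _ (by simp)]
      _ ≤ E * (C * ∫⁻ y, D * ENNReal.ofReal (decay y) * ‖h y‖ₑ ^ 2) := by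
          gcongr with y
          exact h3 y
      _ = _ := by
          simp_rw [mul_assoc D]
          rw [lintegral_const_mul' _ _ ENNReal.ofReal_ne_top]
          ring
  rw [h1]
  calc _ = v⁻¹ * (v * ∫⁻ x, ENNReal.ofReal (decay x) * F x) := by
        rw [← mul_assoc, ENNReal.inv_mul_cancel hv0 hvt, one_mul]
    _ ≤ v⁻¹ * (E * (C * D) * ∫⁻ y, ENNReal.ofReal (decay y) * ‖h y‖ₑ ^ 2) := by gcongr
    _ = _ := by ring

end LogBesovNS

end

noncomputable section

namespace LogBesovNS

open Filter Topology

variable {N : ℕ}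

/-! ### Uniqueness by a weighted energy -/

/-- A decreasing time weight whose decay absorbs the singularity at `t = 0`. -/
def expWeight (lam T t : ℝ) : ℝ := Real.exp (-(lam * (logFactor T t)⁻¹))

theorem expWeight_pos (lam T t : ℝ) : 0 < expWeight lam T t := Real.exp_pos _

theorem measurable_expWeight (lam T : ℝ) : Measurable (expWeight lam T) := by
  unfold expWeight logFactor
  fun_prop

/-- With g = 1/L and g' = w⁻² the integrand is g'e^{λg}, the derivative of λ⁻¹e^{λg}. The factor λ⁻¹
is the source of the contraction; the boundary term at 0 has a favourable sign and is dropped. -/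
theorem lintegral_inv_weight_sq_mul_inv_expWeight {lam T b : ℝ} (hlam : 0 < lam) (hb : 0 < b)
    (hbT : b ≤ T) :
    ∫⁻ x in Ioo 0 b, ENNReal.ofReal ((weight T x ^ 2)⁻¹ * (expWeight lam T x)⁻¹) ≤
      ENNReal.ofReal (lam⁻¹ * (expWeight lam T b)⁻¹) := by
  set g : ℝ → ℝ := Function.update (fun x => (logFactor T x)⁻¹) 0 0 with hg
  have hne : ∀ x : ℝ, 0 < x → g =ᶠ[𝓝 x] fun x => (logFactor T x)⁻¹ := by
    intro x hx
    filter_upwards [lt_mem_nhds hx] with y hy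
    simp [hg, Function.update_of_ne hy.ne']
  have hcont : ContinuousOn g (Icc 0 b) := by
    intro x hx
    rcases hx.1.eq_or_lt with rfl | hx0
    · rw [hg, continuousWithinAt_update_same]
      refine (tendsto_inv_logFactor T).mono_left (nhdsWithin_mono _ ?_)
      exact fun y hy => lt_of_le_of_ne hy.1.1 (Ne.symm hy.2)
    · exact (((hasDerivAt_inv_logFactor hx0 (hx.2.trans hbT)).continuousAt).congr
        (hne x hx0).symm).continuousWithinAt
  have := lintegral_deriv_of_nonneg (g := fun x => lam⁻¹ * Real.exp (lam * g x))
    (g' := fun x => (weight T x ^ 2)⁻¹ * (expWeight lam T x)⁻¹) hb.le (by fun_prop) ?_ ?_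
  · rw [this]
    refine ENNReal.ofReal_le_ofReal ?_
    simp only [hg, Function.update_of_ne hb.ne', expWeight, Real.exp_neg, inv_inv]
    have : 0 < lam⁻¹ * Real.exp (lam * Function.update (fun x => (logFactor T x)⁻¹) 0 0 0) := by
      positivity
    linarith
  · intro x hx
    have h1 := (hasDerivAt_inv_logFactor hx.1 (hx.2.le.trans hbT)).congr_of_eventuallyEq (hne x hx.1)
    have h2 := ((h1.const_mul lam).exp).const_mul lam⁻¹
    convert! h2 using 1
    rw [(hne x hx.1).eq_of_nhds, expWeight, Real.exp_neg, inv_inv]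
    field_simp
  · intro x _
    have := expWeight_pos lam T x
    positivity

/-- The weighted energy of a field. -/
def energy {E : Type*} [NormedAddCommGroup E] (lam T : ℝ) (δ : ℝ → Space N → E) : ℝ≥0∞ :=
  ∫⁻ p, ENNReal.ofReal (expWeight lam T p.1) * (ENNReal.ofReal (decay p.2) * ‖δ p.1 p.2‖ₑ ^ 2) ∂slab N T

section

variable {E : Type*} [NormedAddCommGroup E] [MeasurableSpace E] [OpensMeasurableSpace E]

theorem measurable_energy_integrand (lam T : ℝ) {δ : ℝ → Space N → E}
    (hδ : Measurable (Function.uncurry δ)) :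
    Measurable fun p : ℝ × Space N =>
      ENNReal.ofReal (expWeight lam T p.1) * (ENNReal.ofReal (decay p.2) * ‖δ p.1 p.2‖ₑ ^ 2) :=
  ((measurable_expWeight lam T).comp measurable_fst).ennreal_ofReal.mul
    ((continuous_decay.measurable.comp measurable_snd).ennreal_ofReal.mul (hδ.enorm.pow_const 2))

theorem energy_eq (lam T : ℝ) {δ : ℝ → Space N → E} (hδ : Measurable (Function.uncurry δ)) :
    energy lam T δ = ∫⁻ t in Ioo 0 T, ENNReal.ofReal (expWeight lam T t) *
      ∫⁻ x, ENNReal.ofReal (decay x) * ‖δ t x‖ₑ ^ 2 := by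
  rw [energy, lintegral_slab T (measurable_energy_integrand lam T hδ)]
  exact lintegral_congr fun t => lintegral_const_mul' (ENNReal.ofReal (expWeight lam T t))
    (fun x => ENNReal.ofReal (decay x) * ‖δ t x‖ₑ ^ 2) ENNReal.ofReal_ne_top

end

theorem measurable_oseenConv_sub (i j k : Fin N) {F : ℝ → Space N → ℂ}
    (hF : Measurable (Function.uncurry F)) :
    Measurable fun q : (ℝ × Space N) × ℝ => oseenConv i j k (q.1.1 - q.2) (F q.2) q.1.2 := by
  have h1 : Measurable fun r : ((ℝ × Space N) × ℝ) × Space N =>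
      kern i j k (r.1.1.1 - r.1.2) (r.1.1.2 - r.2) * F r.1.2 r.2 :=
    ((measurable_kern i j k).comp (by fun_prop : Measurable fun r : ((ℝ × Space N) × ℝ) × Space N =>
      (r.1.1.1 - r.1.2, r.1.1.2 - r.2))).mul
      (hF.comp (by fun_prop : Measurable fun r : ((ℝ × Space N) × ℝ) × Space N => (r.1.2, r.2)))
  exact (h1.stronglyMeasurable.integral_prod_right' (ν := (volume : Measure (Space N)))).measurable

/-- Cauchy-Schwarz in τ against w⁻²e^{λ/L}, whose integral over (0,t) is at most λ⁻¹e^{λ/L(t)}; the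
exponential cancels against the energy weight at time t. -/
theorem enorm_duhamel_sq_le (i j k : Fin N) {lam T M : ℝ} (hlam : 0 < lam) {F : ℝ → Space N → ℂ}
    (hF : IsSource T M F) {t : ℝ} (ht : t ∈ Ioo 0 T) (x : Space N) :
    ENNReal.ofReal (expWeight lam T t) * ‖duhamel i j k 0 F t x‖ₑ ^ 2 ≤
      ENNReal.ofReal lam⁻¹ * ∫⁻ τ in Ioo 0 T, ENNReal.ofReal (weight T τ ^ 2 * expWeight lam T τ) *
        ‖oseenConv i j k (t - τ) (F τ) x‖ₑ ^ 2 := by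
  have hc : Measurable fun τ => ‖oseenConv i j k (t - τ) (F τ) x‖ₑ :=
    ((measurable_oseenConv_sub i j k hF.meas).comp (measurable_prodMk_left (x := (t, x)))).enorm
  have hmw := measurable_weight T
  have hme := measurable_expWeight lam T
  have h1 : ‖duhamel i j k 0 F t x‖ₑ ≤ ∫⁻ τ in Ioo 0 t, ‖oseenConv i j k (t - τ) (F τ) x‖ₑ := by
    have hi := integrable_duhamel i j k hF (s := 0) ⟨le_rfl, (ht.1.trans ht.2).le⟩ ⟨ht.1, ht.2.le⟩ x
    rw [duhamel, slab, integral_prod _ hi]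
    refine (enorm_integral_le_lintegral_enorm _).trans_eq ?_
    simp only [zero_add, oseenConv]
  have h2 := sq_lintegral_mul_le (μ := volume.restrict (Ioo 0 t))
    (w := fun τ => ENNReal.ofReal ((weight T τ ^ 2)⁻¹ * (expWeight lam T τ)⁻¹))
    (f := fun τ => ENNReal.ofReal (weight T τ ^ 2 * expWeight lam T τ) * ‖oseenConv i j k (t - τ) (F τ) x‖ₑ)
    (by fun_prop) (by fun_prop)
  have hpos : ∀ τ ∈ Ioo 0 t, 0 < weight T τ ^ 2 * expWeight lam T τ := fun τ hτ => by
    have := weight_pos hτ.1 (hτ.2.trans ht.2).le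
    have := expWeight_pos lam T τ
    positivity
  have hone : ∀ τ ∈ Ioo 0 t, ENNReal.ofReal ((weight T τ ^ 2)⁻¹ * (expWeight lam T τ)⁻¹) *
      ENNReal.ofReal (weight T τ ^ 2 * expWeight lam T τ) = 1 := fun τ hτ => by
    rw [← mul_inv, ← ENNReal.ofReal_mul (inv_nonneg.2 (hpos τ hτ).le), inv_mul_cancel₀ (hpos τ hτ).ne',
      ENNReal.ofReal_one]
  have e1 : ∫⁻ τ in Ioo 0 t, ENNReal.ofReal ((weight T τ ^ 2)⁻¹ * (expWeight lam T τ)⁻¹) *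
      (ENNReal.ofReal (weight T τ ^ 2 * expWeight lam T τ) * ‖oseenConv i j k (t - τ) (F τ) x‖ₑ) =
      ∫⁻ τ in Ioo 0 t, ‖oseenConv i j k (t - τ) (F τ) x‖ₑ :=
    setLIntegral_congr_fun measurableSet_Ioo fun τ hτ => by
      rw [← mul_assoc, hone τ hτ, one_mul]
  have e2 : ∫⁻ τ in Ioo 0 t, ENNReal.ofReal ((weight T τ ^ 2)⁻¹ * (expWeight lam T τ)⁻¹) *
      (ENNReal.ofReal (weight T τ ^ 2 * expWeight lam T τ) * ‖oseenConv i j k (t - τ) (F τ) x‖ₑ) ^ 2 =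
      ∫⁻ τ in Ioo 0 t, ENNReal.ofReal (weight T τ ^ 2 * expWeight lam T τ) *
        ‖oseenConv i j k (t - τ) (F τ) x‖ₑ ^ 2 :=
    setLIntegral_congr_fun measurableSet_Ioo fun τ hτ => by
      rw [mul_pow, sq (ENNReal.ofReal _), ← mul_assoc, ← mul_assoc, hone τ hτ, one_mul]
  rw [e1, e2] at h2
  have hw := expWeight_pos lam T t
  calc _ ≤ ENNReal.ofReal (expWeight lam T t) * (ENNReal.ofReal (lam⁻¹ * (expWeight lam T t)⁻¹) *
        ∫⁻ τ in Ioo 0 T, ENNReal.ofReal (weight T τ ^ 2 * expWeight lam T τ) *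
        ‖oseenConv i j k (t - τ) (F τ) x‖ₑ ^ 2) := by
        gcongr ENNReal.ofReal (expWeight lam T t) * ?_
        refine (pow_le_pow_left₀ bot_le h1 2).trans (h2.trans (mul_le_mul' ?_ ?_))
        · exact lintegral_inv_weight_sq_mul_inv_expWeight hlam ht.1 ht.2.le
        · exact lintegral_mono_set (Ioo_subset_Ioo_right ht.2.le)
    _ = _ := by
        rw [← mul_assoc, ← ENNReal.ofReal_mul hw.le]
        congr 2
        field_simp

/-- The Duhamel operator contracts the weighted energy when `lam` is large. -/
theorem exists_energy_duhamel_le (i j k : Fin N) {T : ℝ} (hT : 0 < T) :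
    ∃ C : ℝ≥0∞, C ≠ ∞ ∧ ∀ {E : Type} [NormedAddCommGroup E] [MeasurableSpace E]
      [OpensMeasurableSpace E] {lam M M' : ℝ}
      {F : ℝ → Space N → ℂ} {δ : ℝ → Space N → E}, 0 < lam → IsSource T M' F → 0 ≤ M →
      Measurable (Function.uncurry δ) →
      (∀ τ ∈ Ioo 0 T, ∀ y, ‖F τ y‖ ≤ M * (weight T τ)⁻¹ * ‖δ τ y‖) →
      energy lam T (duhamel i j k 0 F) ≤ ENNReal.ofReal (lam⁻¹ * M ^ 2) * C * energy lam T δ := by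
  obtain ⟨C, hC, hsq⟩ := exists_weighted_square_bound i j k hT
  refine ⟨C, hC, ?_⟩
  intro E _ _ _ lam M M' F δ hlam hF hM hδ hFδ
  have hmw := measurable_weight T
  have hme := measurable_expWeight lam T
  have hmd : Measurable fun x : Space N => ENNReal.ofReal (decay x) :=
    continuous_decay.measurable.ennreal_ofReal
  have hoc := measurable_oseenConv_sub i j k hF.meas
  set I : (ℝ × Space N) → ℝ → ℝ≥0∞ := fun q τ => ENNReal.ofReal (decay q.2) *
    (ENNReal.ofReal (weight T τ ^ 2 * expWeight lam T τ) *
      ‖oseenConv i j k (q.1 - τ) (F τ) q.2‖ₑ ^ 2) with hI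
  have hIm : Measurable (Function.uncurry I) :=
    ((hmd.comp measurable_snd).comp measurable_fst).mul
      (((by fun_prop : Measurable fun τ => ENNReal.ofReal (weight T τ ^ 2 * expWeight lam T τ)).comp
        measurable_snd).mul (hoc.enorm.pow_const 2))
  -- For fixed τ the source is frozen and t is shifted by τ. The kernel vanishes at nonpositive
  -- times, so the square function bound on (0,T) applies.
  have hshift : ∀ τ ∈ Ioo 0 T, ∫⁻ q, ENNReal.ofReal (decay q.2) *
      ‖oseenConv i j k (q.1 - τ) (F τ) q.2‖ₑ ^ 2 ∂slab N T ≤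
      C * ∫⁻ y, ENNReal.ofReal (decay y) * ‖F τ y‖ₑ ^ 2 := by
    intro τ hτ
    have hFm : Measurable (F τ) := hF.meas.of_uncurry_left
    set G : ℝ → ℝ≥0∞ := fun t => ∫⁻ x, ENNReal.ofReal (decay x) * ‖oseenConv i j k t (F τ) x‖ₑ ^ 2 with hG
    have hG0 : ∀ t ≤ 0, G t = 0 := by
      intro t ht
      simp [hG, oseenConv, kern, not_lt.2 ht]
    have h1 : Measurable fun q : ℝ × Space N => ENNReal.ofReal (decay q.2) *
        ‖oseenConv i j k (q.1 - τ) (F τ) q.2‖ₑ ^ 2 :=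
      (hmd.comp measurable_snd).mul ((hoc.comp (measurable_prodMk_right (y := τ))).enorm.pow_const 2)
    rw [lintegral_slab T h1]
    calc ∫⁻ t in Ioo 0 T, G (t - τ) = ∫⁻ t, (Ioo 0 T).indicator (fun t => G (t - τ)) t :=
          (lintegral_indicator measurableSet_Ioo _).symm
      _ ≤ ∫⁻ t, (Ioo 0 T).indicator G (t - τ) := by
          refine lintegral_mono fun t => ?_
          refine indicator_apply_le' (fun ht => ?_) (fun _ => bot_le)
          rcases le_or_gt (t - τ) 0 with h | h
          · simp [hG0 _ h]
          · have hm : t - τ ∈ Ioo 0 T := ⟨h, by linarith [ht.2, hτ.1]⟩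
            rw [indicator_of_mem hm]
      _ = ∫⁻ t in Ioo 0 T, G t := by
          rw [lintegral_sub_right_eq_self (fun t => (Ioo 0 T).indicator G t) τ,
            lintegral_indicator measurableSet_Ioo]
      _ ≤ _ := hsq (F τ) _ hFm (hF.bound τ hτ)
  -- The factor w² left by Cauchy-Schwarz cancels exactly the square of the bound M/w on the field
  -- multiplying δ.
  have hpt : ∀ τ ∈ Ioo 0 T, ENNReal.ofReal (weight T τ ^ 2 * expWeight lam T τ) *
      (C * ∫⁻ y, ENNReal.ofReal (decay y) * ‖F τ y‖ₑ ^ 2) ≤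
      ENNReal.ofReal (M ^ 2) * C * (ENNReal.ofReal (expWeight lam T τ) *
        ∫⁻ y, ENNReal.ofReal (decay y) * ‖δ τ y‖ₑ ^ 2) := by
    intro τ hτ
    have hw := weight_pos hτ.1 hτ.2.le
    have he := expWeight_pos lam T τ
    have hb : ∀ y, ‖F τ y‖ₑ ^ 2 ≤ ENNReal.ofReal ((M * (weight T τ)⁻¹) ^ 2) * ‖δ τ y‖ₑ ^ 2 := by
      intro y
      rw [ENNReal.ofReal_pow (by positivity), ← mul_pow]
      gcongr
      rw [← ofReal_norm, ← ofReal_norm, ← ENNReal.ofReal_mul (by positivity)]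
      exact ENNReal.ofReal_le_ofReal (hFδ τ hτ y)
    calc _ ≤ ENNReal.ofReal (weight T τ ^ 2 * expWeight lam T τ) * (C *
          ∫⁻ y, ENNReal.ofReal ((M * (weight T τ)⁻¹) ^ 2) * (ENNReal.ofReal (decay y) * ‖δ τ y‖ₑ ^ 2)) := by
          gcongr ENNReal.ofReal (weight T τ ^ 2 * expWeight lam T τ) * (C * ?_)
          refine lintegral_mono fun y => ?_
          refine (mul_le_mul_right (hb y) _).trans_eq ?_
          ring
      _ = ENNReal.ofReal (weight T τ ^ 2 * expWeight lam T τ) * ENNReal.ofReal ((M * (weight T τ)⁻¹) ^ 2) *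
          (C * ∫⁻ y, ENNReal.ofReal (decay y) * ‖δ τ y‖ₑ ^ 2) := by
          rw [lintegral_const_mul' _ _ ENNReal.ofReal_ne_top]; ring
      _ = ENNReal.ofReal (M ^ 2) * ENNReal.ofReal (expWeight lam T τ) *
          (C * ∫⁻ y, ENNReal.ofReal (decay y) * ‖δ τ y‖ₑ ^ 2) := by
          rw [← ENNReal.ofReal_mul (by positivity), ← ENNReal.ofReal_mul (by positivity)]
          congr 2
          field_simp
      _ = _ := by ring
  calc energy lam T (duhamel i j k 0 F)
      ≤ ∫⁻ q, ENNReal.ofReal lam⁻¹ * (∫⁻ τ in Ioo 0 T, I q τ) ∂slab N T := by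
        refine lintegral_mono_ae ?_
        filter_upwards [ae_slab T] with q hq
        simp only [hI]
        rw [lintegral_const_mul' _ _ ENNReal.ofReal_ne_top, mul_left_comm, mul_left_comm (ENNReal.ofReal lam⁻¹)]
        exact mul_le_mul_right (enorm_duhamel_sq_le i j k hlam hF hq q.2) _
    _ = ENNReal.ofReal lam⁻¹ * ∫⁻ τ in Ioo 0 T, ∫⁻ q, I q τ ∂slab N T := by
        rw [lintegral_const_mul' _ _ ENNReal.ofReal_ne_top, lintegral_lintegral_swap hIm.aemeasurable]
    _ ≤ ENNReal.ofReal lam⁻¹ * ∫⁻ τ in Ioo 0 T, ENNReal.ofReal (M ^ 2) * C *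
          (ENNReal.ofReal (expWeight lam T τ) * ∫⁻ y, ENNReal.ofReal (decay y) * ‖δ τ y‖ₑ ^ 2) := by
        gcongr ENNReal.ofReal lam⁻¹ * ?_
        refine setLIntegral_mono' measurableSet_Ioo fun τ hτ => ?_
        refine le_trans (le_of_eq ?_) (hpt τ hτ |>.trans' (mul_le_mul_right (hshift τ hτ) _))
        rw [← lintegral_const_mul' _ _ ENNReal.ofReal_ne_top]
        refine lintegral_congr fun q => ?_
        simp only [hI]; ring
    _ = _ := by
        rw [lintegral_const_mul' _ _ (by finiteness), ← energy_eq lam T hδ,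
          ENNReal.ofReal_mul (by positivity)]
        ring

theorem ennreal_sum_sq_le {ι : Type*} (s : Finset ι) (f : ι → ℝ≥0∞) :
    (∑ i ∈ s, f i) ^ 2 ≤ s.card * ∑ i ∈ s, f i ^ 2 := by
  have h := ENNReal.rpow_sum_le_const_mul_sum_rpow s f (p := 2) (by norm_num)
  norm_num at h
  exact h

/-- The square of a field is O(w⁻²), integrable in time. Finiteness is what allows the energy to be
absorbed into itself. -/
theorem energy_ne_top {E : Type*} [NormedAddCommGroup E] {lam T M : ℝ} (hT : 0 < T) (hlam : 0 ≤ lam)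
    {δ : ℝ → Space N → E} (hδ : ∀ τ ∈ Ioo 0 T, ∀ y, ‖δ τ y‖ ≤ M * (weight T τ)⁻¹) :
    energy lam T δ ≠ ∞ := by
  have hi := (integrable_decay_mul_inv_weight_sq (N := N) hT).const_mul (M ^ 2)
  refine ((lintegral_mono_ae ?_).trans_lt hi.lintegral_lt_top).ne
  filter_upwards [ae_slab T] with p hp
  have hw := weight_pos hp.1 hp.2.le
  have hl := logFactor_pos hp.1 hp.2.le
  have hd := decay_pos p.2
  have he : expWeight lam T p.1 ≤ 1 := by
    rw [expWeight, Real.exp_le_one_iff, neg_nonpos]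
    positivity
  rw [← ofReal_norm, ← ENNReal.ofReal_pow (norm_nonneg _), ← ENNReal.ofReal_mul hd.le,
    ← ENNReal.ofReal_mul (expWeight_pos _ _ _).le]
  refine ENNReal.ofReal_le_ofReal ?_
  calc _ ≤ 1 * (decay p.2 * (M * (weight T p.1)⁻¹) ^ 2) := by
        gcongr
        exact hδ _ hp _
    _ = _ := by rw [mul_pow, inv_pow]; ring

/-- The terms into which `B(U,U) - B(V,V)` is expanded. -/
def diffSource (U V : ℝ → Space N → Vec N) (q : Bool × Fin N × Fin N × Fin N) (τ : ℝ)
    (y : Space N) : ℂ :=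
  if q.1 then U τ y q.2.2.2 * (U - V) τ y q.2.2.1 else (U - V) τ y q.2.2.2 * V τ y q.2.2.1

theorem isSource_diffSource {T M : ℝ} {U V : ℝ → Space N → Vec N} (hU : IsField T M U)
    (hV : IsField T M V) (q : Bool × Fin N × Fin N × Fin N) :
    IsSource T (M * (M + M)) (diffSource U V q) := by
  obtain ⟨b, i, j, k⟩ := q
  cases b
  · have := (hU.sub hV).isSource hV j k
    rw [mul_comm] at this
    exact this
  · exact hU.isSource (hU.sub hV) j k

theorem norm_diffSource_le {T M : ℝ} {U V : ℝ → Space N → Vec N} (hU : IsField T M U)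
    (hV : IsField T M V) (q : Bool × Fin N × Fin N × Fin N) {τ : ℝ} (hτ : τ ∈ Ioo 0 T) (y : Space N) :
    ‖diffSource U V q τ y‖ ≤ M * (weight T τ)⁻¹ * ‖(U - V) τ y‖ := by
  have hM := hU.nonneg
  have hw := weight_pos hτ.1 hτ.2.le
  obtain ⟨b, i, j, k⟩ := q
  cases b
  · change ‖(U - V) τ y k * V τ y j‖ ≤ _
    rw [norm_mul, mul_comm]
    gcongr
    · exact (PiLp.norm_apply_le _ _).trans (hV.bound τ hτ y)
    · exact PiLp.norm_apply_le _ _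
  · change ‖U τ y k * (U - V) τ y j‖ ≤ _
    rw [norm_mul]
    gcongr
    · exact (PiLp.norm_apply_le _ _).trans (hU.bound τ hτ y)
    · exact PiLp.norm_apply_le _ _

theorem enorm_nlin_sub_nlin_le {T M : ℝ} {U V : ℝ → Space N → Vec N} (hU : IsField T M U)
    (hV : IsField T M V) {t : ℝ} (ht : t ∈ Ioo 0 T) (x : Space N) :
    ‖nlin U U 0 t x - nlin V V 0 t x‖ₑ ≤
      ∑ q, ‖duhamel q.2.1 q.2.2.1 q.2.2.2 0 (diffSource U V q) t x‖ₑ := by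
  rw [nlin_sub_nlin hU hV ⟨le_rfl, (ht.1.trans ht.2).le⟩ ⟨ht.1, ht.2.le⟩ x]
  have hle : ∀ v : Vec N, ‖v‖ₑ ≤ ∑ i, ‖v i‖ₑ := by
    intro v
    simp_rw [← ofReal_norm]
    rw [← ENNReal.ofReal_sum_of_nonneg fun i _ => norm_nonneg _]
    exact ENNReal.ofReal_le_ofReal (norm_le_sum_coord v)
  have hsum : ∀ A B : ℝ → Space N → Vec N, ‖nlin A B 0 t x‖ₑ ≤
      ∑ i, ∑ j, ∑ k, ‖duhamel i j k 0 (fun τ y => A τ y k * B τ y j) t x‖ₑ := by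
    intro A B
    refine (hle _).trans (Finset.sum_le_sum fun i _ => ?_)
    rw [nlin_apply]
    exact (enorm_sum_le _ _).trans (Finset.sum_le_sum fun j _ => enorm_sum_le _ _)
  refine (enorm_add_le _ _).trans ((add_le_add (hsum _ _) (hsum _ _)).trans_eq ?_)
  simp only [Fintype.sum_prod_type, Fintype.sum_bool]
  rfl

/-- Two bounded solutions of the same integral equation coincide. -/
theorem ae_eq_of_nlin_eq {T M : ℝ} (hT : 0 < T) {U V : ℝ → Space N → Vec N} (hU : IsField T M U)
    (hV : IsField T M V)
    (h : ∀ t ∈ Ioo 0 T, ∀ᵐ x, U t x - V t x = -(nlin U U 0 t x - nlin V V 0 t x)) :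
    ∀ᵐ p ∂slab N T, U p.1 p.2 = V p.1 p.2 := by
  have hM := hU.nonneg
  have hδ := hU.sub hV
  choose C hC hCle using fun q : Bool × Fin N × Fin N × Fin N =>
    exists_energy_duhamel_le q.2.1 q.2.2.1 q.2.2.2 hT
  set n : ℝ≥0∞ := ((Finset.univ : Finset (Bool × Fin N × Fin N × Fin N)).card : ℝ≥0∞) with hn
  set K : ℝ≥0∞ := n * ∑ q, ENNReal.ofReal (M ^ 2) * C q with hK
  have hKt : K ≠ ∞ := ENNReal.mul_ne_top (ENNReal.natCast_ne_top _)
    (ENNReal.sum_ne_top.2 fun q _ => ENNReal.mul_ne_top ENNReal.ofReal_ne_top (hC q))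
  -- Any λ > K would do; K depends on the size M of the solutions, which need not be small.
  set lam : ℝ := 2 * K.toReal + 1 with hlam
  have hlam0 : 0 < lam := by positivity
  have hmd : ∀ q, Measurable (Function.uncurry (duhamel q.2.1 q.2.2.1 q.2.2.2 0 (diffSource U V q))) :=
    fun q => measurable_duhamel _ _ _ (isSource_diffSource hU hV q) 0
  have h1 : energy lam T (U - V) ≤ n * ∑ q, energy lam T
      (duhamel q.2.1 q.2.2.1 q.2.2.2 0 (diffSource U V q)) := by
    have hsq : ∀ t ∈ Ioo 0 T, ∀ᵐ x, ‖(U - V) t x‖ₑ ^ 2 ≤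
        n * ∑ q, ‖duhamel q.2.1 q.2.2.1 q.2.2.2 0 (diffSource U V q) t x‖ₑ ^ 2 := by
      intro t ht
      filter_upwards [h t ht] with x hx
      refine le_trans (pow_le_pow_left₀ bot_le ?_ 2) (ennreal_sum_sq_le _ _)
      rw [Pi.sub_apply, Pi.sub_apply, hx, enorm_neg]
      exact enorm_nlin_sub_nlin_le hU hV ht x
    have hme := measurable_expWeight lam T
    have hdm : Measurable fun x : Space N => ENNReal.ofReal (decay x) :=
      continuous_decay.measurable.ennreal_ofReal
    have hterm : ∀ q, Measurable fun p : ℝ × Space N => ENNReal.ofReal (expWeight lam T p.1) *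
        (ENNReal.ofReal (decay p.2) *
          ‖duhamel q.2.1 q.2.2.1 q.2.2.2 0 (diffSource U V q) p.1 p.2‖ₑ ^ 2) :=
      fun q => measurable_energy_integrand lam T (hmd q)
    calc energy lam T (U - V)
        ≤ ∫⁻ p, n * ∑ q, ENNReal.ofReal (expWeight lam T p.1) * (ENNReal.ofReal (decay p.2) *
          ‖duhamel q.2.1 q.2.2.1 q.2.2.2 0 (diffSource U V q) p.1 p.2‖ₑ ^ 2) ∂slab N T := by
          rw [energy, lintegral_slab T (measurable_energy_integrand lam T hδ.meas),
            lintegral_slab T ((Finset.measurable_fun_sum _ fun q _ => hterm q).const_mul n)]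
          refine setLIntegral_mono' measurableSet_Ioo fun t ht => ?_
          refine lintegral_mono_ae ?_
          filter_upwards [hsq t ht] with x hx
          refine (mul_le_mul_right (mul_le_mul_right hx _) _).trans_eq ?_
          simp only [← Finset.mul_sum]
          ring
      _ = _ := by
          rw [lintegral_const_mul' _ _ (ENNReal.natCast_ne_top _),
            lintegral_finsetSum _ fun q _ => hterm q]
          rfl
  have h2 : energy lam T (U - V) ≤ ENNReal.ofReal lam⁻¹ * K * energy lam T (U - V) := by
    refine h1.trans ?_
    calc _ ≤ n * ∑ q, ENNReal.ofReal lam⁻¹ * (ENNReal.ofReal (M ^ 2) * C q) * energy lam T (U - V) := by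
          gcongr with q
          refine (hCle q hlam0 (isSource_diffSource hU hV q) hM hδ.meas
            fun τ hτ y => norm_diffSource_le hU hV q hτ y).trans_eq ?_
          rw [ENNReal.ofReal_mul (by positivity)]
          ring
      _ = _ := by
          rw [hK, ← Finset.sum_mul, ← Finset.mul_sum]
          ring
  have hfin : energy lam T (U - V) ≠ ∞ := energy_ne_top hT hlam0.le hδ.bound
  have hzero : energy lam T (U - V) = 0 := by
    have h3 : ENNReal.ofReal lam⁻¹ * K = ENNReal.ofReal (lam⁻¹ * K.toReal) := by
      rw [ENNReal.ofReal_mul (by positivity), ENNReal.ofReal_toReal hKt]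
    have h4 : lam⁻¹ * K.toReal < 1 := by
      rw [inv_mul_lt_one₀ hlam0, hlam]
      have : 0 ≤ K.toReal := ENNReal.toReal_nonneg
      linarith
    rw [h3] at h2
    by_contra hne
    -- A finite nonzero energy cannot be bounded by a proper fraction of itself.
    refine absurd h2 (not_le.2 ?_)
    calc _ < 1 * energy lam T (U - V) :=
          ENNReal.mul_lt_mul_left hne hfin (by simpa using h4)
      _ = _ := one_mul _
  have := (lintegral_eq_zero_iff (measurable_energy_integrand lam T hδ.meas)).1 hzero
  filter_upwards [this] with p hp
  have e1 := (ENNReal.ofReal_pos.2 (expWeight_pos lam T p.1)).ne'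
  have e2 := (ENNReal.ofReal_pos.2 (decay_pos p.2)).ne'
  simpa [e1, e2, sub_eq_zero] using hp

/-- The bilinear term is an integral over the slab, so almost everywhere equality of the fields
gives equality of the terms at every time. -/
theorem nlin_congr {T t : ℝ} (ht : t ≤ T) {U V : ℝ → Space N → Vec N}
    (h : ∀ᵐ p ∂slab N T, U p.1 p.2 = V p.1 p.2) (s : ℝ) : nlin U U s t = nlin V V s t := by
  funext x
  ext i
  rw [nlin_apply, nlin_apply]
  refine Finset.sum_congr rfl fun j _ => Finset.sum_congr rfl fun k _ => integral_congr_ae ?_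
  have h' : ∀ᵐ p ∂slab N t, U p.1 p.2 = V p.1 p.2 := by
    rw [slab_eq_restrict ht]
    exact ae_restrict_of_ae h
  filter_upwards [h'] with p hp
  rw [hp]

end LogBesovNS

end

noncomputable section

namespace LogBesovNS

open Filter Topology

variable {N : ℕ}

/-! ### Uniqueness and Lipschitz dependence -/

theorem InClass.exists_field {T A : ℝ} (hA : 0 ≤ A) {u : ℝ → LogBesov N T} (hu : InClass T u)
    (hle : pathNorm T u ≤ ENNReal.ofReal A) :
    ∃ U : ℝ → Space N → Vec N, IsField T A U ∧
      ∀ t ∈ Ioo 0 T, IsRep (u t : VDist N) (U t) (A * (weight T t)⁻¹) := by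
  obtain ⟨U, hU, hrep, -⟩ := exists_field_of_path (p := fun t => (u t : VDist N)) hA
    (fun φ => (hu.weakStar.continuousOn_apply φ).mono Ioo_subset_Icc_self)
    (fun t ht => (le_iSup₂ (f := fun (s : ℝ) (_ : s ∈ Ioo (0 : ℝ) T) =>
      ENNReal.ofReal (weight T s) * linfNorm (u s : VDist N)) t ht).trans hle)
    (fun t ht => hu.real t (Ioo_subset_Icc_self ht))
  exact ⟨U, hU, hrep⟩

theorem IsRep.linfRep_ae_eq {f : VDist N} {g : Space N → Vec N} {c : ℝ} (hc : 0 ≤ c)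
    (h : IsRep f g c) : linfRep f =ᵐ[volume] g :=
  (isRep_linfRep hc h.linfNorm_le).ae_eq h

/-- No smallness is assumed. The energy argument gives equality of the fields almost everywhere on
the slab; feeding this back into the equation yields equality at every time of [0,T], both endpoints
included. -/
theorem IsMildSolution.eqOn {T : ℝ} (hT : 0 < T) {u₀ : LogBesov N T} {u v : ℝ → LogBesov N T}
    (hu : InClass T u) (hus : IsMildSolution T u₀ u) (hv : InClass T v)
    (hvs : IsMildSolution T u₀ v) : EqOn v u (Icc 0 T) := by
  set A : ℝ := max (pathNorm T u).toReal (pathNorm T v).toReal with hA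
  have hA0 : 0 ≤ A := le_max_of_le_left ENNReal.toReal_nonneg
  have hleu : pathNorm T u ≤ ENNReal.ofReal A :=
    (ENNReal.le_ofReal_iff_toReal_le hu.finite.ne hA0).2 (le_max_left _ _)
  have hlev : pathNorm T v ≤ ENNReal.ofReal A :=
    (ENNReal.le_ofReal_iff_toReal_le hv.finite.ne hA0).2 (le_max_right _ _)
  obtain ⟨U, hU, hUrep⟩ := hu.exists_field hA0 hleu
  obtain ⟨V, hV, hVrep⟩ := hv.exists_field hA0 hlev
  have hpos : ∀ t ∈ Ioo 0 T, 0 ≤ A * (weight T t)⁻¹ := fun t ht =>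
    mul_nonneg hA0 (inv_nonneg.2 (weight_pos ht.1 ht.2.le).le)
  have hueq := (isMildSolution_iff hU fun t ht => (hUrep t ht).linfRep_ae_eq (hpos t ht)).1 hus
  have hveq := (isMildSolution_iff hV fun t ht => (hVrep t ht).linfRep_ae_eq (hpos t ht)).1 hvs
  have hae := ae_eq_of_nlin_eq hT hV hU fun t ht => by
    have ht' : t ∈ Ioc 0 T := ⟨ht.1, ht.2.le⟩
    have h1 := (hVrep t ht).sub (hUrep t ht)
    have h2 := (isRep_nlinDist hU hU ht').sub (isRep_nlinDist hV hV ht')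
    have he : (v t : VDist N) - (u t : VDist N) = nlinDist U U t - nlinDist V V t := by
      rw [hueq t (Ioo_subset_Icc_self ht), hveq t (Ioo_subset_Icc_self ht)]
      exact sub_sub_sub_cancel_left _ _ _
    rw [he] at h1
    filter_upwards [h1.ae_eq h2] with x hx
    rw [neg_sub]
    exact hx
  intro t ht
  refine Subtype.ext ?_
  rw [hueq t ht, hveq t ht, nlinDist, nlinDist, nlin_congr ht.2 hae]

theorem pathNorm_congr {T : ℝ} {u v : ℝ → LogBesov N T} (h : EqOn u v (Icc 0 T)) :
    pathNorm T u = pathNorm T v :=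
  biSup_congr fun t ht => by rw [h (Ioo_subset_Icc_self ht)]

theorem linfNorm_sub_le (f g : VDist N) : linfNorm (f - g) ≤ linfNorm f + linfNorm g := by
  have h1 : f - g = f + (-1 : ℂ) • g := by
    rw [neg_one_smul ℂ g]; exact sub_eq_add_neg _ _
  have h2 := linfNorm_smul_le (-1) g
  rw [enorm_neg, enorm_one, one_mul] at h2
  rw [h1]
  exact (linfNorm_add_le _ _).trans (add_le_add le_rfl h2)

theorem pathNorm_sub_le (T : ℝ) (u v : ℝ → LogBesov N T) :
    pathNorm T (u - v) ≤ pathNorm T u + pathNorm T v := by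
  refine iSup₂_le fun (t : ℝ) (ht : t ∈ Ioo (0 : ℝ) T) => ?_
  have h := linfNorm_sub_le (u t : VDist N) (v t : VDist N)
  refine (mul_le_mul_right h _).trans ?_
  rw [mul_add]
  exact add_le_add
    (le_iSup₂ (f := fun (s : ℝ) (_ : s ∈ Ioo (0 : ℝ) T) =>
      ENNReal.ofReal (weight T s) * linfNorm (u s : VDist N)) t ht)
    (le_iSup₂ (f := fun (s : ℝ) (_ : s ∈ Ioo (0 : ℝ) T) =>
      ENNReal.ofReal (weight T s) * linfNorm (v s : VDist N)) t ht)

theorem linfNorm_heat_nlinDist_sub_le {T M D : ℝ} {U V : ℝ → Space N → Vec N} (hU : IsField T M U)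
    (hV : IsField T M V) (hd : IsField T D (U - V)) {s t : ℝ} (hs : s ∈ Icc 0 T) (ht : t ∈ Ioc 0 T) :
    linfNorm (heat s (nlinDist U U t - nlinDist V V t)) ≤
      ENNReal.ofReal (2 * nlinConst N * M * D * (weight T (max s t))⁻¹) := by
  rw [map_sub]
  have h := (isRep_heat_nlinDist hU hU hs ht).sub (isRep_heat_nlinDist hV hV hs ht)
  exact (IsRep.mk h.meas (ae_of_all _ (norm_nlin_sub_nlin_le hU hV hd hs ht)) h.eq).linfNorm_le

theorem weight_mul_linfNorm_nlinDist_sub_le {T M D : ℝ} {U V : ℝ → Space N → Vec N}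
    (hU : IsField T M U) (hV : IsField T M V) (hd : IsField T D (U - V)) {t : ℝ} (ht : t ∈ Ioo 0 T) :
    ENNReal.ofReal (weight T t) * linfNorm (nlinDist U U t - nlinDist V V t) ≤
      ENNReal.ofReal (2 * nlinConst N * M * D) := by
  refine weight_mul_linfNorm_le ht ?_
  have h := linfNorm_heat_nlinDist_sub_le hU hV hd (s := 0) ⟨le_rfl, (ht.1.trans ht.2).le⟩
    ⟨ht.1, ht.2.le⟩
  rwa [heat_zero, max_eq_right ht.1.le] at h

theorem logBesovNorm_nlinDist_sub_le {T M D : ℝ} {U V : ℝ → Space N → Vec N} (hU : IsField T M U)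
    (hV : IsField T M V) (hd : IsField T D (U - V)) {t : ℝ} (ht : t ∈ Icc 0 T) :
    logBesovNorm T (nlinDist U U t - nlinDist V V t) ≤ ENNReal.ofReal (2 * nlinConst N * M * D) := by
  refine iSup₂_le fun (s : ℝ) (hs : s ∈ Ioo (0 : ℝ) T) => ?_
  rcases ht.1.eq_or_lt with rfl | h0
  · rw [nlinDist_zero_time, nlinDist_zero_time, sub_self (0 : VDist N), map_zero, linfNorm_zero, mul_zero]
    exact bot_le
  refine weight_mul_linfNorm_le hs ((linfNorm_heat_nlinDist_sub_le hU hV hd ⟨hs.1.le, hs.2.le⟩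
    ⟨h0, ht.2⟩).trans (ENNReal.ofReal_le_ofReal ?_))
  have hC := nlinConst_nonneg (N := N)
  have hM := hU.nonneg
  have hD := hd.nonneg
  have := inv_weight_anti hs.1 (le_max_left s t) (max_le hs.2.le ht.2)
  gcongr

/-- Lipschitz dependence of small mild solutions on the initial value. -/
theorem classNorm_sub_le {T A : ℝ} (hA0 : 0 ≤ A) (hA : 12 * nlinConst N * A ≤ 1)
    {u₀ v₀ : LogBesov N T} {u v : ℝ → LogBesov N T}
    (hu : InClass T u) (hus : IsMildSolution T u₀ u) (hue : pathNorm T u ≤ ENNReal.ofReal A)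
    (hv : InClass T v) (hvs : IsMildSolution T v₀ v) (hve : pathNorm T v ≤ ENNReal.ofReal A) :
    classNorm T (u - v) ≤
      ENNReal.ofReal (4 + heatMass N) * logBesovNorm T ((u₀ - v₀ : LogBesov N T) : VDist N) := by
  have hC := nlinConst_nonneg (N := N)
  have hm := heatMass_nonneg (N := N)
  have hpe : pathNorm T (u - v) ≤ ENNReal.ofReal (2 * A) := by
    rw [two_mul, ENNReal.ofReal_add hA0 hA0]
    exact (pathNorm_sub_le T u v).trans (add_le_add hue hve)
  set D : ℝ := (pathNorm T (u - v)).toReal with hD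
  have hDp : pathNorm T (u - v) = ENNReal.ofReal D :=
    (ENNReal.ofReal_toReal (hpe.trans_lt ENNReal.ofReal_lt_top).ne).symm
  have hD0 : 0 ≤ D := ENNReal.toReal_nonneg
  have hDA : D ≤ 2 * A := by
    rwa [hDp, ENNReal.ofReal_le_ofReal_iff (by positivity)] at hpe
  set d : ℝ := (logBesovNorm T ((u₀ - v₀ : LogBesov N T) : VDist N)).toReal with hd
  have hd0 : 0 ≤ d := ENNReal.toReal_nonneg
  have hdp : logBesovNorm T ((u₀ - v₀ : LogBesov N T) : VDist N) = ENNReal.ofReal d :=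
    (ENNReal.ofReal_toReal (u₀ - v₀).2.2.ne).symm
  obtain ⟨U, hU, hUrep⟩ := hu.exists_field hA0 hue
  -- A separate field W of the exact size D = ‖u - v‖ represents the difference, and v is then
  -- represented by U - W. The difference of the two fields thus has size D at every point, instead
  -- of 2A.
  obtain ⟨W, hW, hWrep, -⟩ := exists_field_of_path (p := fun t => ((u - v) t : VDist N)) hD0
    (fun φ => ((hu.weakStar.continuousOn_apply φ).sub (hv.weakStar.continuousOn_apply φ)).mono
      Ioo_subset_Icc_self)
    (fun t ht => (le_iSup₂ (f := fun (s : ℝ) (_ : s ∈ Ioo (0 : ℝ) T) =>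
      ENNReal.ofReal (weight T s) * linfNorm ((u - v) s : VDist N)) t ht).trans hDp.le)
    (fun t ht => isReal_sub (hu.real t (Ioo_subset_Icc_self ht)) (hv.real t (Ioo_subset_Icc_self ht)))
  have hpos : ∀ t ∈ Ioo 0 T, 0 < (weight T t)⁻¹ := fun t ht => inv_pos.2 (weight_pos ht.1 ht.2.le)
  have hVrep : ∀ t ∈ Ioo 0 T, IsRep (v t : VDist N) ((U - W) t) (A * (weight T t)⁻¹ + D * (weight T t)⁻¹) := by
    intro t ht
    have h := (hUrep t ht).sub (hWrep t ht)
    have he : (u t : VDist N) - ((u - v) t : VDist N) = v t := sub_sub_cancel _ _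
    rw [he] at h
    exact h
  -- A common radius for U and U - W: their sizes are A and A + D, and D ≤ 2A.
  have hU' : IsField T (3 * A) U := hU.mono (by linarith)
  have hV' : IsField T (3 * A) (U - W) := (hU.sub hW).mono (by linarith)
  have hUV : IsField T D (U - (U - W)) := by rwa [sub_sub_cancel]
  have hueq := (isMildSolution_iff hU fun t ht => (hUrep t ht).linfRep_ae_eq
    (mul_nonneg hA0 (hpos t ht).le)).1 hus
  have hveq := (isMildSolution_iff hV' fun t ht => (hVrep t ht).linfRep_ae_eq
    (add_nonneg (mul_nonneg hA0 (hpos t ht).le) (mul_nonneg hD0 (hpos t ht).le))).1 hvs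
  have hdiff : ∀ t ∈ Icc 0 T, ((u - v) t : VDist N) = heat t ((u₀ - v₀ : LogBesov N T) : VDist N) -
      (nlinDist U U t - nlinDist (U - W) (U - W) t) := by
    intro t ht
    have h1 : ((u - v) t : VDist N) = (u t : VDist N) - (v t : VDist N) := rfl
    have h2 : ((u₀ - v₀ : LogBesov N T) : VDist N) = (u₀ : VDist N) - (v₀ : VDist N) := rfl
    rw [h1, h2, hueq t ht, hveq t ht, map_sub]
    exact sub_sub_sub_comm _ _ _ _
  -- The Lipschitz constant on the ball of radius 3A is 6CA, at most 1/2 by the hypothesis 12CA ≤ 1.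
  have hhalf : 2 * nlinConst N * (3 * A) * D ≤ D / 2 := by nlinarith
  have hpath : pathNorm T (u - v) ≤ ENNReal.ofReal (d + D / 2) := by
    rw [ENNReal.ofReal_add hd0 (by positivity)]
    refine iSup₂_le fun (t : ℝ) (ht : t ∈ Ioo (0 : ℝ) T) => ?_
    rw [hdiff t (Ioo_subset_Icc_self ht)]
    refine (mul_le_mul_right (linfNorm_sub_le _ _) _).trans ?_
    rw [mul_add]
    refine add_le_add ((weight_mul_linfNorm_le_logBesovNorm ht _).trans hdp.le) ?_
    exact (weight_mul_linfNorm_nlinDist_sub_le hU' hV' hUV ht).trans (ENNReal.ofReal_le_ofReal hhalf)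
  -- D ≤ d + D/2, and D is finite, so the last term is absorbed.
  have hDd : D ≤ 2 * d := by
    rw [hDp, ENNReal.ofReal_le_ofReal_iff (by positivity)] at hpath
    linarith
  have hbesov : ∀ t ∈ Icc 0 T, logBesovNorm T ((u - v) t : VDist N) ≤
      ENNReal.ofReal ((1 + heatMass N) * d + D / 2) := by
    intro t ht
    rw [hdiff t ht, ENNReal.ofReal_add (by positivity) (by positivity)]
    refine (logBesovNorm_sub_le T _ _).trans (add_le_add ?_ ?_)
    · rw [ENNReal.ofReal_mul (by positivity), ← hdp]
      exact logBesovNorm_heat_le ht.1 _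
    · exact (logBesovNorm_nlinDist_sub_le hU' hV' hUV ht).trans (ENNReal.ofReal_le_ofReal hhalf)
  calc classNorm T (u - v) ≤ ENNReal.ofReal ((1 + heatMass N) * d + D / 2) + ENNReal.ofReal D :=
        add_le_add (iSup₂_le hbesov) hDp.le
    _ = ENNReal.ofReal ((1 + heatMass N) * d + D / 2 + D) :=
        (ENNReal.ofReal_add (by positivity) hD0).symm
    -- The terms D/2 + D amount to at most 3d, which is added to (1 + `heatMass N`)d.
    _ ≤ ENNReal.ofReal ((4 + heatMass N) * d) := ENNReal.ofReal_le_ofReal (by nlinarith)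
    _ = _ := by rw [hdp, ENNReal.ofReal_mul (by positivity)]

end LogBesovNS

end

/-! ### Conclusion -/

theorem theorem2p1 (N : ℕ) (hN : 2 ≤ N) (T : ℝ) (hT : 0 < T) :
    ∃ ε : ℝ, 0 < ε ∧
      (∀ u₀ : LogBesov N T, LogBesovNS.IsReal (u₀ : VDist N) → IsDivFree (u₀ : VDist N) →
        logBesovNorm T (u₀ : VDist N) ≤ ENNReal.ofReal ε →
        ∃ u : ℝ → LogBesov N T, (InClass T u ∧ IsMildSolution T u₀ u) ∧
          ∀ v : ℝ → LogBesov N T, InClass T v → IsMildSolution T u₀ v →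
            Set.EqOn v u (Set.Icc 0 T)) ∧
      ∃ K : NNReal, ∀ (u₀ v₀ : LogBesov N T) (u v : ℝ → LogBesov N T),
        LogBesovNS.IsReal (u₀ : VDist N) → IsDivFree (u₀ : VDist N) →
        logBesovNorm T (u₀ : VDist N) ≤ ENNReal.ofReal ε →
        LogBesovNS.IsReal (v₀ : VDist N) → IsDivFree (v₀ : VDist N) →
        logBesovNorm T (v₀ : VDist N) ≤ ENNReal.ofReal ε →
        InClass T u → IsMildSolution T u₀ u →
        InClass T v → IsMildSolution T v₀ v →
        classNorm T (u - v) ≤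
          K * logBesovNorm T ((u₀ - v₀ : LogBesov N T) : VDist N) := by
  have hC := nlinConst_nonneg (N := N)
  -- Picard iteration needs 8Cε ≤ 1. Its solutions have size 2ε, so the Lipschitz estimate needs 12C
  -- · 2ε ≤ 1. The added 1 keeps the denominator positive when only C ≥ 0 is known.
  set ε : ℝ := 1 / (24 * (nlinConst N + 1)) with hε
  have hε0 : 0 < ε := by positivity
  have hε1 : 24 * nlinConst N * ε ≤ 1 := by
    rw [hε, mul_one_div, div_le_one (by positivity)]
    linarith
  have hε8 : 8 * nlinConst N * ε ≤ 1 := by nlinarith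
  -- The Lipschitz claim concerns arbitrary solutions in the class, for which no size is assumed;
  -- uniqueness identifies each of them with the small Picard solution.
  have hsmall : ∀ (w₀ : LogBesov N T) (w : ℝ → LogBesov N T), LogBesovNS.IsReal (w₀ : VDist N) →
      IsDivFree (w₀ : VDist N) → logBesovNorm T (w₀ : VDist N) ≤ ENNReal.ofReal ε →
      InClass T w → IsMildSolution T w₀ w → pathNorm T w ≤ ENNReal.ofReal (2 * ε) := by
    intro w₀ w hr hdiv hle hw hws
    obtain ⟨w', hw', hws', hp⟩ := exists_mildSolution hT hε0.le hε8 w₀ hr hdiv hle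
    rwa [pathNorm_congr (IsMildSolution.eqOn hT hw' hws' hw hws)]
  refine ⟨ε, hε0, fun u₀ hr hdiv hle => ?_, (4 + heatMass N).toNNReal, ?_⟩
  · obtain ⟨u, hu, hus, -⟩ := exists_mildSolution hT hε0.le hε8 u₀ hr hdiv hle
    exact ⟨u, ⟨hu, hus⟩, fun v hv hvs => IsMildSolution.eqOn hT hu hus hv hvs⟩
  · intro u₀ v₀ u v hru hdu hlu hrv hdv hlv hu hus hv hvs
    exact classNorm_sub_le (by positivity) (by linarith) hu hus (hsmall u₀ u hru hdu hlu hu hus)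
      hv hvs (hsmall v₀ v hrv hdv hlv hv hvs)
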